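/- Let $M$ be a (Hausdorff) smooth manifold of dimension $m_0$ and let $E\to M$ be a smooth real vector bundle of rank $m_1$. Let $E[1]=(M,C)$ be the associated degree-1 manifold, whose functions over an open set $U\subseteq M$ are $C(U)=\Gamma(U,\wedge^\bullet E^*)$. A vector field of degree $k\in\mathbb Z$ on $E[1]|_U$ is an $\mathbb R$-linear map $X:C(U)\to C(U)$ of degree $k$ with $X(fg)=X(f)g+(-1)^{k|f|}fX(g)$ for $f$ homogeneous; vector fields form a sheaf $\mathcal T^\bullet=\bigoplus_k\mathcal T^k$ of $C$-modules, with bracket $[X,Y]=XY-(-1)^{|X||Y|}YX$ on homogeneous elements. A vector field $X$ on $U$ defines at each $p\in U$ the tangent vector $X_p(f)=X(f)^0(p)$, where $(\cdot)^0$ is the degree $0$ component. A distribution of rank $d_0|d_1$ on $E[1]$ is a subsheaf $\mathcal D\subseteq\mathcal T^\bullet$ of $C$-modules, containing the homogeneous components of its sections, such that every point of $M$ has an open neighbourhood $U$ for which $\mathcal D(U)$ is generated over $C(U)$ by $d_0$ vector fields of degree $0$ and $d_1$ vector fields of degree $-1$ whose tangent vectors are (jointly) linearly independent at each point of $U$.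 It is involutive if it is closed under the bracket. Coordinates $\{x^\alpha,e^\beta\}$ on $E[1]|_U$, with $\alpha=1,\dots,m_0$ and $\beta=1,\dots,m_1$, consist of local coordinates $\{x^\alpha\}$ of $M$ with domain $U$ and a frame $\{e^\beta\}$ of $E^*|_U$; $\partial/\partial x^\alpha$ and $\partial/\partial e^\beta$ denote the vector fields of degree $0$ and $-1$ on $E[1]|_U$ with $\frac{\partial}{\partial x^\alpha}(x^{\alpha'})=\delta_{\alpha\alpha'}$, $\frac{\partial}{\partial x^\alpha}(e^{\beta})=0$, $\frac{\partial}{\partial e^\beta}(x^{\alpha})=0$, $\frac{\partial}{\partial e^\beta}(e^{\beta'})=\delta_{\beta\beta'}$. Proposition (Frobenius theorem in degree 1). Let $\mathcal D$ be an involutive distribution of rank $d_0|d_1$ on $E[1]$. Then every point of $M$ has an open neighbourhood $U$ with coordinates $\{x^\alpha,e^\beta\}$ on $E[1]|_U$ such that (with $d_0\le m_0$ and $d_1\le m_1$) $$\mathcal D(U)=\Big\langle\frac{\partial}{\partial x^1},\dots,\frac{\partial}{\partial x^{d_0}},\frac{\partial}{\partial e^1},\dots,\frac{\partial}{\partial e^{d_1}}\Big\rangle$$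 as a $C(U)$-module. -/

import Mathlib

open scoped Manifold ContDiff
open TopologicalSpace

/-! The degree-1 manifold `E[1] = (M, Γ(⋀• E*))` of a smooth real vector bundle `E → M`,
its vector fields, distributions and local coordinates.
`M` is a smooth manifold of dimension `m₀`; `E : M → Type*` is a vector bundle with model
fibre `F`. -/

namespace DegreeOne

noncomputable section

instance exteriorAlgebra_finite {W : Type*} [AddCommGroup W] [Module ℝ W] [Module.Finite ℝ W] :
    Module.Finite ℝ (ExteriorAlgebra ℝ W) :=
  Module.Finite.of_basis (Module.finBasis ℝ W).ExteriorAlgebra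

section

variable (m₀ : ℕ) {M : Type*} [TopologicalSpace M]
  [ChartedSpace (EuclideanSpace ℝ (Fin m₀)) M]
  (F : Type*) [NormedAddCommGroup F] [NormedSpace ℝ F] [FiniteDimensional ℝ F]
  (E : M → Type*) [∀ p, AddCommGroup (E p)] [∀ p, Module ℝ (E p)]
  [∀ p, TopologicalSpace (E p)] [TopologicalSpace (Bundle.TotalSpace F E)]
  [FiberBundle F E] [VectorBundle ℝ F E]

/-- The fibre `⋀• E_p*`. -/
abbrev Fibre (p : M) : Type _ := ExteriorAlgebra ℝ (Module.Dual ℝ (E p))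

/-- The map `⋀• E_p* → ⋀• F*` induced by the preferred local trivialization of `E` around `p₀`.
It is an isomorphism for `p` in the domain of that trivialization. -/
def localRep (p₀ p : M) : Fibre E p →ₐ[ℝ] ExteriorAlgebra ℝ (Module.Dual ℝ F) :=
  ExteriorAlgebra.map ((trivializationAt F E p₀).symmₗ ℝ p).dualMap

/-- Smoothness of a section of `⋀• E*` over `U`: around every point, all its components in a
local trivialization (a map to the finite-dimensional space `⋀• F*`) are smooth. -/
def IsSmoothSection (U : Opens M) (σ : ∀ p : U, Fibre E (p : M)) : Prop :=
  ∀ (p₀ : U) (φ : Module.Dual ℝ (ExteriorAlgebra ℝ (Module.Dual ℝ F))),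
    ContMDiffAt (𝓡 m₀) 𝓘(ℝ, ℝ) ∞ (fun p : U => φ (localRep F E (p₀ : M) (p : M) (σ p))) p₀

theorem isSmoothSection_mul {U : Opens M} {σ η : ∀ p : U, Fibre E (p : M)}
    (hσ : IsSmoothSection m₀ F E U σ) (hη : IsSmoothSection m₀ F E U η) :
    IsSmoothSection m₀ F E U (σ * η) := by
  intro p₀ φ
  let b := Module.finBasis ℝ (ExteriorAlgebra ℝ (Module.Dual ℝ F))
  have key : (fun p : U => φ (localRep F E (p₀ : M) (p : M) ((σ * η) p))) =
      fun p : U => ∑ i, ∑ j, (b.coord i (localRep F E (p₀ : M) (p : M) (σ p)) *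
        b.coord j (localRep F E (p₀ : M) (p : M) (η p))) * φ (b i * b j) := by
    funext p
    have hmul : localRep F E (p₀ : M) (p : M) ((σ * η) p) =
        localRep F E (p₀ : M) (p : M) (σ p) * localRep F E (p₀ : M) (p : M) (η p) :=
      map_mul _ _ _
    rw [hmul]
    generalize localRep F E (p₀ : M) (p : M) (σ p) = u
    generalize localRep F E (p₀ : M) (p : M) (η p) = v
    conv_lhs => rw [← b.sum_repr u, ← b.sum_repr v]
    simp only [Finset.sum_mul_sum, map_sum, smul_mul_smul_comm, map_smul, smul_eq_mul,
      Module.Basis.coord_apply]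
  rw [key]
  refine ContMDiffAt.sum fun i _ => ContMDiffAt.sum fun j _ => ?_
  exact ((hσ p₀ _).mul (hη p₀ _)).mul contMDiffAt_const

theorem isSmoothSection_of_fun {U : Opens M} {g : U → ℝ} (hg : ContMDiff (𝓡 m₀) 𝓘(ℝ, ℝ) ∞ g) :
    IsSmoothSection m₀ F E U (fun p => algebraMap ℝ (Fibre E (p : M)) (g p)) := by
  intro p₀ φ
  have key : (fun p : U => φ (localRep F E (p₀ : M) (p : M)
      (algebraMap ℝ (Fibre E (p : M)) (g p)))) = fun p : U => g p * φ 1 := by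
    funext p
    rw [AlgHom.commutes, Algebra.algebraMap_eq_smul_one, map_smul, smul_eq_mul]
  rw [key]
  exact (hg p₀).mul contMDiffAt_const

/-- The algebra `C(U) = Γ(U, ⋀• E*)` of functions on `E[1]|_U`. -/
def functions (U : Opens M) : Subalgebra ℝ (∀ p : U, Fibre E (p : M)) where
  carrier := {σ | IsSmoothSection m₀ F E U σ}
  mul_mem' := isSmoothSection_mul m₀ F E
  add_mem' := by
    intro σ η hσ hη p₀ φ
    have key : (fun p : U => φ (localRep F E (p₀ : M) (p : M) ((σ + η) p))) = fun p : U =>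
        φ (localRep F E (p₀ : M) (p : M) (σ p)) + φ (localRep F E (p₀ : M) (p : M) (η p)) := by
      funext p
      rw [Pi.add_apply, map_add, map_add]
    rw [key]
    exact (hσ p₀ φ).add (hη p₀ φ)
  algebraMap_mem' r := isSmoothSection_of_fun m₀ F E (g := fun _ => r) contMDiff_const

/-- A smooth function on `U`, as a function of degree `0` on `E[1]|_U`. -/
def ofSmooth {U : Opens M} (g : U → ℝ) (hg : ContMDiff (𝓡 m₀) 𝓘(ℝ, ℝ) ∞ g) :
    functions m₀ F E U :=
  ⟨fun p => algebraMap ℝ (Fibre E (p : M)) (g p), isSmoothSection_of_fun m₀ F E hg⟩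

variable {m₀ F E} in
/-- The restriction of functions from `U` to `U' ⊆ U`. -/
def restrict {U' U : Opens M} (h : U' ≤ U) : functions m₀ F E U →ₐ[ℝ] functions m₀ F E U' where
  toFun f := ⟨fun p => f.1 (Opens.inclusion h p), fun p₀ φ =>
    (f.2 (Opens.inclusion h p₀) φ).comp (x := p₀)
      (f := Opens.inclusion h) (contMDiff_inclusion h).contMDiffAt⟩
  map_one' := rfl
  map_mul' _ _ := rfl
  map_zero' := rfl
  map_add' _ _ := rfl
  commutes' _ := rfl

/-- The homogeneous functions of degree `l` on `E[1]|_U`: the sections of `⋀ˡ E*`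
(only `0` if `l < 0`). -/
def homogeneous (U : Opens M) : ℤ → Submodule ℝ (functions m₀ F E U)
  | Int.ofNat l =>
    { carrier := {f | ∀ p : U, f.1 p ∈ ⋀[ℝ]^l (Module.Dual ℝ (E (p : M)))}
      zero_mem' := fun _ => Submodule.zero_mem _
      add_mem' := fun hf hg p => Submodule.add_mem _ (hf p) (hg p)
      smul_mem' := fun c _ hf p => Submodule.smul_mem _ c (hf p) }
  | Int.negSucc _ => ⊥

/-- The `ℝ`-linear endomorphisms of `C(U)`. They form a `C(U)`-module by `(f • X) g = f * X g`. -/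
abbrev Endo (U : Opens M) : Type _ := functions m₀ F E U →ₗ[ℝ] functions m₀ F E U

/-- `X` is a vector field of degree `k` on `E[1]|_U`, that is a derivation of `C(U)` of
degree `k`: `|X f| = |f| + k` and `X (f g) = (X f) g + (-1)^{k |f|} f (X g)`. -/
structure IsVectorField (U : Opens M) (k : ℤ) (X : Endo m₀ F E U) : Prop where
  degree : ∀ (i : ℤ), ∀ f ∈ homogeneous m₀ F E U i, X f ∈ homogeneous m₀ F E U (i + k)
  leibniz : ∀ (i : ℤ), ∀ f ∈ homogeneous m₀ F E U i, ∀ g,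
    X (f * g) = X f * g + ((-1 : ℝ) ^ (i * k)) • (f * X g)

/-- The space `𝒯ᵏ(U)` of vector fields of degree `k`. -/
def vectorFieldsOfDegree (U : Opens M) (k : ℤ) : Submodule ℝ (Endo m₀ F E U) where
  carrier := {X | IsVectorField m₀ F E U k X}
  zero_mem' := ⟨fun _ _ _ => Submodule.zero_mem _, fun _ _ _ _ => by simp⟩
  add_mem' := by
    intro X Y hX hY
    refine ⟨fun i f hf => Submodule.add_mem _ (hX.degree i f hf) (hY.degree i f hf),
      fun i f hf g => ?_⟩
    simp only [LinearMap.add_apply, hX.leibniz i f hf g, hY.leibniz i f hf g, add_mul, mul_add,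
      smul_add]
    abel
  smul_mem' := by
    intro c X hX
    refine ⟨fun i f hf => Submodule.smul_mem _ c (hX.degree i f hf), fun i f hf g => ?_⟩
    simp only [LinearMap.smul_apply, hX.leibniz i f hf g, smul_add, smul_mul_assoc,
      mul_smul_comm, smul_comm c]

/-- The space `𝒯•(U) = ⨁ₖ 𝒯ᵏ(U)` of vector fields on `E[1]|_U`. -/
def vectorFields (U : Opens M) : Submodule ℝ (Endo m₀ F E U) :=
  ⨆ k : ℤ, vectorFieldsOfDegree m₀ F E U k

variable {m₀ F E}

/-- The vector field `Y` on `U'` is the restriction of the vector field `X` on `U ⊇ U'`: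
`Y (f|_U') = (X f)|_U'` for all `f ∈ C(U)`. (On a Hausdorff manifold derivations are local, so
each vector field has exactly one restriction.) -/
def IsRestriction {U' U : Opens M} (h : U' ≤ U) (X : Endo m₀ F E U) (Y : Endo m₀ F E U') : Prop :=
  ∀ f, Y (restrict h f) = restrict h (X f)

/-- The graded commutator `XY - (-1)^{kl} YX` of `X` and `Y` of degrees `k` and `l`. -/
def bracket {U : Opens M} (k l : ℤ) (X Y : Endo m₀ F E U) : Endo m₀ F E U :=
  X ∘ₗ Y - ((-1 : ℝ) ^ (k * l)) • (Y ∘ₗ X)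

/-- The tangent vector `X_p : f ↦ (X f)⁰(p)` defined by `X`. (It is written as a functional on
`C(U)`; on a Hausdorff manifold `C(U)` maps onto the stalk at `p`, through which it factors.) -/
def tangentVector {U : Opens M} (X : Endo m₀ F E U) (p : U) :
    Module.Dual ℝ (functions m₀ F E U) where
  toFun f := ExteriorAlgebra.algebraMapInv ((X f).1 p)
  map_add' f g := by
    rw [map_add, ← map_add ExteriorAlgebra.algebraMapInv]; rfl
  map_smul' c f := by
    rw [map_smul, RingHom.id_apply, ← map_smul ExteriorAlgebra.algebraMapInv]; rfl

variable (m₀ F E)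

/-- A distribution on `E[1]` of rank `d₀|d₁`: a graded subsheaf of `C`-modules of the sheaf of
vector fields, locally generated by `d₀` vector fields of degree `0` and `d₁` vector fields of
degree `-1` that are linearly independent at each point. -/
structure Distribution (d₀ d₁ : ℕ) where
  sections : ∀ U : Opens M, Submodule (functions m₀ F E U) (Endo m₀ F E U)
  isVectorField : ∀ (U : Opens M), ∀ X ∈ sections U, X ∈ vectorFields m₀ F E U
  /-- closed under restriction -/
  restriction : ∀ {U' U : Opens M} (h : U' ≤ U), ∀ X ∈ sections U, ∀ Y ∈ vectorFields m₀ F E U',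
    IsRestriction h X Y → Y ∈ sections U'
  /-- a vector field that is locally in the subsheaf is in the subsheaf -/
  gluing : ∀ (U : Opens M), ∀ X ∈ vectorFields m₀ F E U,
    (∀ p ∈ U, ∃ (U' : Opens M) (h : U' ≤ U), p ∈ U' ∧ ∃ Y ∈ sections U', IsRestriction h X Y) →
    X ∈ sections U
  /-- contains the homogeneous components of each of its sections -/
  graded : ∀ (U : Opens M) (X : ℤ →₀ Endo m₀ F E U),
    (∀ k, X k ∈ vectorFieldsOfDegree m₀ F E U k) → (X.sum fun _ Y => Y) ∈ sections U →
    ∀ k, X k ∈ sections U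
  locallyGenerated : ∀ p : M, ∃ U : Opens M, p ∈ U ∧
    ∃ (X : Fin d₀ → Endo m₀ F E U) (Y : Fin d₁ → Endo m₀ F E U),
      (∀ i, X i ∈ vectorFieldsOfDegree m₀ F E U 0) ∧
      (∀ j, Y j ∈ vectorFieldsOfDegree m₀ F E U (-1)) ∧
      (∀ q : U, LinearIndependent ℝ
        (Sum.elim (fun i => tangentVector (X i) q) (fun j => tangentVector (Y j) q))) ∧
      sections U = Submodule.span (functions m₀ F E U) (Set.range X ∪ Set.range Y)

variable {m₀ F E} in
/-- A distribution is involutive if it is closed under the Lie bracket of vector fields. -/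
def Distribution.IsInvolutive {d₀ d₁ : ℕ} (D : Distribution m₀ F E d₀ d₁) : Prop :=
  ∀ (U : Opens M) (k l : ℤ) (X Y : Endo m₀ F E U),
    X ∈ vectorFieldsOfDegree m₀ F E U k → Y ∈ vectorFieldsOfDegree m₀ F E U l →
    X ∈ D.sections U → Y ∈ D.sections U → bracket k l X Y ∈ D.sections U

/-- Coordinates `{x^α, e^β}` on `E[1]|_U`, where `α = 1, …, m₀` and `β = 1, …, m₁`: a chart of `M`
with domain `U` together with a frame `{e^β}` of `E*` over `U`. -/
structure Coordinates (m₁ : ℕ) (U : Opens M) where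
  chart : OpenPartialHomeomorph M (EuclideanSpace ℝ (Fin m₀))
  chart_mem : chart ∈ IsManifold.maximalAtlas (𝓡 m₀) ∞ M
  chart_source : chart.source = U
  e : Fin m₁ → functions m₀ F E U
  e_mem : ∀ β, e β ∈ homogeneous m₀ F E U 1
  linearIndependent : ∀ p : U, LinearIndependent ℝ fun β => (e β).1 p
  span_eq : ∀ p : U, Submodule.span ℝ (Set.range fun β => (e β).1 p) =
    ⋀[ℝ]^1 (Module.Dual ℝ (E (p : M)))

namespace Coordinates

variable {m₀ F E} {m₁ : ℕ} {U : Opens M} (c : Coordinates m₀ F E m₁ U)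

/-- The coordinate `x^α`, a function of degree `0` on `E[1]|_U`. -/
def x (α : Fin m₀) : functions m₀ F E U :=
  ofSmooth m₀ F E (fun p : U => c.chart (p : M) α) <| by
    have hc : ContMDiffOn (𝓡 m₀) (𝓡 m₀) ∞ c.chart c.chart.source :=
      contMDiffOn_of_mem_maximalAtlas c.chart_mem
    have h1 : ContMDiff (𝓡 m₀) (𝓡 m₀) ∞ (fun p : U => c.chart (p : M)) :=
      hc.comp_contMDiff contMDiff_subtype_val fun p => by
        rw [c.chart_source]; exact p.2
    exact (EuclideanSpace.proj (𝕜 := ℝ) α).contMDiff.comp h1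

/-- `X` is the coordinate vector field `∂/∂x^α`. -/
structure IsPartialX (α : Fin m₀) (X : Endo m₀ F E U) : Prop where
  mem : X ∈ vectorFieldsOfDegree m₀ F E U 0
  apply_x : ∀ α', X (c.x α') = if α = α' then 1 else 0
  apply_e : ∀ β, X (c.e β) = 0

/-- `X` is the coordinate vector field `∂/∂e^β`. -/
structure IsPartialE (β : Fin m₁) (X : Endo m₀ F E U) : Prop where
  mem : X ∈ vectorFieldsOfDegree m₀ F E U (-1)
  apply_x : ∀ α, X (c.x α) = 0
  apply_e : ∀ β', X (c.e β') = if β = β' then 1 else 0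

end Coordinates

end

end

end DegreeOne

/-! Take a local frame of the distribution, `X i` of degree 0 and `Y j` of degree -1. In
coordinates, `X i` moves the base along an ordinary vector field v_i and acts on functions of degree
1 (sections of E*) by ∇_i ξ = dξ(v_i) + ξ ∘ K_i, while `Y j` is contraction with a section w_j of E.
Independence of the tangent vectors makes the v_i, and separately the w_j, independent near a given
point. Hence d₀ ≤ m₀, d₁ ≤ m₁, and the w_j span a subbundle B of E.

An invertible matrix of functions normalises the v_i so that ℓ_j(v_i) = δ_ij for fixed linear
functions ℓ_j. Then X_i ℓ_j is constant and Y_i ℓ_j = 0, so the brackets [X, X] and [Y, X] kill all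
ℓ_j, and involutivity makes them combinations of the Y alone. In components: the v_i commute, the
∇_i preserve the annihilator B° of B, and they commute on B°. What remains is an ordinary integrable
distribution on M with a flat partial connection on B°.

Both are integrated at once. After a linear splitting of the base coordinates into (x, y), the
distribution consists of the vectors (h, b h), and the connection has a matrix θ on a frame ζ of B°.
Leaves and parallel transport together solve one total differential equation ∂u/∂x = f(x, u), whose
integrability condition is commutation plus flatness. `exists_solution_total_differential` solves it
along rays: the solution curve is found as a zero of a smooth map on a Banach space of curves, the
inverse function theorem gives smooth dependence on parameters, and integrability identifies the
derivative in x. `exists_straightening` extracts a diffeomorphism straightening the v_i and an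
invertible G for which G ζ is parallel.

The new coordinates are the straightened base coordinates, d₁ forms with constant coefficients dual
to the w_j, and the parallel frame of B°. In them Y_j = ∂/∂e^j, and X_i differs from ∂/∂x^i by a
combination of the Y, which gives the claim (`sections_eq_span`). Underneath lie two facts on vector
fields: they are local operators, and by Hadamard's lemma and the Leibniz rule they are determined
by their values on coordinates (`eq_sum_partials`). Sections of the distribution over smaller open
sets are controlled pointwise, through `Distribution.SpannedBy`. -/

set_option linter.unusedSectionVars false

/-! ### Smoothness of superposition operators; the inverse function theorem -/

namespace DegreeOne

noncomputable section

open Set Filter Topology unitInterval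

section Superposition

universe u v

variable {K : Type v} [TopologicalSpace K] [CompactSpace K]

/-- The pointwise application of a family of continuous linear maps, as a continuous bilinear
map. -/
def pointwiseApply (K : Type v) [TopologicalSpace K] [CompactSpace K]
    (Y Z : Type u) [NormedAddCommGroup Y] [NormedSpace ℝ Y]
    [NormedAddCommGroup Z] [NormedSpace ℝ Z] :
    C(K, Y →L[ℝ] Z) →L[ℝ] C(K, Y) →L[ℝ] C(K, Z) :=
  LinearMap.mkContinuous₂
    (LinearMap.mk₂ ℝ (fun (A : C(K, Y →L[ℝ] Z)) (h : C(K, Y)) =>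
        (⟨fun t => A t (h t), A.continuous.clm_apply h.continuous⟩ : C(K, Z)))
      (fun _ _ _ => rfl) (fun _ _ _ => rfl)
      (fun A h k => by ext t; exact map_add (A t) _ _)
      (fun c A h => by ext t; exact map_smul (A t) _ _)) 1 fun A h => by
    rw [one_mul]
    refine (ContinuousMap.norm_le _ (mul_nonneg (norm_nonneg A) (norm_nonneg h))).2 fun t => ?_
    exact ((A t).le_opNorm _).trans
      (mul_le_mul (A.norm_coe_le_norm t) (h.norm_coe_le_norm t) (norm_nonneg _) (norm_nonneg _))

@[simp]
theorem pointwiseApply_apply {Y Z : Type u} [NormedAddCommGroup Y] [NormedSpace ℝ Y]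
    [NormedAddCommGroup Z] [NormedSpace ℝ Z] (A : C(K, Y →L[ℝ] Z)) (h : C(K, Y)) (t : K) :
    pointwiseApply K Y Z A h t = A t (h t) := rfl

/-- The remainder at each t is bounded by the mean value inequality, uniformly in t because `g'`
varies little on a δ-neighbourhood of the values of u. -/
theorem hasFDerivAt_comp_left {Y Z : Type u} [NormedAddCommGroup Y] [NormedSpace ℝ Y]
    [NormedAddCommGroup Z] [NormedSpace ℝ Z] (g : C(Y, Z)) (g' : C(Y, Y →L[ℝ] Z))
    (hg : ∀ y, HasFDerivAt g (g' y) y) (u : C(K, Y)) :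
    HasFDerivAt (fun u : C(K, Y) => g.comp u) (pointwiseApply K Y Z (g'.comp u)) u := by
  rw [hasFDerivAt_iff_isLittleO_nhds_zero, Asymptotics.isLittleO_iff]
  intro ε hε
  have hc : Continuous fun u : C(K, Y) => g'.comp u := ContinuousMap.continuous_postcomp g'
  obtain ⟨δ, hδ, hδ'⟩ := (Metric.continuous_iff (α := C(K, Y)) (β := C(K, Y →L[ℝ] Z))).1 hc u ε hε
  filter_upwards [Metric.ball_mem_nhds (0 : C(K, Y)) hδ] with h hh
  rw [mem_ball_zero_iff] at hh
  refine (ContinuousMap.norm_le _ (by positivity)).2 fun t => ?_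
  have hmain : ‖g (u t + h t) - g (u t) - g' (u t) (u t + h t - u t)‖ ≤ ε * ‖u t + h t - u t‖ := by
    refine (convex_ball (u t) δ).norm_image_sub_le_of_norm_hasFDerivWithin_le'
      (f := g) (f' := fun y => g' y) (φ := g' (u t))
      (fun y _ => (hg y).hasFDerivWithinAt) (fun y hy => ?_)
      (Metric.mem_ball_self hδ) ?_
    -- The uniform modulus of continuity of `g'` along u comes from continuity of `u ↦ g'.comp u` in
    -- the sup norm, tested on u shifted by the constant y - u t.
    · have h1 : dist (u + ContinuousMap.const K (y - u t)) u < δ := by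
        rw [dist_eq_norm, add_sub_cancel_left, ContinuousMap.norm_lt_iff _ hδ]
        exact fun _ => by simpa [dist_eq_norm] using hy
      have h2 := (ContinuousMap.norm_coe_le_norm (g'.comp (u + ContinuousMap.const K (y - u t))
        - g'.comp u) t).trans ((dist_eq_norm _ _).symm.trans_le (hδ' _ h1).le)
      simpa using h2
    · rw [Metric.mem_ball, dist_eq_norm, add_sub_cancel_left]
      exact (h.norm_coe_le_norm t).trans_lt hh
  rw [add_sub_cancel_left] at hmain
  exact hmain.trans (mul_le_mul_of_nonneg_left (h.norm_coe_le_norm t) hε.le)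

/-- Superposition operators with smooth kernel are smooth. -/
theorem contDiff_comp_left {Y Z : Type u} [NormedAddCommGroup Y] [NormedSpace ℝ Y]
    [NormedAddCommGroup Z] [NormedSpace ℝ Z] (g : C(Y, Z)) (hg : ContDiff ℝ ∞ g) :
    ContDiff ℝ ∞ (fun u : C(K, Y) => g.comp u) := by
  rw [contDiff_infty]
  intro n
  -- The derivative is again built from a superposition operator, with kernel valued in `Y →L[ℝ] Z`,
  -- so the target has to vary in the induction.
  induction n generalizing Z with
  | zero => exact contDiff_zero.2 (ContinuousMap.continuous_postcomp g)
  | succ n ih =>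
    have hg' : ContDiff ℝ ∞ (fderiv ℝ g) := hg.fderiv_right (by simp)
    let g' : C(Y, Y →L[ℝ] Z) := ⟨fderiv ℝ g, hg'.continuous⟩
    rw [Nat.cast_add, Nat.cast_one, contDiff_succ_iff_hasFDerivAt]
    exact ⟨fun u => pointwiseApply K Y Z (g'.comp u),
      (ih g' hg').continuousLinearMap_comp (pointwiseApply K Y Z),
      hasFDerivAt_comp_left g g' fun y => (hg.differentiable (by simp) y).hasFDerivAt⟩

end Superposition

/-- The inverse function theorem for smooth maps, with a smooth inverse on an open set. -/
theorem exists_smooth_localInverse {X Y : Type*} [NormedAddCommGroup X] [NormedSpace ℝ X]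
    [CompleteSpace X] [NormedAddCommGroup Y] [NormedSpace ℝ Y] {Φ : X → Y} {O : Set X}
    (hO : IsOpen O) (hΦ : ContDiffOn ℝ ∞ Φ O) {x₀ : X} (hx₀ : x₀ ∈ O) (e : X ≃L[ℝ] Y)
    (he : HasFDerivAt Φ (e : X →L[ℝ] Y) x₀) :
    ∃ Θ : OpenPartialHomeomorph X Y, x₀ ∈ Θ.source ∧ Θ.source ⊆ O ∧ (Θ : X → Y) = Φ ∧
      ContDiffOn ℝ ∞ Θ.symm Θ.target ∧
      ∀ x ∈ Θ.source, ∃ e' : X ≃L[ℝ] Y, HasFDerivAt Φ (e' : X →L[ℝ] Y) x := by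
  have hat : ∀ x ∈ O, ContDiffAt ℝ ∞ Φ x := fun x hx => hΦ.contDiffAt (hO.mem_nhds hx)
  let Θ₀ := (hat x₀ hx₀).toOpenPartialHomeomorph Φ he (by simp)
  have hcont : ContinuousOn (fderiv ℝ Φ) O := hΦ.continuousOn_fderiv_of_isOpen hO (by simp)
  -- Restricting to the open set where the derivative is invertible makes the inverse smooth on the
  -- whole target, not merely at the image of x₀.
  let R : Set X := O ∩ fderiv ℝ Φ ⁻¹' (Set.range ((↑) : (X ≃L[ℝ] Y) → (X →L[ℝ] Y)))
  have hR : IsOpen R := hcont.isOpen_inter_preimage hO ContinuousLinearEquiv.isOpen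
  have hR' : ∀ x ∈ R, ∃ e' : X ≃L[ℝ] Y, HasFDerivAt Φ (e' : X →L[ℝ] Y) x := by
    rintro x ⟨hx, e', he'⟩
    exact ⟨e', he' ▸ ((hat x hx).differentiableAt (by simp)).hasFDerivAt⟩
  have hsrc : (Θ₀.restrOpen R hR).source = Θ₀.source ∩ R := rfl
  refine ⟨Θ₀.restrOpen R hR, ?_, ?_, rfl, ?_, ?_⟩
  · exact ⟨(hat x₀ hx₀).mem_toOpenPartialHomeomorph_source he _, hx₀, e, he.fderiv.symm⟩
  · exact fun x hx => hx.2.1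
  · intro y hy
    have hm := (Θ₀.restrOpen R hR).map_target hy
    obtain ⟨e', he'⟩ := hR' _ hm.2
    exact ((Θ₀.restrOpen R hR).contDiffAt_symm hy he' (hat _ hm.2.1)).contDiffWithinAt
  · exact fun x hx => hR' x hx.2

end

end DegreeOne

/-! ### Total differential equations, solved along rays in a Banach space of curves -/

namespace DegreeOne

noncomputable section

open Set Filter Topology unitInterval

section TotalDifferentialEquation

universe u

variable {P Q : Type u} [NormedAddCommGroup P] [NormedSpace ℝ P]
  [NormedAddCommGroup Q] [NormedSpace ℝ Q]

/-- The primitive vanishing at `0` of a continuous curve on the unit interval, on all of `ℝ`. -/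
def primitiveExt (v : C(I, Q)) (t : ℝ) : Q := ∫ s in (0 : ℝ)..t, IccExtend zero_le_one v s

theorem continuous_extend (v : C(I, Q)) : Continuous (IccExtend (zero_le_one' ℝ) v) :=
  v.continuous.Icc_extend'

theorem extend_coe (v : C(I, Q)) (t : I) : IccExtend (zero_le_one' ℝ) v t = v t :=
  IccExtend_val _ _ _

theorem hasDerivAt_primitiveExt [CompleteSpace Q] (v : C(I, Q)) (t : ℝ) :
    HasDerivAt (primitiveExt v) (IccExtend (zero_le_one' ℝ) v t) t :=
  (continuous_extend v).integral_hasStrictDerivAt 0 t |>.hasDerivAt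

/-- The primitive vanishing at `0`, as an operator on continuous curves. -/
def primitive (Q : Type u) [NormedAddCommGroup Q] [NormedSpace ℝ Q] [CompleteSpace Q] :
    C(I, Q) →L[ℝ] C(I, Q) :=
  LinearMap.mkContinuous
    { toFun := fun v => (⟨fun t => primitiveExt v t,
        (continuous_iff_continuousAt.2 fun t => (hasDerivAt_primitiveExt v t).continuousAt).comp
          continuous_subtype_val⟩ : C(I, Q))
      map_add' := fun v w => by
        ext t
        have : IccExtend (zero_le_one' ℝ) (v + w) =
            IccExtend (zero_le_one' ℝ) v + IccExtend (zero_le_one' ℝ) w := rfl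
        simp only [ContinuousMap.coe_mk, ContinuousMap.add_apply, primitiveExt]
        rw [← intervalIntegral.integral_add ((continuous_extend v).intervalIntegrable _ _)
          ((continuous_extend w).intervalIntegrable _ _)]
        rfl
      map_smul' := fun c v => by
        ext t
        simp only [ContinuousMap.coe_mk, ContinuousMap.smul_apply, primitiveExt, RingHom.id_apply]
        rw [← intervalIntegral.integral_smul]
        rfl } 1 fun v => by
    rw [one_mul]
    refine (ContinuousMap.norm_le _ (norm_nonneg v)).2 fun t => ?_
    refine (intervalIntegral.norm_integral_le_of_norm_le_const (C := ‖v‖) fun s _ =>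
      v.norm_coe_le_norm _).trans ?_
    rw [sub_zero, abs_of_nonneg t.2.1]
    exact mul_le_of_le_one_right (norm_nonneg v) t.2.2

theorem primitive_apply [CompleteSpace Q] (v : C(I, Q)) (t : I) :
    primitive Q v t = primitiveExt v t := rfl

/-- The constant curves. -/
def constCurve (Q : Type u) [NormedAddCommGroup Q] [NormedSpace ℝ Q] : Q →L[ℝ] C(I, Q) :=
  LinearMap.mkContinuous
    { toFun := ContinuousMap.const I
      map_add' := fun _ _ => rfl
      map_smul' := fun _ _ => rfl } 1 fun q => by
    rw [one_mul]
    exact (ContinuousMap.norm_le _ (norm_nonneg q)).2 fun t => le_rfl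

@[simp]
theorem constCurve_apply (q : Q) (t : I) : constCurve Q q t = q := rfl

/-- The curve `t ↦ (t x, x, u t)`. -/
def radialLift (P Q : Type u) [NormedAddCommGroup P] [NormedSpace ℝ P]
    [NormedAddCommGroup Q] [NormedSpace ℝ Q] : P × C(I, Q) →L[ℝ] C(I, P × P × Q) :=
  LinearMap.mkContinuous
    { toFun := fun z => (⟨fun t => ((t : ℝ) • z.1, z.1, z.2 t), by fun_prop⟩ : C(I, P × P × Q))
      map_add' := fun _ _ => by ext t <;> simp
      map_smul' := fun c z => by ext t <;> simp [smul_comm c] } 1 fun z => by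
    rw [one_mul]
    refine (ContinuousMap.norm_le _ (norm_nonneg z)).2 fun t => ?_
    refine norm_prod_le_iff.2 ⟨?_, norm_prod_le_iff.2 ⟨norm_fst_le z, ?_⟩⟩
    · refine le_trans ?_ (norm_fst_le z)
      change ‖(t : ℝ) • z.1‖ ≤ _
      rw [norm_smul, Real.norm_of_nonneg t.2.1]
      exact mul_le_of_le_one_left (norm_nonneg _) t.2.2
    · exact (z.2.norm_coe_le_norm t).trans (norm_snd_le z)

@[simp]
theorem radialLift_apply (z : P × C(I, Q)) (t : I) :
    radialLift P Q z t = ((t : ℝ) • z.1, z.1, z.2 t) := rfl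

/-- The kernel `(y, x, q) ↦ f (y, q) x`. -/
def radialKernel (f : P × Q → P →L[ℝ] Q) (hf : ContDiff ℝ ∞ f) : C(P × P × Q, Q) :=
  ⟨fun z => f (z.1, z.2.2) z.2.1,
    ((hf.continuous.comp (by fun_prop : Continuous fun z : P × P × Q => (z.1, z.2.2))).clm_apply
      (by fun_prop))⟩

theorem contDiff_radialKernel (f : P × Q → P →L[ℝ] Q) (hf : ContDiff ℝ ∞ f) :
    ContDiff ℝ ∞ (radialKernel f hf) :=
  (hf.comp (by fun_prop : ContDiff ℝ ∞ fun z : P × P × Q => (z.1, z.2.2))).clm_apply (by fun_prop)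

theorem fderiv_radialKernel (f : P × Q → P →L[ℝ] Q) (hf : ContDiff ℝ ∞ f) (z w : P × P × Q) :
    fderiv ℝ (radialKernel f hf) z w =
      fderiv ℝ f (z.1, z.2.2) (w.1, w.2.2) z.2.1 + f (z.1, z.2.2) w.2.1 := by
  have h1 : HasFDerivAt (fun z : P × P × Q => f (z.1, z.2.2)) _ z :=
    ((hf.differentiable (by simp) (z.1, z.2.2)).hasFDerivAt).comp z
      (hasFDerivAt_fst.prodMk (hasFDerivAt_snd.comp z (hasFDerivAt_snd (𝕜 := ℝ)
        (E := P) (F := P × Q))))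
  have h2 : HasFDerivAt (fun z : P × P × Q => z.2.1) _ z :=
    (hasFDerivAt_fst.comp z (hasFDerivAt_snd (𝕜 := ℝ) (E := P) (F := P × Q)))
  have h3 := (h1.clm_apply h2).fderiv
  change fderiv ℝ (fun z : P × P × Q => f (z.1, z.2.2) z.2.1) z w = _
  rw [h3]
  simp [add_comm]

variable [CompleteSpace P] [CompleteSpace Q]

/-- The derivative of the kernel, as a continuous map. -/
def radialKernelDeriv (f : P × Q → P →L[ℝ] Q) (hf : ContDiff ℝ ∞ f) :
    C(P × P × Q, P × P × Q →L[ℝ] Q) :=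
  ⟨fderiv ℝ (radialKernel f hf), (contDiff_radialKernel f hf).continuous_fderiv (by simp)⟩

/-- The map whose zeros are the solutions `u` of `u' = f (t x, u) x`, `u 0 = q`. -/
def radialMap (f : P × Q → P →L[ℝ] Q) (hf : ContDiff ℝ ∞ f) (z : (P × Q) × C(I, Q)) :
    (P × Q) × C(I, Q) :=
  (z.1, z.2 - constCurve Q z.1.2 -
    primitive Q ((radialKernel f hf).comp (radialLift P Q (z.1.1, z.2))))

/-- The derivative of `radialMap`. -/
def radialMapDeriv (f : P × Q → P →L[ℝ] Q) (hf : ContDiff ℝ ∞ f) (z : (P × Q) × C(I, Q)) :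
    (P × Q) × C(I, Q) →L[ℝ] (P × Q) × C(I, Q) :=
  (ContinuousLinearMap.fst ℝ (P × Q) C(I, Q)).prod
    (ContinuousLinearMap.snd ℝ (P × Q) C(I, Q) -
      constCurve Q ∘L ContinuousLinearMap.snd ℝ P Q ∘L ContinuousLinearMap.fst ℝ (P × Q) C(I, Q) -
      primitive Q ∘L pointwiseApply I (P × P × Q) Q
        ((radialKernelDeriv f hf).comp (radialLift P Q (z.1.1, z.2))) ∘L radialLift P Q ∘L
        (ContinuousLinearMap.fst ℝ P Q ∘L ContinuousLinearMap.fst ℝ (P × Q) C(I, Q)).prod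
          (ContinuousLinearMap.snd ℝ (P × Q) C(I, Q)))

theorem hasFDerivAt_radialMap (f : P × Q → P →L[ℝ] Q) (hf : ContDiff ℝ ∞ f)
    (z : (P × Q) × C(I, Q)) : HasFDerivAt (radialMap f hf) (radialMapDeriv f hf z) z := by
  have h1 := hasFDerivAt_comp_left (K := I) (radialKernel f hf) (radialKernelDeriv f hf)
    (fun y => ((contDiff_radialKernel f hf).differentiable (by simp) y).hasFDerivAt)
    (radialLift P Q (z.1.1, z.2))
  let L := (ContinuousLinearMap.fst ℝ P Q ∘L ContinuousLinearMap.fst ℝ (P × Q) C(I, Q)).prod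
          (ContinuousLinearMap.snd ℝ (P × Q) C(I, Q))
  have h2 : HasFDerivAt (fun z : (P × Q) × C(I, Q) => radialLift P Q (z.1.1, z.2))
      (radialLift P Q ∘L L) z := (radialLift P Q ∘L L).hasFDerivAt
  have h3 := (primitive Q).hasFDerivAt.comp z (h1.comp z h2)
  exact hasFDerivAt_fst.prodMk ((hasFDerivAt_snd.sub
    (constCurve Q ∘L ContinuousLinearMap.snd ℝ P Q ∘L
      ContinuousLinearMap.fst ℝ (P × Q) C(I, Q)).hasFDerivAt).sub h3)

theorem contDiff_radialMap (f : P × Q → P →L[ℝ] Q) (hf : ContDiff ℝ ∞ f) :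
    ContDiff ℝ ∞ (radialMap f hf) := by
  let L := (ContinuousLinearMap.fst ℝ P Q ∘L ContinuousLinearMap.fst ℝ (P × Q) C(I, Q)).prod
          (ContinuousLinearMap.snd ℝ (P × Q) C(I, Q))
  have h2 : ContDiff ℝ ∞ (fun z : (P × Q) × C(I, Q) => radialLift P Q (z.1.1, z.2)) :=
    (radialLift P Q ∘L L).contDiff
  have h3 := ((contDiff_comp_left (K := I) (radialKernel f hf)
    (contDiff_radialKernel f hf)).comp h2).continuousLinearMap_comp (primitive Q)
  exact contDiff_fst.prodMk ((contDiff_snd.sub (constCurve Q ∘L ContinuousLinearMap.snd ℝ P Q ∘L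
      ContinuousLinearMap.fst ℝ (P × Q) C(I, Q)).contDiff).sub h3)

/-- At x = 0 the kernel f(tx, u) x depends to first order on x alone, so the linearisation is
triangular with identities on the diagonal. Because `radialMap` keeps the parameters (x, q) as a
component, the inverse function theorem applied to it acts as the implicit function theorem. -/
theorem radialMapDeriv_const (f : P × Q → P →L[ℝ] Q) (hf : ContDiff ℝ ∞ f) (q₀ : Q) :
    ∃ e : ((P × Q) × C(I, Q)) ≃L[ℝ] (P × Q) × C(I, Q),
      (e : (P × Q) × C(I, Q) →L[ℝ] _) = radialMapDeriv f hf ((0, q₀), constCurve Q q₀) := by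
  refine ⟨(ContinuousLinearEquiv.refl ℝ (P × Q)).skewProd (ContinuousLinearEquiv.refl ℝ C(I, Q))
    (-(constCurve Q ∘L ContinuousLinearMap.snd ℝ P Q) -
      primitive Q ∘L constCurve Q ∘L f (0, q₀) ∘L ContinuousLinearMap.fst ℝ P Q), ?_⟩
  refine ContinuousLinearMap.ext fun w => Prod.ext rfl ?_
  have : pointwiseApply I (P × P × Q) Q ((radialKernelDeriv f hf).comp
      (radialLift P Q (0, constCurve Q q₀))) (radialLift P Q (w.1.1, w.2)) =
      constCurve Q (f (0, q₀) w.1.1) := by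
    ext t
    simp [radialKernelDeriv, fderiv_radialKernel]
  simp [radialMapDeriv, this]
  abel

/-- The curve `t ↦ f (t x, u t) (t h)`. -/
def transportCurve (f : P × Q → P →L[ℝ] Q) (hf : ContDiff ℝ ∞ f) (x h : P) (u : C(I, Q)) :
    C(I, Q) :=
  ⟨fun t => f ((t : ℝ) • x, u t) ((t : ℝ) • h),
    (hf.continuous.comp (by fun_prop : Continuous fun t : I => ((t : ℝ) • x, u t))).clm_apply
      (by fun_prop)⟩

/-- If u solves the radial equation, the derivative of W(t) = f(tx, u)(th) is f'(x, f x)(th) + f h.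
Integrability exchanges x and th, giving f'(th, f(th)) x + f h, which is the linearised kernel
evaluated at (h, W). Since W(0) = 0, W is the variation of u under a change h of x. -/
theorem radialMapDeriv_transportCurve (f : P × Q → P →L[ℝ] Q) (hf : ContDiff ℝ ∞ f)
    {z : (P × Q) × C(I, Q)} (hz : (radialMap f hf z).2 = 0)
    (compat : ∀ t : I, ∀ h k, fderiv ℝ f ((t : ℝ) • z.1.1, z.2 t)
        (h, f ((t : ℝ) • z.1.1, z.2 t) h) k =
      fderiv ℝ f ((t : ℝ) • z.1.1, z.2 t) (k, f ((t : ℝ) • z.1.1, z.2 t) k) h) (h : P) :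
    radialMapDeriv f hf z ((h, 0), transportCurve f hf z.1.1 h z.2) = ((h, 0), 0) := by
  set x := z.1.1
  set u := z.2
  set κ : C(I, Q) := (radialKernel f hf).comp (radialLift P Q (x, u))
  set R : C(I, Q) := pointwiseApply I (P × P × Q) Q
    ((radialKernelDeriv f hf).comp (radialLift P Q (x, u)))
      (radialLift P Q (h, transportCurve f hf x h u))
  have hR : ∀ t : I, R t = fderiv ℝ f ((t : ℝ) • x, u t)
      ((t : ℝ) • h, f ((t : ℝ) • x, u t) ((t : ℝ) • h)) x + f ((t : ℝ) • x, u t) h :=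
    fun t => fderiv_radialKernel f hf _ _
  let U : ℝ → Q := fun t => z.1.2 + primitiveExt κ t
  have hU : ∀ t : I, U t = u t := fun t => by
    have := congrArg (fun v : C(I, Q) => v t) hz
    simp only [radialMap, ContinuousMap.sub_apply, constCurve_apply, primitive_apply,
      ContinuousMap.zero_apply] at this
    rw [sub_sub, sub_eq_zero] at this
    exact this.symm
  have hU' : ∀ t : I, HasDerivAt U (f ((t : ℝ) • x, u t) x) t := fun t => by
    have := (hasDerivAt_primitiveExt κ t).const_add z.1.2
    rwa [extend_coe] at this
  have hW : ∀ t : I, HasDerivAt (fun s : ℝ => f (s • x, U s) (s • h)) (R t) t := fun t => by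
    have h1 : HasDerivAt (fun s : ℝ => (s • x, U s)) (x, f ((t : ℝ) • x, u t) x) t := by
      have := (hasDerivAt_id (t : ℝ)).smul_const x
      rw [one_smul] at this
      exact this.prodMk (hU' t)
    have h2 : HasDerivAt (fun s : ℝ => s • h) h t := by
      have := (hasDerivAt_id (t : ℝ)).smul_const h
      rwa [one_smul] at this
    have h3 := ((hf.differentiable (by simp) _).hasFDerivAt.comp_hasDerivAt (t : ℝ) h1).clm_apply h2
    -- The only use of integrability: the directions x and th are exchanged.
    rw [hR t, ← compat t x ((t : ℝ) • h), ← hU t]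
    rw [← hU t] at h3
    exact h3
  have hint : primitive Q R = transportCurve f hf x h u := by
    ext t
    rw [primitive_apply, primitiveExt, intervalIntegral.integral_eq_sub_of_hasDerivAt
      (f := fun s : ℝ => f (s • x, U s) (s • h)) _ ((continuous_extend R).intervalIntegrable _ _)]
    · simp [hU t, transportCurve]
    · intro s hs
      rw [uIcc_of_le t.2.1] at hs
      have hs' : s ∈ I := ⟨hs.1, hs.2.trans t.2.2⟩
      have := hW ⟨s, hs'⟩
      rwa [← extend_coe R] at this
  refine Prod.ext rfl ?_
  change transportCurve f hf x h u - constCurve Q 0 - primitive Q R = 0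
  rw [hint, map_zero, sub_zero, sub_self]

/-- **Frobenius theorem for total differential equations**: if `f` is integrable near `(0, q₀)`,
the equation `∂u/∂x = f (x, u)`, `u (0, q) = q`, has a solution depending smoothly on `q`. -/
theorem exists_solution_total_differential (f : P × Q → P →L[ℝ] Q) (hf : ContDiff ℝ ∞ f) (q₀ : Q)
    {O : Set (P × Q)} (hO : IsOpen O) (hq₀ : ((0, q₀) : P × Q) ∈ O)
    (compat : ∀ z ∈ O, ∀ h k, fderiv ℝ f z (h, f z h) k = fderiv ℝ f z (k, f z k) h) :
    ∃ (N : Set (P × Q)) (u : P × Q → Q), IsOpen N ∧ ((0, q₀) : P × Q) ∈ N ∧ ContDiffOn ℝ ∞ u N ∧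
      (∀ q, ((0, q) : P × Q) ∈ N → u (0, q) = q) ∧
      (∀ w ∈ N, (w.1, u w) ∈ O) ∧
      ∀ w ∈ N, ∀ h, fderiv ℝ u w (h, 0) = f (w.1, u w) h := by
  obtain ⟨e, he⟩ := radialMapDeriv_const f hf q₀
  obtain ⟨Θ, hΘ₀, -, hΘ, hΘs, hΘd⟩ := exists_smooth_localInverse isOpen_univ
    (contDiff_radialMap f hf).contDiffOn (mem_univ _) e (he ▸ hasFDerivAt_radialMap f hf _)
  have hzero : ∀ q, radialMap f hf ((0, q), constCurve Q q) = ((0, q), 0) := fun q => by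
    refine Prod.ext rfl ?_
    have : (radialKernel f hf).comp (radialLift P Q (0, constCurve Q q)) = 0 := by
      ext t
      simp [radialKernel]
    simp [radialMap, this]
  -- The second component of `radialMap` is the defect in the integral equation, so the solution
  -- with parameters w is the preimage of (w, 0).
  let j : P × Q → (P × Q) × C(I, Q) := fun w => (w, 0)
  have hj : ContDiff ℝ ∞ j := contDiff_id.prodMk contDiff_const
  let S : P × Q → C(I, Q) := fun w => (Θ.symm (j w)).2
  have hN₁ : IsOpen (j ⁻¹' Θ.target) := Θ.open_target.preimage hj.continuous
  have hS : ContDiffOn ℝ ∞ S (j ⁻¹' Θ.target) :=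
    contDiff_snd.comp_contDiffOn (hΘs.comp hj.contDiffOn fun w hw => hw)
  let T : P × Q → C(I, P × P × Q) := fun w => radialLift P Q (w.1, S w)
  have hT : ContinuousOn T (j ⁻¹' Θ.target) := by
    refine (radialLift P Q).continuous.comp_continuousOn ?_
    exact continuous_fst.continuousOn.prodMk hS.continuousOn
  -- Integrability is known only on O, so N keeps the parameters whose entire solution curve runs in
  -- O. This is an open condition because the interval is compact.
  have hO' : IsOpen {c : C(I, P × P × Q) | MapsTo c univ {z | (z.1, z.2.2) ∈ O}} :=
    ContinuousMap.isOpen_setOfPred_mapsTo isCompact_univ (hO.preimage (by fun_prop))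
  have key : ∀ w ∈ j ⁻¹' Θ.target, Θ.symm (j w) = (w, S w) ∧ radialMap f hf (w, S w) = (w, 0) := by
    intro w hw
    have h1 : radialMap f hf (Θ.symm (j w)) = j w := hΘ ▸ Θ.right_inv hw
    have h2 : (Θ.symm (j w)).1 = w := congrArg Prod.fst h1
    have h3 : Θ.symm (j w) = (w, S w) := Prod.ext h2 rfl
    exact ⟨h3, h3 ▸ h1⟩
  have hS₀ : ∀ q, ((0, q) : P × Q) ∈ j ⁻¹' Θ.target → S (0, q) = constCurve Q q := by
    intro q hq
    have h1 := congrArg Prod.snd (key _ hq).2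
    have : (radialKernel f hf).comp (radialLift P Q (0, S (0, q))) = 0 := by
      ext t
      simp [radialKernel]
    simp only [radialMap, this, map_zero, sub_zero] at h1
    exact sub_eq_zero.1 h1
  have hq₁ : ((0, q₀) : P × Q) ∈ j ⁻¹' Θ.target := by
    have := Θ.map_source hΘ₀
    rwa [hΘ, hzero] at this
  refine ⟨j ⁻¹' Θ.target ∩ T ⁻¹' {c | MapsTo c univ {z | (z.1, z.2.2) ∈ O}}, fun w => S w 1,
    hT.isOpen_inter_preimage hN₁ hO', ⟨hq₁, fun t _ => ?_⟩, ?_, ?_, ?_, ?_⟩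
  · change (((t : ℝ) • (0 : P), S (0, q₀) t) : P × Q) ∈ O
    rw [hS₀ q₀ hq₁, smul_zero]
    exact hq₀
  · exact (ContinuousMap.evalCLM ℝ (1 : I) (M := Q)).contDiff.comp_contDiffOn
      (hS.mono inter_subset_left)
  · exact fun q hq => congrArg (fun v : C(I, Q) => v 1) (hS₀ q hq.1)
  · intro w hw
    have := hw.2 (mem_univ (1 : I))
    simpa [T] using this
  · intro w hw h
    have hSd : DifferentiableAt ℝ S w :=
      (hS.contDiffAt (hN₁.mem_nhds hw.1)).differentiableAt (by simp)
    obtain ⟨e', he'⟩ := hΘd _ (Θ.map_target hw.1)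
    rw [(key w hw.1).1] at he'
    have he'' : (e' : (P × Q) × C(I, Q) →L[ℝ] _) = radialMapDeriv f hf (w, S w) :=
      he'.unique (hasFDerivAt_radialMap f hf _)
    have h1 : HasFDerivAt (fun w => radialMap f hf (w, S w)) _ w :=
      HasFDerivAt.comp (f := fun w => (w, S w)) w (hasFDerivAt_radialMap f hf (w, S w))
        ((hasFDerivAt_id w).prodMk hSd.hasFDerivAt)
    have h2 : (fun w => radialMap f hf (w, S w)) =ᶠ[𝓝 w] fun w => (w, 0) := by
      filter_upwards [hN₁.mem_nhds hw.1] with w' hw' using (key w' hw').2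
    have h3 := congrArg (fun A => A (h, (0 : Q)))
      ((h1.congr_of_eventuallyEq h2.symm).unique ((hasFDerivAt_id w).prodMk
        (hasFDerivAt_const (0 : C(I, Q)) w)))
    have h4 : radialMapDeriv f hf (w, S w) ((h, 0), fderiv ℝ S w (h, 0)) = ((h, 0), 0) := h3
    -- Differentiating `radialMap f hf (w, S w) = (w, 0)` shows that the derivative of S along h
    -- solves the linearised equation, and so does the transport curve. The linearisation is
    -- invertible here, so the two agree; at t = 1 the transport curve is f(x, u) h.
    have h5 := radialMapDeriv_transportCurve f hf (z := (w, S w))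
      (congrArg Prod.snd (key w hw.1).2) (fun t => compat _ (hw.2 (mem_univ t))) h
    rw [← he''] at h4 h5
    have h6 : fderiv ℝ S w (h, 0) = transportCurve f hf w.1 h (S w) :=
      congrArg Prod.snd (e'.injective (h4.trans h5.symm))
    have h7 : HasFDerivAt (fun w => S w 1) ((ContinuousMap.evalCLM ℝ (1 : I)) ∘L fderiv ℝ S w) w :=
      (ContinuousMap.evalCLM ℝ (1 : I) (M := Q)).hasFDerivAt.comp w hSd.hasFDerivAt
    rw [h7.fderiv]
    change fderiv ℝ S w (h, 0) 1 = _
    rw [h6]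
    simp [transportCurve]

end TotalDifferentialEquation

end

end DegreeOne

/-! ### The Frobenius theorem with a flat partial connection; Hadamard's lemma -/

namespace DegreeOne

noncomputable section

open Set Filter Topology unitInterval

section Frobenius

universe u

/-- A function that is smooth near a point agrees near that point with a globally smooth one. -/
theorem exists_contDiff_extension {X Y : Type*} [NormedAddCommGroup X] [NormedSpace ℝ X]
    [FiniteDimensional ℝ X] [NormedAddCommGroup Y] [NormedSpace ℝ Y] {O : Set X} (hO : IsOpen O)
    {f : X → Y} (hf : ContDiffOn ℝ ∞ f O) {x : X} (hx : x ∈ O) :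
    ∃ (g : X → Y) (O' : Set X), ContDiff ℝ ∞ g ∧ IsOpen O' ∧ x ∈ O' ∧ O' ⊆ O ∧ EqOn g f O' := by
  obtain ⟨r, hr, hrO⟩ := Metric.isOpen_iff.1 hO x hx
  let χ : ContDiffBump x := ⟨r / 4, r / 2, by positivity, by linarith⟩
  refine ⟨fun y => χ y • f y, Metric.ball x (r / 4), ?_, Metric.isOpen_ball,
    Metric.mem_ball_self (by positivity),
    (Metric.ball_subset_ball (by linarith)).trans hrO, fun y hy => ?_⟩
  · rw [contDiff_iff_contDiffAt]
    intro y
    by_cases hy : y ∈ O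
    · exact χ.contDiff.contDiffAt.smul (hf.contDiffAt (hO.mem_nhds hy))
    · have : (fun y => χ y • f y) =ᶠ[𝓝 y] fun _ => 0 := by
        have hcl : y ∉ Metric.closedBall x (r / 2) := fun h =>
          hy (hrO (Metric.closedBall_subset_ball (by linarith) h))
        filter_upwards [Metric.isClosed_closedBall.isOpen_compl.mem_nhds hcl] with z hz
        rw [χ.zero_of_le_dist (le_of_lt (not_le.1 fun h => hz (Metric.mem_closedBall.2 h))), zero_smul]
      exact contDiffAt_const.congr_of_eventuallyEq this
  · change χ y • f y = f y
    rw [χ.one_of_mem_closedBall (Metric.ball_subset_closedBall hy), one_smul]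

variable {P Q : Type u} [NormedAddCommGroup P] [NormedSpace ℝ P] [FiniteDimensional ℝ P]
  [NormedAddCommGroup Q] [NormedSpace ℝ Q] [FiniteDimensional ℝ Q]

/-- A cut-off replaces f by a globally smooth map and a translation moves x₀ to 0. Integrability
survives on the neighbourhood where the cut-off changes nothing, and the solution is required to
stay there. -/
theorem exists_local_solution_total_differential {O : Set (P × Q)} (hO : IsOpen O)
    {f : P × Q → P →L[ℝ] Q} (hf : ContDiffOn ℝ ∞ f O) {x₀ : P} {q₀ : Q} (h₀ : (x₀, q₀) ∈ O)
    (compat : ∀ z ∈ O, ∀ h k, fderiv ℝ f z (h, f z h) k = fderiv ℝ f z (k, f z k) h) :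
    ∃ (N : Set (P × Q)) (u : P × Q → Q), IsOpen N ∧ (x₀, q₀) ∈ N ∧ ContDiffOn ℝ ∞ u N ∧
      (∀ q, (x₀, q) ∈ N → u (x₀, q) = q) ∧
      (∀ w ∈ N, (w.1, u w) ∈ O) ∧
      ∀ w ∈ N, ∀ h, fderiv ℝ u w (h, 0) = f (w.1, u w) h := by
  have := FiniteDimensional.complete ℝ P
  have := FiniteDimensional.complete ℝ Q
  obtain ⟨g, O', hg, hO', hxO', hO'O, hgf⟩ := exists_contDiff_extension hO hf h₀
  have hgf' : ∀ z ∈ O', fderiv ℝ g z = fderiv ℝ f z := fun z hz =>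
    (hgf.eventuallyEq_of_mem (hO'.mem_nhds hz)).fderiv_eq
  let c : P × Q := (x₀, 0)
  have hc : ∀ z : P × Q, z + c = (z.1 + x₀, z.2) := fun z => Prod.ext rfl (add_zero _)
  have hc' : ∀ z : P × Q, z - c = (z.1 - x₀, z.2) := fun z => Prod.ext rfl (sub_zero _)
  have hd : ∀ z, fderiv ℝ (fun z => g (z + c)) z = fderiv ℝ g (z + c) := fun z =>
    fderiv_comp_add_right c
  obtain ⟨N, u, hN, h0N, hu, hu0, huO, hud⟩ := exists_solution_total_differential
    (fun z => g (z + c)) (hg.comp (contDiff_id.add contDiff_const)) q₀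
    (O := (fun z => z + c) ⁻¹' O') (hO'.preimage (by fun_prop)) (by simpa [hc] using hxO')
    (fun z hz h k => by
      rw [hd, hgf' _ hz, hgf hz]
      exact compat _ (hO'O hz) h k)
  have hsub : ContDiff ℝ ∞ fun w : P × Q => w - c := contDiff_id.sub contDiff_const
  refine ⟨(fun w => w - c) ⁻¹' N, fun w => u (w - c), hN.preimage hsub.continuous,
    by simpa [hc'] using h0N, hu.comp hsub.contDiffOn fun w hw => hw, fun q hq => ?_,
    fun w hw => ?_, fun w hw h => ?_⟩
  · have h1 : (x₀, q) - c = (0, q) := by simp [hc']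
    simp only [h1]
    exact hu0 q (by rw [mem_preimage, h1] at hq; exact hq)
  · have := hO'O (huO _ hw)
    simpa [hc, hc'] using this
  · have h1 := hud _ hw h
    have h2 : fderiv ℝ (fun w => u (w - c)) w = fderiv ℝ u (w - c) := by
      simpa only [sub_eq_add_neg] using fderiv_comp_add_right (-c)
    rw [h2, h1]
    have h3 : ((w - c).1, u (w - c)) + c = (w.1, u (w - c)) := by simp [hc, hc']
    have h4 := huO _ hw
    rw [mem_preimage, h3] at h4
    simp only [h3]
    rw [hgf h4]

variable {𝔸 : Type u} [NormedRing 𝔸] [NormedAlgebra ℝ 𝔸] [FiniteDimensional ℝ 𝔸]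

/-- The total differential equation for the leaves of the distribution spanned by the vectors
`(h, b h)`, together with the parallel transport along them for the connection form `θ`. -/
def leafEquation (b : P × Q → P →L[ℝ] Q) (θ : P × Q → P →L[ℝ] 𝔸) (z : P × (Q × 𝔸)) :
    P →L[ℝ] Q × 𝔸 :=
  (b (z.1, z.2.1)).prod (-(ContinuousLinearMap.mul ℝ 𝔸 z.2.2 ∘L θ (z.1, z.2.1)))

theorem contDiffOn_leafEquation {O : Set (P × Q)} {b : P × Q → P →L[ℝ] Q}
    {θ : P × Q → P →L[ℝ] 𝔸} (hb : ContDiffOn ℝ ∞ b O) (hθ : ContDiffOn ℝ ∞ θ O) :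
    ContDiffOn ℝ ∞ (leafEquation b θ) {z : P × (Q × 𝔸) | (z.1, z.2.1) ∈ O} := by
  have h0 : ContDiff ℝ ∞ fun z : P × (Q × 𝔸) => (z.1, z.2.1) := by fun_prop
  have h1 := hb.comp h0.contDiffOn (s := {z : P × (Q × 𝔸) | (z.1, z.2.1) ∈ O}) fun z hz => hz
  have h2 := hθ.comp h0.contDiffOn (s := {z : P × (Q × 𝔸) | (z.1, z.2.1) ∈ O}) fun z hz => hz
  have h3 : ContDiff ℝ ∞ fun z : P × (Q × 𝔸) => ContinuousLinearMap.mul ℝ 𝔸 z.2.2 :=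
    (ContinuousLinearMap.mul ℝ 𝔸).contDiff.comp (contDiff_snd.comp contDiff_snd)
  have h4 := (contDiffOn_const (c := ContinuousLinearMap.inl ℝ Q 𝔸)).clm_comp h1
  have h5 := (contDiffOn_const (c := ContinuousLinearMap.inr ℝ Q 𝔸)).clm_comp
    (h3.contDiffOn.clm_comp h2).neg
  refine (h4.add h5).congr fun z _ => ContinuousLinearMap.ext fun k => ?_
  simp [leafEquation]

theorem fderiv_leafEquation {O : Set (P × Q)} (hO : IsOpen O) {b : P × Q → P →L[ℝ] Q}
    {θ : P × Q → P →L[ℝ] 𝔸} (hb : ContDiffOn ℝ ∞ b O) (hθ : ContDiffOn ℝ ∞ θ O)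
    {z : P × (Q × 𝔸)} (hz : (z.1, z.2.1) ∈ O) (w : P × (Q × 𝔸)) (k : P) :
    fderiv ℝ (leafEquation b θ) z w k =
      (fderiv ℝ b (z.1, z.2.1) (w.1, w.2.1) k,
        -(z.2.2 * fderiv ℝ θ (z.1, z.2.1) (w.1, w.2.1) k + w.2.2 * θ (z.1, z.2.1) k)) := by
  have hO' : IsOpen {z : P × (Q × 𝔸) | (z.1, z.2.1) ∈ O} := hO.preimage (by fun_prop)
  have hd : DifferentiableAt ℝ (leafEquation b θ) z :=
    ((contDiffOn_leafEquation hb hθ).contDiffAt (hO'.mem_nhds hz)).differentiableAt (by simp)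
  have h0 : HasFDerivAt (fun z : P × (Q × 𝔸) => (z.1, z.2.1)) _ z :=
    hasFDerivAt_fst.prodMk (hasFDerivAt_fst.comp z (hasFDerivAt_snd (𝕜 := ℝ)
      (E := P) (F := Q × 𝔸)))
  have h1 := HasFDerivAt.comp (f := fun z : P × (Q × 𝔸) => (z.1, z.2.1)) z
    ((hb.contDiffAt (hO.mem_nhds hz)).differentiableAt (by simp)).hasFDerivAt h0
  have h2 := HasFDerivAt.comp (f := fun z : P × (Q × 𝔸) => (z.1, z.2.1)) z
    ((hθ.contDiffAt (hO.mem_nhds hz)).differentiableAt (by simp)).hasFDerivAt h0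
  have h3 : HasFDerivAt (fun z : P × (Q × 𝔸) => z.2.2) _ z :=
    hasFDerivAt_snd.comp z (hasFDerivAt_snd (𝕜 := ℝ) (E := P) (F := Q × 𝔸))
  have h4 := (h1.clm_apply (hasFDerivAt_const k z)).prodMk
    ((h3.mul' (h2.clm_apply (hasFDerivAt_const k z))).neg)
  have h5 := (hd.hasFDerivAt.clm_apply (hasFDerivAt_const k z)).unique h4
  have h6 := congrArg (fun A => A w) h5
  simpa [Function.comp_def] using h6

/-- **Frobenius theorem** for the integrable distribution spanned by the vectors `(h, b h)` and a
flat partial connection `θ` along it: there are coordinates `Ψ` straightening the distribution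
and a gauge transformation `G` trivializing the connection. -/
theorem exists_straightening {O : Set (P × Q)} (hO : IsOpen O) {b : P × Q → P →L[ℝ] Q}
    {θ : P × Q → P →L[ℝ] 𝔸} (hb : ContDiffOn ℝ ∞ b O) (hθ : ContDiffOn ℝ ∞ θ O)
    (hbb : ∀ z ∈ O, ∀ h k, fderiv ℝ b z (h, b z h) k = fderiv ℝ b z (k, b z k) h)
    (hθθ : ∀ z ∈ O, ∀ h k, fderiv ℝ θ z (h, b z h) k - θ z h * θ z k =
      fderiv ℝ θ z (k, b z k) h - θ z k * θ z h) {z₀ : P × Q} (hz₀ : z₀ ∈ O) :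
    ∃ (Ψ : OpenPartialHomeomorph (P × Q) (P × Q)) (G : P × Q → 𝔸), z₀ ∈ Ψ.source ∧
      Ψ.source ⊆ O ∧ ContDiffOn ℝ ∞ Ψ Ψ.source ∧ ContDiffOn ℝ ∞ Ψ.symm Ψ.target ∧
      ContDiffOn ℝ ∞ G Ψ.source ∧
      ∀ z ∈ Ψ.source, (Ψ z).1 = z.1 ∧ IsUnit (G z) ∧
        (∀ h, fderiv ℝ Ψ z (h, b z h) = (h, 0)) ∧
        ∀ h, fderiv ℝ G z (h, b z h) = -(G z * θ z h) := by
  obtain ⟨x₀, y₀⟩ := z₀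
  have hO' : IsOpen {z : P × (Q × 𝔸) | (z.1, z.2.1) ∈ O} := hO.preimage (by fun_prop)
  -- The Q-component of the integrability condition is `hbb`; the 𝔸-component is `hθθ` multiplied on
  -- the left by the current gauge.
  obtain ⟨N, u, hN, h0N, hu, hu0, huO, hud⟩ := exists_local_solution_total_differential
    hO' (contDiffOn_leafEquation hb hθ) (x₀ := x₀) (q₀ := (y₀, 1)) hz₀ (fun z hz h k => by
      rw [fderiv_leafEquation hO hb hθ hz, fderiv_leafEquation hO hb hθ hz]
      refine Prod.ext (hbb _ hz h k) ?_
      have := congrArg (fun a => z.2.2 * a) (hθθ _ hz h k)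
      simp only [mul_sub] at this
      simp only [leafEquation, ContinuousLinearMap.prod_apply, neg_apply,
        ContinuousLinearMap.comp_apply, ContinuousLinearMap.mul_apply', neg_mul, mul_assoc,
        ← sub_eq_add_neg]
      rw [this])
  let j : P × Q → P × (Q × 𝔸) := fun z => (z.1, (z.2, 1))
  have hj : ContDiff ℝ ∞ j := by fun_prop
  have hjd : ∀ z (w : P × Q), fderiv ℝ j z w = (w.1, (w.2, 0)) := fun z w => by
    have h1 : HasFDerivAt (fun z : P × Q => (z.2, (1 : 𝔸))) _ z :=
      (hasFDerivAt_snd (𝕜 := ℝ) (E := P) (F := Q)).prodMk (hasFDerivAt_const (1 : 𝔸) z)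
    have h2 : HasFDerivAt j _ z := hasFDerivAt_fst.prodMk h1
    rw [h2.fderiv]
    rfl
  have hNj : IsOpen (j ⁻¹' N) := hN.preimage hj.continuous
  have huj : ContDiffOn ℝ ∞ (fun z => u (j z)) (j ⁻¹' N) := hu.comp hj.contDiffOn fun z hz => hz
  have hujd : ∀ z ∈ j ⁻¹' N, HasFDerivAt (fun z => u (j z)) (fderiv ℝ u (j z) ∘L fderiv ℝ j z) z :=
    fun z hz => HasFDerivAt.comp z
      ((hu.contDiffAt (hN.mem_nhds hz)).differentiableAt (by simp)).hasFDerivAt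
      (hj.differentiable (by simp) z).hasFDerivAt
  -- `Kmap` sends (x, y) to the point over x of the leaf through (x₀, y). Its local inverse is the
  -- straightening Ψ, and the gauge transported from the initial value 1, read through Ψ, is G.
  let Kmap : P × Q → P × Q := fun z => (z.1, (u (j z)).1)
  have hK : ContDiffOn ℝ ∞ Kmap (j ⁻¹' N) :=
    contDiff_fst.contDiffOn.prodMk (contDiff_fst.comp_contDiffOn huj)
  have hKd : ∀ z ∈ j ⁻¹' N, HasFDerivAt Kmap ((ContinuousLinearMap.fst ℝ P Q).prod
      (ContinuousLinearMap.fst ℝ Q 𝔸 ∘L fderiv ℝ u (j z) ∘L fderiv ℝ j z)) z := fun z hz =>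
    hasFDerivAt_fst.prodMk (hasFDerivAt_fst.comp z (hujd z hz))
  have hleaf : ∀ z ∈ j ⁻¹' N, ∀ h, fderiv ℝ u (j z) (fderiv ℝ j z (h, 0)) =
      (b (Kmap z) h, -((u (j z)).2 * θ (Kmap z) h)) := fun z hz h => by
    rw [hjd]
    exact hud _ hz h
  have hK₀ : Kmap (x₀, y₀) = (x₀, y₀) := by
    simp only [Kmap, j, hu0 _ h0N]
  -- Over x₀ the solution equals its initial value, so the derivative of `Kmap` at the base point is
  -- the triangular map (h, k) ↦ (h, k + b h).
  have hvert : ∀ k, fderiv ℝ u (j (x₀, y₀)) (fderiv ℝ j (x₀, y₀) (0, k)) = (k, 0) := fun k => by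
    have hc : HasFDerivAt (fun q : Q × 𝔸 => (x₀, q)) (ContinuousLinearMap.inr ℝ P (Q × 𝔸))
      (y₀, 1) := (hasFDerivAt_const x₀ _).prodMk (hasFDerivAt_id _)
    have h1 := HasFDerivAt.comp (f := fun q : Q × 𝔸 => (x₀, q)) (y₀, 1)
      ((hu.contDiffAt (hN.mem_nhds h0N)).differentiableAt (by simp)).hasFDerivAt hc
    have h2 : (fun q => u (x₀, q)) =ᶠ[𝓝 (y₀, 1)] fun q => q := by
      filter_upwards [(hN.preimage (by fun_prop : Continuous fun q : Q × 𝔸 => (x₀, q))).mem_nhds h0N]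
        with q hq using hu0 q hq
    have h3 := congrArg (fun A => A (k, (0 : 𝔸)))
      ((h1.congr_of_eventuallyEq h2.symm).unique (hasFDerivAt_id _))
    rw [hjd]
    exact h3
  have := FiniteDimensional.complete ℝ P
  have := FiniteDimensional.complete ℝ Q
  have := FiniteDimensional.complete ℝ 𝔸
  -- The gauge is 1 at the base point, hence a unit nearby.
  have hO₁ : IsOpen (j ⁻¹' N ∩ (fun z => (u (j z)).2) ⁻¹' {a | IsUnit a}) :=
    (contDiff_snd.comp_contDiffOn huj).continuousOn.isOpen_inter_preimage hNj Units.isOpen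
  have hz₁ : (x₀, y₀) ∈ j ⁻¹' N ∩ (fun z => (u (j z)).2) ⁻¹' {a | IsUnit a} := by
    refine ⟨h0N, ?_⟩
    simp only [mem_preimage, j, hu0 _ h0N]
    exact isUnit_one
  obtain ⟨Θ, hΘ₀, hΘO, hΘ, hΘs, -⟩ := exists_smooth_localInverse hO₁ (hK.mono inter_subset_left)
    hz₁ ((ContinuousLinearEquiv.refl ℝ P).skewProd (ContinuousLinearEquiv.refl ℝ Q) (b (x₀, y₀)))
    (by
      refine (hKd _ h0N).congr_fderiv (ContinuousLinearMap.ext fun w => Prod.ext rfl ?_)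
      have h1 : w = (w.1, 0) + (0, w.2) := by simp
      change (fderiv ℝ u (j (x₀, y₀)) (fderiv ℝ j (x₀, y₀) w)).1 = w.2 + b (x₀, y₀) w.1
      rw [h1, map_add, map_add, hleaf _ h0N, hvert, hK₀]
      simp [add_comm])
  have hΨ : ∀ z ∈ Θ.target, Θ.symm z ∈ j ⁻¹' N ∧ IsUnit (u (j (Θ.symm z))).2 ∧
      Kmap (Θ.symm z) = z := fun z hz =>
    ⟨(hΘO (Θ.map_target hz)).1, (hΘO (Θ.map_target hz)).2, hΘ ▸ Θ.right_inv hz⟩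
  have hΨd : ∀ z ∈ Θ.target, DifferentiableAt ℝ Θ.symm z := fun z hz =>
    (hΘs.contDiffAt (Θ.open_target.mem_nhds hz)).differentiableAt (by simp)
  -- By the leaf equation the derivative of `Kmap` takes (h, 0) to (h, b h); the inverse takes it
  -- back.
  have hΨh : ∀ z ∈ Θ.target, ∀ h, fderiv ℝ Θ.symm z (h, b z h) = (h, 0) := fun z hz h => by
    obtain ⟨h1, -, h2⟩ := hΨ z hz
    have h3 : HasFDerivAt Θ.symm (fderiv ℝ Θ.symm z) (Kmap (Θ.symm z)) := by
      rw [h2]; exact (hΨd z hz).hasFDerivAt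
    have h4 := h3.comp (Θ.symm z) (hKd _ h1)
    have h5 : (Θ.symm ∘ Kmap) =ᶠ[𝓝 (Θ.symm z)] id := by
      filter_upwards [Θ.open_source.mem_nhds (Θ.map_target hz)] with w hw
      rw [Function.comp_apply, ← hΘ, Θ.left_inv hw, id]
    have h6 := congrArg (fun A => A (h, (0 : Q)))
      ((h4.congr_of_eventuallyEq h5.symm).unique (hasFDerivAt_id _))
    have h7 : fderiv ℝ Θ.symm z (h, (fderiv ℝ u (j (Θ.symm z))
      (fderiv ℝ j (Θ.symm z) (h, 0))).1) = (h, 0) := h6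
    rwa [hleaf _ h1, h2] at h7
  refine ⟨Θ.symm, fun z => (u (j (Θ.symm z))).2, ?_, fun z hz => ?_, hΘs, ?_, ?_, fun z hz => ?_⟩
  · have := Θ.map_source hΘ₀
    rwa [hΘ, hK₀] at this
  · have := huO _ (hΨ z hz).1
    have h2 : ((j (Θ.symm z)).1, (u (j (Θ.symm z))).1) = z := (hΨ z hz).2.2
    simp only [mem_ofPred_eq] at this
    rwa [h2] at this
  · rw [Θ.symm_symm, hΘ]
    exact hK.mono fun z hz => (hΘO hz).1
  · exact (contDiff_snd.comp_contDiffOn huj).comp hΘs fun z hz => (hΨ z hz).1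
  · obtain ⟨h1, h2, h3⟩ := hΨ z hz
    have h0 : (Kmap (Θ.symm z)).1 = z.1 := by rw [h3]
    refine ⟨h0, h2, hΨh z hz, fun h => ?_⟩
    have h4 := (hasFDerivAt_snd.comp _ (hujd _ h1)).comp z (hΨd z hz).hasFDerivAt
    have h5 : HasFDerivAt (fun z => (u (j (Θ.symm z))).2) _ z := h4
    rw [h5.fderiv]
    change (fderiv ℝ u (j (Θ.symm z)) (fderiv ℝ j (Θ.symm z)
      (fderiv ℝ Θ.symm z (h, b z h)))).2 = _
    rw [hΨh z hz, hleaf _ h1, h3]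

end Frobenius

/-- **Hadamard's lemma**. -/
theorem exists_hadamard_factor {X : Type} [NormedAddCommGroup X] [NormedSpace ℝ X]
    [FiniteDimensional ℝ X] {O : Set X} (hO : IsOpen O) {f : X → ℝ} (hf : ContDiffOn ℝ ∞ f O)
    {x₀ : X} (hx₀ : x₀ ∈ O) :
    ∃ (g : X → X →L[ℝ] ℝ) (O' : Set X), ContDiff ℝ ∞ g ∧ IsOpen O' ∧ x₀ ∈ O' ∧ O' ⊆ O ∧
      ∀ x ∈ O', f x = f x₀ + g x (x - x₀) := by
  obtain ⟨F, O', hF, hO', hxO', hO'O, hFf⟩ := exists_contDiff_extension hO hf hx₀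
  have hF' : ContDiff ℝ ∞ (fderiv ℝ F) := hF.fderiv_right (by simp)
  let κ : C(X × X × X, X →L[ℝ] ℝ) := ⟨fun z => fderiv ℝ F (z.2.2 + z.1),
    hF'.continuous.comp (by fun_prop)⟩
  have hκ : ContDiff ℝ ∞ κ := hF'.comp (by fun_prop : ContDiff ℝ ∞ fun z : X × X × X => z.2.2 + z.1)
  -- At time s the path is (s(x - x₀), x - x₀, x₀), where κ reads the derivative of F at x₀ + s(x -
  -- x₀). The factor g is the integral of these over the unit interval; it is smooth in x by the
  -- superposition theorem.
  let path : X → C(I, X × X × X) := fun x => radialLift X X (x - x₀, constCurve X x₀)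
  have hpath : ContDiff ℝ ∞ path := (radialLift X X).contDiff.comp
    ((contDiff_id.sub contDiff_const).prodMk contDiff_const)
  let g : X → X →L[ℝ] ℝ := fun x => primitive (X →L[ℝ] ℝ) (κ.comp (path x)) 1
  have hg : ContDiff ℝ ∞ g := (((contDiff_comp_left κ hκ).comp hpath).continuousLinearMap_comp
    (primitive (X →L[ℝ] ℝ))).continuousLinearMap_comp (ContinuousMap.evalCLM ℝ (1 : I))
  refine ⟨g, O', hg, hO', hxO', hO'O, fun x hx => ?_⟩
  have h1 : g x (x - x₀) =
      ∫ s in (0 : ℝ)..1, IccExtend (zero_le_one' ℝ) (κ.comp (path x)) s (x - x₀) :=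
    ContinuousLinearMap.intervalIntegral_apply
      ((continuous_extend (κ.comp (path x))).intervalIntegrable _ _) _
  have h2 : ∀ s ∈ uIcc (0 : ℝ) 1, HasDerivAt (fun s : ℝ => F (x₀ + s • (x - x₀)))
      (IccExtend (zero_le_one' ℝ) (κ.comp (path x)) s (x - x₀)) s := fun s hs => by
    rw [uIcc_of_le zero_le_one] at hs
    have h3 : HasDerivAt (fun s : ℝ => x₀ + s • (x - x₀)) (x - x₀) s := by
      have := ((hasDerivAt_id s).smul_const (x - x₀)).const_add x₀
      rwa [one_smul] at this
    have h4 := (hF.differentiable (by simp) _).hasFDerivAt.comp_hasDerivAt s h3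
    have h5 := extend_coe (κ.comp (path x)) ⟨s, hs⟩
    simp only at h5
    rw [h5]
    exact h4
  rw [h1, intervalIntegral.integral_eq_sub_of_hasDerivAt h2
    (((continuous_extend (κ.comp (path x))).clm_apply continuous_const).intervalIntegrable _ _)]
  simp [hFf hx, hFf hxO']

end

end DegreeOne

/-! ### Degrees and contractions in the exterior algebra -/

namespace DegreeOne

noncomputable section

open Set Filter Topology

section ExteriorAlgebra

variable {V W : Type*} [AddCommGroup V] [Module ℝ V] [AddCommGroup W] [Module ℝ W]

theorem ι_mem_exteriorPower_one (v : V) : ExteriorAlgebra.ι ℝ v ∈ ⋀[ℝ]^1 V := by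
  rw [ExteriorAlgebra.exteriorPower, pow_one]
  exact LinearMap.mem_range_self _ v

theorem algebraMap_mem_exteriorPower_zero (r : ℝ) :
    algebraMap ℝ (ExteriorAlgebra ℝ V) r ∈ ⋀[ℝ]^0 V := by
  rw [ExteriorAlgebra.exteriorPower, pow_zero]
  exact Submodule.algebraMap_mem r

theorem mul_mem_exteriorPower {i j : ℕ} {x y : ExteriorAlgebra ℝ V} (hx : x ∈ ⋀[ℝ]^i V)
    (hy : y ∈ ⋀[ℝ]^j V) : x * y ∈ ⋀[ℝ]^(i + j) V := by
  rw [ExteriorAlgebra.exteriorPower, pow_add]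
  exact Submodule.mul_mem_mul hx hy

theorem algebraMap_algebraMapInv_of_mem {x : ExteriorAlgebra ℝ V} (hx : x ∈ ⋀[ℝ]^0 V) :
    algebraMap ℝ _ (ExteriorAlgebra.algebraMapInv x) = x := by
  rw [ExteriorAlgebra.exteriorPower, pow_zero] at hx
  obtain ⟨r, rfl⟩ := Submodule.mem_one.1 hx
  rw [ExteriorAlgebra.algebraMap_leftInverse V r]

theorem algebraMapInv_of_mem_succ {i : ℕ} {x : ExteriorAlgebra ℝ V} (hx : x ∈ ⋀[ℝ]^(i + 1) V) :
    ExteriorAlgebra.algebraMapInv x = 0 := by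
  rw [ExteriorAlgebra.exteriorPower, pow_succ'] at hx
  refine Submodule.mul_induction_on hx ?_ fun x y hx hy => by rw [map_add, hx, hy, add_zero]
  rintro _ ⟨v, rfl⟩ y -
  simp [ExteriorAlgebra.algebraMapInv]

/-- Vectors commute with homogeneous elements up to the Koszul sign. -/
theorem mul_ι_of_mem {l : ℕ} {x : ExteriorAlgebra ℝ V} (hx : x ∈ ⋀[ℝ]^l V) (v : V) :
    x * ExteriorAlgebra.ι ℝ v = (-1 : ℝ) ^ l • (ExteriorAlgebra.ι ℝ v * x) := by
  rw [ExteriorAlgebra.exteriorPower] at hx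
  induction hx using Submodule.pow_induction_on_left' with
  | algebraMap r => rw [pow_zero, one_smul, Algebra.commutes]
  | add x y i hx hy ihx ihy => rw [add_mul, ihx, ihy, mul_add, smul_add]
  | mem_mul w hw i x hx ih =>
    obtain ⟨w, rfl⟩ := hw
    have h1 : ExteriorAlgebra.ι ℝ w * ExteriorAlgebra.ι ℝ v =
        -(ExteriorAlgebra.ι ℝ v * ExteriorAlgebra.ι ℝ w) :=
      eq_neg_of_add_eq_zero_left (ExteriorAlgebra.ι_add_mul_swap w v)
    rw [mul_assoc, ih, mul_smul_comm, ← mul_assoc, h1, pow_succ, mul_neg_one, neg_mul, smul_neg,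
      neg_smul, mul_assoc]

/-- The contraction of `⋀ V` with a covector. -/
def contract (d : Module.Dual ℝ V) : ExteriorAlgebra ℝ V →ₗ[ℝ] ExteriorAlgebra ℝ V :=
  CliffordAlgebra.contractLeft d

theorem contract_ι_mul (d : Module.Dual ℝ V) (v : V) (x : ExteriorAlgebra ℝ V) :
    contract d (ExteriorAlgebra.ι ℝ v * x) = d v • x - ExteriorAlgebra.ι ℝ v * contract d x :=
  CliffordAlgebra.contractLeft_ι_mul (Q := 0) d v x

theorem contract_algebraMap (d : Module.Dual ℝ V) (r : ℝ) :
    contract d (algebraMap ℝ (ExteriorAlgebra ℝ V) r) = 0 :=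
  CliffordAlgebra.contractLeft_algebraMap (Q := 0) d r

theorem contract_ι (d : Module.Dual ℝ V) (v : V) :
    contract d (ExteriorAlgebra.ι ℝ v) = algebraMap ℝ _ (d v) :=
  CliffordAlgebra.contractLeft_ι (Q := 0) d v

/-- Contraction is an odd derivation, by induction on the number of vectors in x. This becomes the
signed Leibniz rule of ∂/∂e^β. -/
theorem contract_mul_of_mem (d : Module.Dual ℝ V) {l : ℕ} {x : ExteriorAlgebra ℝ V}
    (hx : x ∈ ⋀[ℝ]^l V) (y : ExteriorAlgebra ℝ V) :
    contract d (x * y) = contract d x * y + (-1 : ℝ) ^ l • (x * contract d y) := by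
  rw [ExteriorAlgebra.exteriorPower] at hx
  induction hx using Submodule.pow_induction_on_left' with
  | algebraMap r =>
    rw [contract_algebraMap, zero_mul, zero_add, pow_zero, one_smul, ← Algebra.smul_def, map_smul,
      Algebra.smul_def]
  | add x z i hx hz ihx ihz =>
    rw [add_mul, map_add, ihx, ihz, map_add, add_mul, add_mul, smul_add]
    abel
  | mem_mul w hw i x hx ih =>
    obtain ⟨w, rfl⟩ := hw
    rw [mul_assoc, contract_ι_mul, ih, contract_ι_mul, sub_mul, pow_succ, mul_add, mul_smul_comm,
      smul_mul_assoc, mul_neg_one, neg_smul, mul_assoc, mul_assoc]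
    abel

theorem contract_mem (d : Module.Dual ℝ V) {l : ℕ} {x : ExteriorAlgebra ℝ V}
    (hx : x ∈ ⋀[ℝ]^(l + 1) V) : contract d x ∈ ⋀[ℝ]^l V := by
  induction l generalizing x with
  | zero =>
    rw [ExteriorAlgebra.exteriorPower, zero_add, pow_one] at hx
    obtain ⟨v, rfl⟩ := hx
    rw [contract_ι]
    exact algebraMap_mem_exteriorPower_zero _
  | succ l ih =>
    rw [ExteriorAlgebra.exteriorPower, pow_succ'] at hx
    refine Submodule.mul_induction_on hx ?_ fun x y hx hy => by
      rw [map_add]; exact Submodule.add_mem _ hx hy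
    rintro _ ⟨v, rfl⟩ y hy
    rw [contract_ι_mul]
    refine Submodule.sub_mem _ (Submodule.smul_mem _ _ hy) ?_
    have := mul_mem_exteriorPower (ι_mem_exteriorPower_one v) (ih hy)
    rwa [add_comm] at this

theorem contract_of_mem_zero (d : Module.Dual ℝ V) {x : ExteriorAlgebra ℝ V}
    (hx : x ∈ ⋀[ℝ]^0 V) : contract d x = 0 := by
  rw [← algebraMap_algebraMapInv_of_mem hx, contract_algebraMap]

theorem map_mem_exteriorPower (f : V →ₗ[ℝ] W) {l : ℕ} {x : ExteriorAlgebra ℝ V}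
    (hx : x ∈ ⋀[ℝ]^l V) : ExteriorAlgebra.map f x ∈ ⋀[ℝ]^l W := by
  have h : (⋀[ℝ]^l V).map (ExteriorAlgebra.map f).toLinearMap ≤ ⋀[ℝ]^l W := by
    rw [ExteriorAlgebra.exteriorPower, ExteriorAlgebra.exteriorPower, Submodule.map_pow]
    refine pow_le_pow_left' ?_ l
    rintro _ ⟨_, ⟨v, rfl⟩, rfl⟩
    exact ⟨f v, (ExteriorAlgebra.map_apply_ι f v).symm⟩
  exact h ⟨x, hx, rfl⟩

end ExteriorAlgebra

end

end DegreeOne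

/-! ### Locality and restriction of vector fields -/

namespace DegreeOne

noncomputable section

open Set Filter Topology

section Locality

variable {m₀ : ℕ} {M : Type*} [TopologicalSpace M]
  [ChartedSpace (EuclideanSpace ℝ (Fin m₀)) M]

/-- Both sides are smoothness at a point of M of one and the same extension of f by zero. -/
theorem contMDiffAt_inclusion_iff {U' U : Opens M} (h : U' ≤ U) {f : U → ℝ} {q : U'} :
    ContMDiffAt (𝓡 m₀) 𝓘(ℝ, ℝ) ∞ (fun p => f (Opens.inclusion h p)) q ↔
      ContMDiffAt (𝓡 m₀) 𝓘(ℝ, ℝ) ∞ f (Opens.inclusion h q) := by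
  classical
  let g : M → ℝ := fun p => if hp : p ∈ U then f ⟨p, hp⟩ else 0
  have h1 : f = fun p : U => g p := by
    funext p
    simp [g]
  have h2 : (fun p => f (Opens.inclusion h p)) = fun p : U' => g p := by
    funext p
    simp [g, h p.2]
  rw [h2, contMDiffAt_subtype_iff]
  conv_rhs => rw [h1]
  rw [contMDiffAt_subtype_iff]

/-- Around every point of an open set there is a smooth bump function supported in it. -/
theorem exists_bump [T2Space M] [IsManifold (𝓡 m₀) ∞ M] {U : Opens M} {q : M} (hq : q ∈ U) :
    ∃ ρ : M → ℝ, ContMDiff (𝓡 m₀) 𝓘(ℝ, ℝ) ∞ ρ ∧ tsupport ρ ⊆ U ∧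
      ∃ N : Opens M, N ≤ U ∧ q ∈ N ∧ ∀ p ∈ N, ρ p = 1 := by
  obtain ⟨f, -, hf⟩ := ((SmoothBumpFunction.nhds_basis_tsupport (I := 𝓡 m₀) q).mem_iff).1
    (U.isOpen.mem_nhds hq)
  obtain ⟨N, hN, hNo, hqN⟩ := mem_nhds_iff.1
    (inter_mem f.eventuallyEq_one (U.isOpen.mem_nhds hq))
  exact ⟨f, f.contMDiff, hf, ⟨N, hNo⟩, fun p hp => (hN hp).2, hqN, fun p hp => (hN hp).1⟩

variable {F : Type*} [NormedAddCommGroup F] [NormedSpace ℝ F] [FiniteDimensional ℝ F]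
  {E : M → Type*} [∀ p, AddCommGroup (E p)] [∀ p, Module ℝ (E p)]
  [∀ p, TopologicalSpace (E p)] [TopologicalSpace (Bundle.TotalSpace F E)]
  [FiberBundle F E] [VectorBundle ℝ F E]

theorem isSmoothSection_of_eq {U : Opens M} {η : ∀ p : U, Fibre E (p : M)}
    (f : functions m₀ F E U) (h : ∀ q, η q = f.1 q) : IsSmoothSection m₀ F E U η :=
  (funext h : η = f.1) ▸ f.2

theorem isSmoothSection_of_locally {U : Opens M} {σ : ∀ p : U, Fibre E (p : M)}
    (hσ : ∀ p ∈ U, ∃ (U' : Opens M) (h : U' ≤ U), p ∈ U' ∧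
      IsSmoothSection m₀ F E U' fun q => σ (Opens.inclusion h q)) :
    IsSmoothSection m₀ F E U σ := by
  intro p φ
  obtain ⟨U', h, hp, hs⟩ := hσ p p.2
  exact (contMDiffAt_inclusion_iff h (q := ⟨p, hp⟩)
    (f := fun q : U => φ (localRep F E p q (σ q)))).1 (hs ⟨p, hp⟩ φ)

@[simp]
theorem restrict_apply {U' U : Opens M} (h : U' ≤ U) (f : functions m₀ F E U) (q : U') :
    (restrict h f).1 q = f.1 (Opens.inclusion h q) := rfl

theorem sum_apply {U : Opens M} {ι : Type*} [Fintype ι] (f : ι → functions m₀ F E U) (q : U) :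
    (∑ i, f i).1 q = ∑ i, (f i).1 q := by
  rw [AddSubmonoidClass.coe_finsetSum, Finset.sum_apply]

theorem ofSmooth_mem {U : Opens M} (g : U → ℝ) (hg : ContMDiff (𝓡 m₀) 𝓘(ℝ, ℝ) ∞ g) :
    ofSmooth m₀ F E g hg ∈ homogeneous m₀ F E U 0 :=
  fun _ => algebraMap_mem_exteriorPower_zero _

theorem restrict_mem_homogeneous {U' U : Opens M} (h : U' ≤ U) {i : ℤ} {f : functions m₀ F E U}
    (hf : f ∈ homogeneous m₀ F E U i) : restrict h f ∈ homogeneous m₀ F E U' i := by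
  cases i with
  | ofNat l => exact fun p => hf (Opens.inclusion h p)
  | negSucc l =>
    have : f = 0 := hf
    rw [this, map_zero]
    exact Submodule.zero_mem _

/-- The extension by zero of `ρ f`, where `ρ` is a smooth function with support in the domain
of `f`. -/
def bumpExtend {U' U : Opens M} (h : U' ≤ U) (ρ : M → ℝ) (hρ : ContMDiff (𝓡 m₀) 𝓘(ℝ, ℝ) ∞ ρ)
    (hs : tsupport ρ ⊆ U') : functions m₀ F E U' →ₗ[ℝ] functions m₀ F E U := by
  classical
  exact
  { toFun := fun f => ⟨fun p => if hp : (p : M) ∈ U' then ρ p • f.1 ⟨p, hp⟩ else 0, by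
      refine isSmoothSection_of_locally fun p hp => ?_
      by_cases hp' : p ∈ U'
      · refine ⟨U', h, hp', ?_⟩
        refine isSmoothSection_of_eq (ofSmooth m₀ F E (fun q : U' => ρ q)
          (hρ.comp contMDiff_subtype_val) * f) fun q => ?_
        refine (dif_pos q.2).trans ?_
        exact Algebra.smul_def _ _
      · refine ⟨U ⊓ ⟨(tsupport ρ)ᶜ, (isClosed_tsupport ρ).isOpen_compl⟩, inf_le_left,
          ⟨hp, fun h => hp' (hs h)⟩, ?_⟩
        refine isSmoothSection_of_eq 0 fun q => ?_
        have : ρ q = 0 := image_eq_zero_of_notMem_tsupport q.2.2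
        by_cases hq : (q : M) ∈ U'
        · refine (dif_pos hq).trans ?_
          exact this ▸ zero_smul ℝ _
        · exact dif_neg hq⟩
    map_add' := fun f g => Subtype.ext (funext fun p => by
      by_cases hp : (p : M) ∈ U'
      · simp [dif_pos hp]
      · simp [dif_neg hp])
    map_smul' := fun c f => Subtype.ext (funext fun p => by
      by_cases hp : (p : M) ∈ U'
      · simp [dif_pos hp, smul_comm c]
      · simp [dif_neg hp]) }

section

variable {U' U : Opens M} (h : U' ≤ U) {ρ : M → ℝ} (hρ : ContMDiff (𝓡 m₀) 𝓘(ℝ, ℝ) ∞ ρ)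
    (hs : tsupport ρ ⊆ U')

theorem bumpExtend_apply (f : functions m₀ F E U') (q : U') :
    (bumpExtend h ρ hρ hs f).1 (Opens.inclusion h q) = ρ q • f.1 q :=
  dif_pos q.2

theorem bumpExtend_apply_of_notMem (f : functions m₀ F E U') (q : U) (hq : (q : M) ∉ tsupport ρ) :
    (bumpExtend h ρ hρ hs f).1 q = 0 := by
  by_cases hq' : (q : M) ∈ U'
  · have := bumpExtend_apply h hρ hs f ⟨q, hq'⟩
    rw [image_eq_zero_of_notMem_tsupport hq, zero_smul] at this
    exact this
  · exact dif_neg hq'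

theorem bumpExtend_mem {f : functions m₀ F E U'} {i : ℤ} (hf : f ∈ homogeneous m₀ F E U' i) :
    bumpExtend h ρ hρ hs f ∈ homogeneous m₀ F E U i := by
  cases i with
  | ofNat l =>
    intro p
    by_cases hp : (p : M) ∈ U'
    · have := bumpExtend_apply h hρ hs f ⟨p, hp⟩
      change (bumpExtend h ρ hρ hs f).1 p = _ at this
      rw [this]
      exact Submodule.smul_mem _ _ (hf ⟨p, hp⟩)
    · have : (bumpExtend h ρ hρ hs f).1 p = 0 := dif_neg hp
      rw [this]
      exact Submodule.zero_mem _
  | negSucc l =>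
    have : f = 0 := hf
    rw [this, map_zero]
    exact Submodule.zero_mem _

/-- With its mirror image below: extension by zero is linear over C(U) on both sides, which
transfers the graded Leibniz rule from Z to ρ Z. -/
theorem bumpExtend_mul_restrict (f : functions m₀ F E U') (g : functions m₀ F E U) :
    bumpExtend h ρ hρ hs (f * restrict h g) = bumpExtend h ρ hρ hs f * g := by
  refine Subtype.ext (funext fun p => ?_)
  by_cases hp : (p : M) ∈ tsupport ρ
  · have h1 := bumpExtend_apply h hρ hs (f * restrict h g) ⟨p, hs hp⟩
    have h2 := bumpExtend_apply h hρ hs f ⟨p, hs hp⟩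
    change (bumpExtend h ρ hρ hs _).1 p = _ at h1
    change (bumpExtend h ρ hρ hs _).1 p = _ at h2
    change _ = (bumpExtend h ρ hρ hs f).1 p * g.1 p
    rw [h1, h2]
    exact (smul_mul_assoc _ _ _).symm
  · rw [bumpExtend_apply_of_notMem h hρ hs _ p hp]
    change _ = (bumpExtend h ρ hρ hs f).1 p * g.1 p
    rw [bumpExtend_apply_of_notMem h hρ hs _ p hp, zero_mul]

theorem bumpExtend_restrict_mul (f : functions m₀ F E U') (g : functions m₀ F E U) :
    bumpExtend h ρ hρ hs (restrict h g * f) = g * bumpExtend h ρ hρ hs f := by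
  refine Subtype.ext (funext fun p => ?_)
  by_cases hp : (p : M) ∈ tsupport ρ
  · have h1 := bumpExtend_apply h hρ hs (restrict h g * f) ⟨p, hs hp⟩
    have h2 := bumpExtend_apply h hρ hs f ⟨p, hs hp⟩
    change (bumpExtend h ρ hρ hs _).1 p = _ at h1
    change (bumpExtend h ρ hρ hs _).1 p = _ at h2
    change _ = g.1 p * (bumpExtend h ρ hρ hs f).1 p
    rw [h1, h2]
    exact (mul_smul_comm _ _ _).symm
  · rw [bumpExtend_apply_of_notMem h hρ hs _ p hp]
    change _ = g.1 p * (bumpExtend h ρ hρ hs f).1 p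
    rw [bumpExtend_apply_of_notMem h hρ hs _ p hp, mul_zero]

theorem restrict_bumpExtend {N : Opens M} (hN : N ≤ U') (h1 : ∀ p ∈ N, ρ p = 1)
    (f : functions m₀ F E U') :
    restrict (hN.trans h) (bumpExtend h ρ hρ hs f) = restrict hN f := by
  refine Subtype.ext (funext fun p => ?_)
  have := bumpExtend_apply h hρ hs f (Opens.inclusion hN p)
  rw [show ρ (Opens.inclusion hN p) = 1 from h1 p p.2, one_smul] at this
  exact this

end

variable [T2Space M] [IsManifold (𝓡 m₀) ∞ M]

/-- Vector fields are local operators. -/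
theorem restrict_apply_eq_zero {U' U : Opens M} (h : U' ≤ U) {X : Endo m₀ F E U}
    (hX : X ∈ vectorFields m₀ F E U) {f : functions m₀ F E U} (hf : restrict h f = 0) :
    restrict h (X f) = 0 := by
  refine Submodule.iSup_induction (p := fun k : ℤ => vectorFieldsOfDegree m₀ F E U k)
    (motive := fun X => restrict h (X f) = 0) hX (fun k X hX => ?_) (map_zero _) fun X Y hX hY => by
      rw [LinearMap.add_apply, map_add, hX, hY, add_zero]
  refine Subtype.ext (funext fun q => ?_)
  obtain ⟨ρ, hρ, hs, N, hN, hqN, hN1⟩ := exists_bump (m₀ := m₀) (U := U') q.2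
  let r := ofSmooth m₀ F E (fun p : U => ρ p) (hρ.comp contMDiff_subtype_val)
  -- f vanishes on U' and r vanishes off it. Expanding X(r f) = 0 at q, where f = 0 and r = 1,
  -- leaves (X f)(q) = 0.
  have h1 : r * f = 0 := by
    refine Subtype.ext (funext fun p => ?_)
    by_cases hp : (p : M) ∈ tsupport ρ
    · have h2 := congrArg (fun g => g.1 ⟨(p : M), hs hp⟩) hf
      change f.1 p = 0 at h2
      change r.1 p * f.1 p = 0
      rw [h2, mul_zero]
    · change algebraMap ℝ _ (ρ p) * f.1 p = 0
      rw [image_eq_zero_of_notMem_tsupport hp, map_zero, zero_mul]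
  have h2 := hX.leibniz 0 r (ofSmooth_mem _ _) f
  rw [h1, map_zero, zero_mul, zpow_zero, one_smul] at h2
  have h3 := congrArg (fun g => g.1 (Opens.inclusion h q)) h2
  have h4 : f.1 (Opens.inclusion h q) = 0 := congrArg (fun g => g.1 q) hf
  change 0 = (X r).1 (Opens.inclusion h q) * f.1 (Opens.inclusion h q) +
    algebraMap ℝ _ (ρ q) * (X f).1 (Opens.inclusion h q) at h3
  rw [h4, mul_zero, zero_add, hN1 _ hqN, map_one, one_mul] at h3
  exact h3.symm

theorem restrict_apply_congr {U' U : Opens M} (h : U' ≤ U) {X : Endo m₀ F E U}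
    (hX : X ∈ vectorFields m₀ F E U) {f g : functions m₀ F E U}
    (hfg : restrict h f = restrict h g) : restrict h (X f) = restrict h (X g) := by
  rw [← sub_eq_zero, ← map_sub, ← map_sub]
  exact restrict_apply_eq_zero h hX (by rw [map_sub, hfg, sub_self])

theorem apply_congr {U' U : Opens M} (h : U' ≤ U) {X : Endo m₀ F E U}
    (hX : X ∈ vectorFields m₀ F E U) {f g : functions m₀ F E U}
    (hfg : restrict h f = restrict h g) {q : U} (hq : (q : M) ∈ U') : (X f).1 q = (X g).1 q :=
  congrArg (fun g => g.1 ⟨(q : M), hq⟩) (restrict_apply_congr h hX hfg)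

theorem mem_vectorFields_of_degree {U : Opens M} {k : ℤ} {X : Endo m₀ F E U}
    (hX : X ∈ vectorFieldsOfDegree m₀ F E U k) : X ∈ vectorFields m₀ F E U :=
  Submodule.mem_iSup_of_mem k hX

/-- Every germ of a function extends. -/
theorem exists_extension {U' U : Opens M} (h : U' ≤ U) {q : M} (hq : q ∈ U') :
    ∃ (e : functions m₀ F E U' →ₗ[ℝ] functions m₀ F E U) (N : Opens M) (hN : N ≤ U'), q ∈ N ∧
      (∀ f, restrict (hN.trans h) (e f) = restrict hN f) ∧
      ∀ i, ∀ f ∈ homogeneous m₀ F E U' i, e f ∈ homogeneous m₀ F E U i := by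
  obtain ⟨ρ, hρ, hs, N, hN, hqN, hN1⟩ := exists_bump (m₀ := m₀) hq
  exact ⟨bumpExtend h ρ hρ hs, N, hN, hqN, restrict_bumpExtend h hρ hs hN hN1,
    fun i f hf => bumpExtend_mem h hρ hs hf⟩

/-- The restriction of a vector field. -/
theorem exists_isRestriction {U' U : Opens M} (h : U' ≤ U) {k : ℤ} {X : Endo m₀ F E U}
    (hX : X ∈ vectorFieldsOfDegree m₀ F E U k) :
    ∃ Y ∈ vectorFieldsOfDegree m₀ F E U' k, IsRestriction h X Y := by
  choose e N hN hqN he hedeg using fun q : U' =>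
    exists_extension (m₀ := m₀) (F := F) (E := E) h q.2
  have hX' := mem_vectorFields_of_degree hX
  -- The restriction is defined at q by applying X to an extension of the germ of f at q. Locality
  -- makes the value independent of the extension, so one extension can serve all nearby points
  -- (smoothness), and products may be extended factorwise (Leibniz rule).
  have key : ∀ (q : U') (N' : Opens M) (hN' : N' ≤ U') (_ : (q : M) ∈ N')
      (f : functions m₀ F E U') (g : functions m₀ F E U),
      restrict (hN'.trans h) g = restrict hN' f →
      (X (e q f)).1 (Opens.inclusion h q) = (X g).1 (Opens.inclusion h q) := by
    intro q N' hN' hq f g hg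
    refine apply_congr (U' := N q ⊓ N') ((inf_le_left.trans (hN q)).trans h) hX' ?_ ⟨hqN q, hq⟩
    refine Subtype.ext (funext fun p => ?_)
    have h1 := congrArg (fun g => g.1 ⟨(p : M), p.2.1⟩) (he q f)
    have h2 := congrArg (fun g => g.1 ⟨(p : M), p.2.2⟩) hg
    exact h1.trans h2.symm
  let Y : Endo m₀ F E U' :=
    { toFun := fun f => ⟨fun q => (X (e q f)).1 (Opens.inclusion h q), by
        refine isSmoothSection_of_locally fun p hp => ⟨N ⟨p, hp⟩, hN ⟨p, hp⟩, hqN ⟨p, hp⟩, ?_⟩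
        refine isSmoothSection_of_eq (restrict ((hN ⟨p, hp⟩).trans h) (X (e ⟨p, hp⟩ f)))
          fun q => ?_
        exact key _ (N ⟨p, hp⟩) (hN ⟨p, hp⟩) q.2 f _ (he _ f)⟩
      map_add' := fun f g => Subtype.ext (funext fun q => by
        change (X (e q (f + g))).1 _ = (X (e q f)).1 _ + (X (e q g)).1 _
        rw [map_add, map_add]
        rfl)
      map_smul' := fun c f => Subtype.ext (funext fun q => by
        change (X (e q (c • f))).1 _ = c • (X (e q f)).1 _
        rw [map_smul, map_smul]
        rfl) }
  refine ⟨Y, ⟨fun i f hf => ?_, fun i f hf g => ?_⟩, fun f => ?_⟩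
  · have h1 : ∀ q : U', X (e q f) ∈ homogeneous m₀ F E U (i + k) := fun q =>
      hX.degree i _ (hedeg q i f hf)
    generalize i + k = j at h1 ⊢
    cases j with
    | ofNat l => exact fun q => h1 q (Opens.inclusion h q)
    | negSucc l =>
      refine Subtype.ext (funext fun q => ?_)
      have h2 : X (e q f) = 0 := h1 q
      change (X (e q f)).1 _ = 0
      rw [h2]
      rfl
  · refine Subtype.ext (funext fun q => ?_)
    change (X (e q (f * g))).1 _ = (X (e q f)).1 (Opens.inclusion h q) * g.1 q +
      ((-1 : ℝ) ^ (i * k)) • (f.1 q * (X (e q g)).1 (Opens.inclusion h q))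
    have h1 := hX.leibniz i (e q f) (hedeg q i f hf) (e q g)
    rw [key q (N q) (hN q) (hqN q) (f * g) (e q f * e q g)
      (by rw [map_mul, map_mul, he, he]), h1]
    have h2 : ∀ f, (e q f).1 (Opens.inclusion h q) = f.1 q := fun f =>
      congrArg (fun g => g.1 ⟨(q : M), hqN q⟩) (he q f)
    rw [← h2 f, ← h2 g]
    rfl
  · refine Subtype.ext (funext fun q => ?_)
    exact key q U' le_rfl q.2 (restrict h f) f rfl

/-- The vector fields `X` and `Y` span the distribution pointwise over `W`. -/
def Distribution.SpannedBy {d₀ d₁ : ℕ} (D : Distribution m₀ F E d₀ d₁) {W : Opens M}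
    (X : Fin d₀ → Endo m₀ F E W) (Y : Fin d₁ → Endo m₀ F E W) : Prop :=
  ∀ (U' : Opens M) (h : U' ≤ W), ∀ Z ∈ D.sections U', ∀ q : U',
    ∃ (f : Fin d₀ → Fibre E (q : M)) (g : Fin d₁ → Fibre E (q : M)), ∀ s : functions m₀ F E W,
      (Z (restrict h s)).1 q = ∑ i, f i * (X i s).1 (Opens.inclusion h q) +
        ∑ j, g j * (Y j s).1 (Opens.inclusion h q)

theorem bumpExtend_comp_mem {U' U : Opens M} (h : U' ≤ U) {ρ : M → ℝ}
    (hρ : ContMDiff (𝓡 m₀) 𝓘(ℝ, ℝ) ∞ ρ) (hs : tsupport ρ ⊆ U') {Z : Endo m₀ F E U'}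
    (hZ : Z ∈ vectorFields m₀ F E U') :
    bumpExtend h ρ hρ hs ∘ₗ Z ∘ₗ (restrict h).toLinearMap ∈ vectorFields m₀ F E U := by
  refine Submodule.iSup_induction (p := fun k : ℤ => vectorFieldsOfDegree m₀ F E U' k)
    (motive := fun Z => bumpExtend h ρ hρ hs ∘ₗ Z ∘ₗ (restrict h).toLinearMap ∈
      vectorFields m₀ F E U) hZ (fun k Z hZ => ?_) ?_ fun Z₁ Z₂ h₁ h₂ => ?_
  · refine mem_vectorFields_of_degree (k := k) ⟨fun i f hf => ?_, fun i f hf g => ?_⟩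
    · exact bumpExtend_mem h hρ hs (hZ.degree i _ (restrict_mem_homogeneous h hf))
    · simp only [LinearMap.comp_apply, AlgHom.toLinearMap_apply, map_mul]
      rw [hZ.leibniz i _ (restrict_mem_homogeneous h hf), map_add, map_smul,
        bumpExtend_mul_restrict, bumpExtend_restrict_mul]
  · rw [LinearMap.zero_comp, LinearMap.comp_zero]
    exact Submodule.zero_mem _
  · rw [LinearMap.add_comp, LinearMap.comp_add]
    exact Submodule.add_mem _ h₁ h₂

/-- A section Z over U' need not extend to U, but ρ Z does for a bump function ρ supported in U',
and it lies in the distribution by gluing. It is then a combination of the generators over U, and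
has the values of Z where ρ = 1. -/
theorem Distribution.spannedBy_of_sections_eq {d₀ d₁ : ℕ} (D : Distribution m₀ F E d₀ d₁)
    {U : Opens M} {X : Fin d₀ → Endo m₀ F E U} {Y : Fin d₁ → Endo m₀ F E U}
    (hD : D.sections U = Submodule.span (functions m₀ F E U) (range X ∪ range Y)) :
    D.SpannedBy X Y := by
  intro U' h Z hZ q
  obtain ⟨ρ, hρ, hs, N, hN, hqN, hN1⟩ := exists_bump (m₀ := m₀) q.2
  let V : Endo m₀ F E U := bumpExtend h ρ hρ hs ∘ₗ Z ∘ₗ (restrict h).toLinearMap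
  have hV : V ∈ D.sections U := by
    refine D.gluing U V (bumpExtend_comp_mem h hρ hs (D.isVectorField _ _ hZ)) fun p hp => ?_
    by_cases hp' : p ∈ U'
    · let r := ofSmooth m₀ F E (fun p : U' => ρ p) (hρ.comp contMDiff_subtype_val)
      refine ⟨U', h, hp', r • Z, Submodule.smul_mem _ _ hZ, fun f => ?_⟩
      refine Subtype.ext (funext fun p => ?_)
      exact (Algebra.smul_def _ _).symm.trans (bumpExtend_apply h hρ hs _ p).symm
    · refine ⟨U ⊓ ⟨(tsupport ρ)ᶜ, (isClosed_tsupport ρ).isOpen_compl⟩, inf_le_left,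
        ⟨hp, fun h => hp' (hs h)⟩, 0, Submodule.zero_mem _, fun f => ?_⟩
      refine Subtype.ext (funext fun p => ?_)
      exact (bumpExtend_apply_of_notMem h hρ hs (Z (restrict h f)) ⟨p, p.2.1⟩ p.2.2).symm
  rw [hD, Submodule.span_union, Submodule.mem_sup] at hV
  obtain ⟨V₁, hV₁, V₂, hV₂, hV⟩ := hV
  obtain ⟨f, rfl⟩ := (Submodule.mem_span_range_iff_exists_fun _).1 hV₁
  obtain ⟨g, rfl⟩ := (Submodule.mem_span_range_iff_exists_fun _).1 hV₂
  refine ⟨fun i => (f i).1 (Opens.inclusion h q), fun j => (g j).1 (Opens.inclusion h q),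
    fun s => ?_⟩
  have h1 := congrArg (fun T : Endo m₀ F E U => (T s).1 (Opens.inclusion h q)) hV
  have h2 : (V s).1 (Opens.inclusion h q) = (Z (restrict h s)).1 q := by
    refine (bumpExtend_apply h hρ hs _ q).trans ?_
    rw [hN1 _ hqN, one_smul]
    rfl
  simp only [LinearMap.add_apply, LinearMap.sum_apply, LinearMap.smul_apply] at h1
  rw [← h2, ← h1]
  change (∑ i, f i • X i s).1 _ + (∑ i, g i • Y i s).1 _ = _
  rw [sum_apply, sum_apply]
  rfl

/-- Test functions on W' need not extend to W; their germs at q do, and locality says that only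
germs matter. -/
theorem Distribution.SpannedBy.restrict {d₀ d₁ : ℕ} {D : Distribution m₀ F E d₀ d₁}
    {W' W : Opens M} {X : Fin d₀ → Endo m₀ F E W} {Y : Fin d₁ → Endo m₀ F E W}
    (hD : D.SpannedBy X Y) (h : W' ≤ W) {X' : Fin d₀ → Endo m₀ F E W'}
    {Y' : Fin d₁ → Endo m₀ F E W'} (hX' : ∀ i, IsRestriction h (X i) (X' i))
    (hY' : ∀ i, IsRestriction h (Y i) (Y' i))
    (hX'' : ∀ i, X' i ∈ vectorFields m₀ F E W') (hY'' : ∀ i, Y' i ∈ vectorFields m₀ F E W') :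
    D.SpannedBy X' Y' := by
  intro U' hU' Z hZ q
  obtain ⟨f, g, hfg⟩ := hD U' (hU'.trans h) Z hZ q
  obtain ⟨e, N, hN, hqN, he, -⟩ := exists_extension (m₀ := m₀) (F := F) (E := E) h (hU' q.2)
  refine ⟨f, g, fun s => ?_⟩
  have h1 : ∀ T ∈ vectorFields m₀ F E W', (T (DegreeOne.restrict h (e s))).1
      (Opens.inclusion hU' q) = (T s).1 (Opens.inclusion hU' q) := fun T hT =>
    apply_congr hN hT (he s) hqN
  have h2 : (Z (DegreeOne.restrict hU' s)).1 q =
      (Z (DegreeOne.restrict (hU'.trans h) (e s))).1 q := by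
    refine apply_congr (U' := N ⊓ U') inf_le_right (D.isVectorField _ _ hZ) ?_ ⟨hqN, q.2⟩
    refine Subtype.ext (funext fun p => ?_)
    exact (congrArg (fun g => g.1 ⟨(p : M), p.2.1⟩) (he s)).symm
  rw [h2, hfg]
  congr 1
  · refine Finset.sum_congr rfl fun i _ => ?_
    rw [← h1 _ (hX'' i), hX']
    rfl
  · refine Finset.sum_congr rfl fun i _ => ?_
    rw [← h1 _ (hY'' i), hY']
    rfl

end Locality

end

end DegreeOne

/-! ### Components of functions with respect to a frame -/

namespace DegreeOne

noncomputable section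

open Set Filter Topology

section MatrixSmooth

variable {m₀ : ℕ} {N : Type*} [TopologicalSpace N] [ChartedSpace (EuclideanSpace ℝ (Fin m₀)) N]
  {n : Type*} [Fintype n] [DecidableEq n]

theorem contMDiffAt_det {A : N → Matrix n n ℝ} {q : N}
    (hA : ∀ i j, ContMDiffAt (𝓡 m₀) 𝓘(ℝ, ℝ) ∞ (fun p => A p i j) q) :
    ContMDiffAt (𝓡 m₀) 𝓘(ℝ, ℝ) ∞ (fun p => (A p).det) q := by
  simp only [Matrix.det_apply']
  exact ContMDiffAt.sum fun s _ => contMDiffAt_const.mul (contMDiffAt_finsetProd fun i _ => hA _ _)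

theorem contMDiffAt_matrix_inv {A : N → Matrix n n ℝ} {q : N}
    (hA : ∀ i j, ContMDiffAt (𝓡 m₀) 𝓘(ℝ, ℝ) ∞ (fun p => A p i j) q) (hq : (A q).det ≠ 0)
    (i j : n) : ContMDiffAt (𝓡 m₀) 𝓘(ℝ, ℝ) ∞ (fun p => (A p)⁻¹ i j) q := by
  simp only [Matrix.inv_def, Matrix.smul_apply, Ring.inverse_eq_inv', Matrix.adjugate_apply,
    smul_eq_mul]
  refine ((contMDiffAt_det hA).inv₀ hq).mul (contMDiffAt_det fun k l => ?_)
  by_cases hk : k = j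
  · subst hk
    simp only [Matrix.updateRow_self]
    exact contMDiffAt_const
  · simp only [Matrix.updateRow_ne hk]
    exact hA k l

end MatrixSmooth

variable {m₀ : ℕ} {M : Type*} [TopologicalSpace M]
  [ChartedSpace (EuclideanSpace ℝ (Fin m₀)) M]
  {F : Type*} [NormedAddCommGroup F] [NormedSpace ℝ F] [FiniteDimensional ℝ F]
  {E : M → Type*} [∀ p, AddCommGroup (E p)] [∀ p, Module ℝ (E p)]
  [∀ p, TopologicalSpace (E p)] [TopologicalSpace (Bundle.TotalSpace F E)]
  [FiberBundle F E] [VectorBundle ℝ F E]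

theorem localRep_injective {p₀ p : M} (hp : p ∈ (trivializationAt F E p₀).baseSet) :
    Function.Injective (localRep F E p₀ p) := by
  have h : ((trivializationAt F E p₀).linearMapAt ℝ p).dualMap ∘ₗ
      ((trivializationAt F E p₀).symmₗ ℝ p).dualMap = LinearMap.id := by
    refine LinearMap.ext fun x => LinearMap.ext fun v => ?_
    exact congrArg x ((trivializationAt F E p₀).symmₗ_linearMapAt hp v)
  have h2 : (ExteriorAlgebra.map ((trivializationAt F E p₀).linearMapAt ℝ p).dualMap).comp
      (localRep F E p₀ p) = AlgHom.id ℝ _ := by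
    rw [localRep, ExteriorAlgebra.map_comp_map, h, ExteriorAlgebra.map_id]
  exact Function.LeftInverse.injective fun x => DFunLike.congr_fun h2 x

/-- The algebra of constant coefficient functions in `m₁` odd variables. -/
abbrev OddAlgebra (m₁ : ℕ) : Type := ExteriorAlgebra ℝ (Fin m₁ → ℝ)

namespace Coordinates

variable {m₁ : ℕ} {U : Opens M} (c : Coordinates m₀ F E m₁ U)

/-- The covectors of the frame. -/
def covector (p : U) (β : Fin m₁) : Module.Dual ℝ (E (p : M)) :=
  ExteriorAlgebra.ιInv ((c.e β).1 p)

theorem ι_covector (p : U) (β : Fin m₁) :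
    ExteriorAlgebra.ι ℝ (c.covector p β) = (c.e β).1 p := by
  have h : (c.e β).1 p ∈ ⋀[ℝ]^1 (Module.Dual ℝ (E (p : M))) := c.e_mem β p
  rw [ExteriorAlgebra.exteriorPower, pow_one] at h
  obtain ⟨v, hv⟩ := h
  rw [covector, ← hv, ExteriorAlgebra.ι_leftInverse]

/-- The frame at a point, as a basis of the dual of the fibre. -/
def dualBasis (p : U) : Module.Basis (Fin m₁) ℝ (Module.Dual ℝ (E (p : M))) :=
  Module.Basis.mk (v := c.covector p)
    (by
      refine LinearIndependent.of_comp (ExteriorAlgebra.ι ℝ) ?_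
      convert c.linearIndependent p using 1
      exact funext fun β => c.ι_covector p β)
    (by
      intro v _
      have h : ExteriorAlgebra.ι ℝ v ∈ Submodule.span ℝ (range fun β => (c.e β).1 p) := by
        rw [c.span_eq]
        exact ι_mem_exteriorPower_one v
      have h2 : (range fun β => (c.e β).1 p) = ExteriorAlgebra.ι ℝ '' range (c.covector p) := by
        rw [← range_comp]
        exact congrArg range (funext fun β => (c.ι_covector p β).symm)
      rw [h2, Submodule.span_image] at h
      obtain ⟨w, hw, hwv⟩ := h
      rwa [(ExteriorAlgebra.ι_inj ℝ w v).1 hwv] at hw)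

/-- The isomorphism of the fibre at `p` with the model algebra. -/
def fibreEquiv (p : U) : OddAlgebra m₁ ≃ₐ[ℝ] Fibre E (p : M) :=
  AlgEquiv.ofAlgHom
    (ExteriorAlgebra.map (c.dualBasis p).equivFun.symm.toLinearMap)
    (ExteriorAlgebra.map (c.dualBasis p).equivFun.toLinearMap)
    (by rw [ExteriorAlgebra.map_comp_map]; simp)
    (by rw [ExteriorAlgebra.map_comp_map]; simp)

theorem fibreEquiv_ι (p : U) (v : Fin m₁ → ℝ) :
    c.fibreEquiv p (ExteriorAlgebra.ι ℝ v) = ∑ β, v β • (c.e β).1 p := by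
  change ExteriorAlgebra.map (c.dualBasis p).equivFun.symm.toLinearMap (ExteriorAlgebra.ι ℝ v) = _
  rw [ExteriorAlgebra.map_apply_ι, LinearEquiv.coe_coe, Module.Basis.equivFun_symm_apply, map_sum]
  refine Finset.sum_congr rfl fun β _ => ?_
  rw [map_smul, ← c.ι_covector]
  simp [dualBasis]

theorem fibreEquiv_mem {p : U} {l : ℕ} {a : OddAlgebra m₁} (ha : a ∈ ⋀[ℝ]^l (Fin m₁ → ℝ)) :
    c.fibreEquiv p a ∈ ⋀[ℝ]^l (Module.Dual ℝ (E (p : M))) :=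
  map_mem_exteriorPower _ ha

theorem fibreEquiv_symm_mem {p : U} {l : ℕ} {a : Fibre E (p : M)}
    (ha : a ∈ ⋀[ℝ]^l (Module.Dual ℝ (E (p : M)))) :
    (c.fibreEquiv p).symm a ∈ ⋀[ℝ]^l (Fin m₁ → ℝ) :=
  map_mem_exteriorPower _ ha

/-- The functions with constant coefficients with respect to the frame. -/
def frameHom : OddAlgebra m₁ →ₐ[ℝ] functions m₀ F E U :=
  ExteriorAlgebra.lift ℝ ⟨Fintype.linearCombination ℝ c.e, fun v => by
    refine Subtype.ext (funext fun p => ?_)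
    have h : (Fintype.linearCombination ℝ c.e v).1 p =
        c.fibreEquiv p (ExteriorAlgebra.ι ℝ v) := by
      rw [Fintype.linearCombination_apply, sum_apply, fibreEquiv_ι]
      rfl
    change (Fintype.linearCombination ℝ c.e v).1 p * (Fintype.linearCombination ℝ c.e v).1 p = 0
    rw [h, ← map_mul, ExteriorAlgebra.ι_sq_zero, map_zero]⟩

theorem frameHom_ι (v : Fin m₁ → ℝ) : c.frameHom (ExteriorAlgebra.ι ℝ v) = ∑ β, v β • c.e β :=
  ExteriorAlgebra.lift_ι_apply _ _ _ _

theorem frameHom_ι_single (β : Fin m₁) :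
    c.frameHom (ExteriorAlgebra.ι ℝ (Pi.single β 1)) = c.e β := by
  rw [frameHom_ι, Finset.sum_eq_single β]
  · simp
  · intro γ _ hγ
    simp [hγ]
  · simp

theorem frameHom_apply (a : OddAlgebra m₁) (p : U) :
    (c.frameHom a).1 p = c.fibreEquiv p a := by
  let ev : functions m₀ F E U →ₐ[ℝ] Fibre E (p : M) :=
    (Pi.evalAlgHom ℝ _ p).comp (functions m₀ F E U).val
  have h : ev.comp c.frameHom = (c.fibreEquiv p).toAlgHom := by
    refine ExteriorAlgebra.hom_ext (LinearMap.ext fun v => ?_)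
    change (c.frameHom (ExteriorAlgebra.ι ℝ v)).1 p = c.fibreEquiv p (ExteriorAlgebra.ι ℝ v)
    rw [frameHom_ι, sum_apply, fibreEquiv_ι]
    rfl
  exact DFunLike.congr_fun h a

/-- The components of a smooth function on `E[1]` with respect to a frame are smooth. -/
theorem contMDiff_component (ψ : Module.Dual ℝ (OddAlgebra m₁)) (f : functions m₀ F E U) :
    ContMDiff (𝓡 m₀) 𝓘(ℝ, ℝ) ∞ fun p : U => ψ ((c.fibreEquiv p).symm (f.1 p)) := by
  intro p₀
  let b := Module.finBasis ℝ (OddAlgebra m₁)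
  -- `T p` passes from the frame to the local trivialization. With R a left inverse of `T p₀`, the
  -- matrix of R ∘ `T p` has smooth entries and is the identity at p₀. Inverting it near p₀ recovers
  -- the frame components from the trivialized ones.
  let T : U → OddAlgebra m₁ →ₗ[ℝ] ExteriorAlgebra ℝ (Module.Dual ℝ F) := fun p =>
    (localRep F E p₀ p).toLinearMap ∘ₗ (c.fibreEquiv p).toLinearMap
  have hT₀ : LinearMap.ker (T p₀) = ⊥ := LinearMap.ker_eq_bot.2
    ((localRep_injective (FiberBundle.mem_baseSet_trivializationAt' (p₀ : M))).comp
      (c.fibreEquiv p₀).injective)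
  obtain ⟨R, hR⟩ := (T p₀).exists_leftInverse_of_injective hT₀
  let A : U → Matrix (Fin _) (Fin _) ℝ := fun p => LinearMap.toMatrix b b (R ∘ₗ T p)
  have hA : ∀ i j, ContMDiffAt (𝓡 m₀) 𝓘(ℝ, ℝ) ∞ (fun p => A p i j) p₀ := fun i j => by
    have h1 := (c.frameHom (b j)).2 p₀ (b.coord i ∘ₗ R)
    refine h1.congr_of_eventuallyEq (Eventually.of_forall fun p => ?_)
    simp only [A, LinearMap.toMatrix_apply]
    rw [c.frameHom_apply]
    rfl
  have hA₀ : (A p₀).det ≠ 0 := by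
    simp only [A, hR, LinearMap.toMatrix_id, Matrix.det_one]
    exact one_ne_zero
  have hinv := contMDiffAt_matrix_inv hA hA₀
  have hne : ∀ᶠ p in 𝓝 p₀, (A p).det ≠ 0 :=
    (contMDiffAt_det hA).continuousAt.eventually_ne hA₀
  have hw : ∀ j, ContMDiffAt (𝓡 m₀) 𝓘(ℝ, ℝ) ∞
      (fun p : U => b.coord j (R (localRep F E p₀ p (f.1 p)))) p₀ := fun j =>
    f.2 p₀ (b.coord j ∘ₗ R)
  have hfin : ContMDiffAt (𝓡 m₀) 𝓘(ℝ, ℝ) ∞ (fun p : U => ∑ i, (∑ j, (A p)⁻¹ i j *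
      b.coord j (R (localRep F E p₀ p (f.1 p)))) * ψ (b i)) p₀ :=
    ContMDiffAt.sum fun i _ => (ContMDiffAt.sum fun j _ => (hinv i j).mul (hw j)).mul
      contMDiffAt_const
  refine hfin.congr_of_eventuallyEq ?_
  filter_upwards [hne] with p hp
  set a := (c.fibreEquiv p).symm (f.1 p) with ha
  have h1 : R (localRep F E p₀ p (f.1 p)) = (R ∘ₗ T p) a := by
    simp [T, ha]
  have h2 : (A p)⁻¹.mulVec (b.repr (R (localRep F E p₀ p (f.1 p)))) = b.repr a := by
    rw [h1, ← LinearMap.toMatrix_mulVec_repr b b, Matrix.mulVec_mulVec, Matrix.nonsing_inv_mul _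
      (isUnit_iff_ne_zero.2 hp), Matrix.one_mulVec]
  conv_lhs => rw [← b.sum_repr a]
  simp only [map_sum, map_smul, smul_eq_mul]
  refine Finset.sum_congr rfl fun i _ => ?_
  rw [← h2]
  rfl

/-- The function on `E[1]` with given smooth components. -/
def ofComponents (a : U → OddAlgebra m₁) (ha : ∀ ψ : Module.Dual ℝ (OddAlgebra m₁),
    ContMDiff (𝓡 m₀) 𝓘(ℝ, ℝ) ∞ fun p : U => ψ (a p)) : functions m₀ F E U :=
  ⟨fun p => c.fibreEquiv p (a p), by
    let b := Module.finBasis ℝ (OddAlgebra m₁)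
    refine isSmoothSection_of_eq
      (∑ i, ofSmooth m₀ F E _ (ha (b.coord i)) * c.frameHom (b i)) fun p => ?_
    rw [sum_apply]
    conv_lhs => rw [← b.sum_repr (a p), map_sum]
    refine Finset.sum_congr rfl fun i _ => ?_
    change _ = algebraMap ℝ _ (b.coord i (a p)) * (c.frameHom (b i)).1 p
    rw [map_smul, c.frameHom_apply, Algebra.smul_def]
    rfl⟩

/-- Every function is a sum of products of a degree 0 function and one with constant coefficients,
so linear identities need only be tested on such products. -/
theorem eq_sum_components {n : ℕ} (b : Module.Basis (Fin n) ℝ (OddAlgebra m₁))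
    (f : functions m₀ F E U) :
    f = ∑ i, ofSmooth m₀ F E _ (c.contMDiff_component (b.coord i) f) * c.frameHom (b i) := by
  refine Subtype.ext (funext fun p => ?_)
  rw [sum_apply]
  conv_lhs => rw [← (c.fibreEquiv p).apply_symm_apply (f.1 p),
    ← b.sum_repr ((c.fibreEquiv p).symm (f.1 p)), map_sum]
  refine Finset.sum_congr rfl fun i _ => ?_
  change _ = algebraMap ℝ _ (b.coord i _) * (c.frameHom (b i)).1 p
  rw [map_smul, c.frameHom_apply, Algebra.smul_def]
  rfl

end Coordinates

end

end DegreeOne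

/-! ### The chain rule and the coordinate vector fields -/

namespace DegreeOne

noncomputable section

open Set Filter Topology

variable {m₀ : ℕ} {M : Type*} [TopologicalSpace M]
  [ChartedSpace (EuclideanSpace ℝ (Fin m₀)) M]
  {F : Type*} [NormedAddCommGroup F] [NormedSpace ℝ F] [FiniteDimensional ℝ F]
  {E : M → Type*} [∀ p, AddCommGroup (E p)] [∀ p, Module ℝ (E p)]
  [∀ p, TopologicalSpace (E p)] [TopologicalSpace (Bundle.TotalSpace F E)]
  [FiberBundle F E] [VectorBundle ℝ F E]

theorem apply_algebraMap {U : Opens M} {X : Endo m₀ F E U} {k : ℤ}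
    (hX : X ∈ vectorFieldsOfDegree m₀ F E U k) (r : ℝ) : X (algebraMap ℝ _ r) = 0 := by
  have h1 : (1 : functions m₀ F E U) ∈ homogeneous m₀ F E U 0 := fun p => by
    have := algebraMap_mem_exteriorPower_zero (V := Module.Dual ℝ (E (p : M))) 1
    rwa [map_one] at this
  have h2 := hX.leibniz 0 1 h1 1
  rw [mul_one, mul_one, one_mul, zero_mul, zpow_zero, one_smul, left_eq_add] at h2
  rw [Algebra.algebraMap_eq_smul_one, map_smul, h2, smul_zero]

namespace Coordinates

variable {m₁ : ℕ} {U : Opens M} (c : Coordinates m₀ F E m₁ U)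

theorem chart_mem_target (p : U) : c.chart p ∈ c.chart.target :=
  c.chart.map_source (by rw [c.chart_source]; exact p.2)

theorem symm_mem {y : EuclideanSpace ℝ (Fin m₀)} (hy : y ∈ c.chart.target) :
    c.chart.symm y ∈ U := by
  have := c.chart.map_target hy
  rwa [c.chart_source] at this

theorem symm_chart (p : U) : c.chart.symm (c.chart p) = p :=
  c.chart.left_inv (by rw [c.chart_source]; exact p.2)

/-- The coordinate expression of a function. -/
def express (g : U → ℝ) (y : EuclideanSpace ℝ (Fin m₀)) : ℝ := by
  classical exact if h : c.chart.symm y ∈ U then g ⟨_, h⟩ else 0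

theorem express_of_mem (g : U → ℝ) {y : EuclideanSpace ℝ (Fin m₀)} (hy : y ∈ c.chart.target) :
    c.express g y = g ⟨c.chart.symm y, c.symm_mem hy⟩ := dif_pos _

theorem express_chart (g : U → ℝ) (p : U) : c.express g (c.chart p) = g p := by
  rw [c.express_of_mem g (c.chart_mem_target p)]
  exact congrArg g (Subtype.ext (c.symm_chart p))

theorem contDiffOn_express {g : U → ℝ} (hg : ContMDiff (𝓡 m₀) 𝓘(ℝ, ℝ) ∞ g) :
    ContDiffOn ℝ ∞ (c.express g) c.chart.target := by
  classical
  let G : M → ℝ := fun p => if hp : p ∈ U then g ⟨p, hp⟩ else 0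
  have hG : ContMDiffOn (𝓡 m₀) 𝓘(ℝ, ℝ) ∞ G U := by
    intro p hp
    have h1 : g = fun p : U => G p := by
      funext p
      simp [G]
    have h2 := hg ⟨p, hp⟩
    rw [h1, contMDiffAt_subtype_iff] at h2
    exact h2.contMDiffWithinAt
  rw [← contMDiffOn_iff_contDiffOn]
  exact hG.comp (contMDiffOn_symm_of_mem_maximalAtlas c.chart_mem) fun y hy => c.symm_mem hy

theorem contMDiff_comp_chart {H : EuclideanSpace ℝ (Fin m₀) → ℝ}
    (hH : ContDiffOn ℝ ∞ H c.chart.target) :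
    ContMDiff (𝓡 m₀) 𝓘(ℝ, ℝ) ∞ fun p : U => H (c.chart p) := by
  have h1 : ContMDiffOn (𝓡 m₀) (𝓡 m₀) ∞ c.chart c.chart.source :=
    contMDiffOn_of_mem_maximalAtlas c.chart_mem
  have h2 : ContMDiff (𝓡 m₀) (𝓡 m₀) ∞ (fun p : U => c.chart (p : M)) :=
    h1.comp_contMDiff contMDiff_subtype_val fun p => by rw [c.chart_source]; exact p.2
  exact (contMDiffOn_iff_contDiffOn.2 hH).comp_contMDiff h2 c.chart_mem_target

/-- The function of degree `0` with a given coordinate expression. -/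
def pull (H : EuclideanSpace ℝ (Fin m₀) → ℝ) (hH : ContDiffOn ℝ ∞ H c.chart.target) :
    functions m₀ F E U :=
  ofSmooth m₀ F E _ (c.contMDiff_comp_chart hH)

theorem pull_apply (H : EuclideanSpace ℝ (Fin m₀) → ℝ) (hH : ContDiffOn ℝ ∞ H c.chart.target)
    (q : U) : (c.pull H hH).1 q = algebraMap ℝ (Fibre E (q : M)) (H (c.chart q)) := rfl

theorem pull_mem (H : EuclideanSpace ℝ (Fin m₀) → ℝ) (hH : ContDiffOn ℝ ∞ H c.chart.target) :
    c.pull H hH ∈ homogeneous m₀ F E U 0 := ofSmooth_mem _ _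

theorem x_mem (α : Fin m₀) : c.x α ∈ homogeneous m₀ F E U 0 := ofSmooth_mem _ _

theorem ofSmooth_eq_pull (g : U → ℝ) (hg : ContMDiff (𝓡 m₀) 𝓘(ℝ, ℝ) ∞ g) :
    ofSmooth m₀ F E g hg = c.pull (c.express g) (c.contDiffOn_express hg) :=
  Subtype.ext (funext fun q => by
    rw [pull_apply, express_chart]
    rfl)

/-- Every function of degree `0` is smooth in the coordinates. -/
theorem exists_eq_pull {f : functions m₀ F E U} (hf : f ∈ homogeneous m₀ F E U 0) :
    ∃ (H : EuclideanSpace ℝ (Fin m₀) → ℝ) (hH : ContDiffOn ℝ ∞ H c.chart.target),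
      f = c.pull H hH := by
  let g : U → ℝ := fun q => ExteriorAlgebra.algebraMapInv (f.1 q)
  have hg : ∀ q, algebraMap ℝ _ (g q) = f.1 q := fun q => algebraMap_algebraMapInv_of_mem (hf q)
  have hg' : ContMDiff (𝓡 m₀) 𝓘(ℝ, ℝ) ∞ g := fun q₀ => by
    refine (f.2 q₀ ExteriorAlgebra.algebraMapInv.toLinearMap).congr_of_eventuallyEq
      (Eventually.of_forall fun q => ?_)
    simp only
    rw [← hg q, AlgHom.commutes]
    exact (ExteriorAlgebra.algebraMap_leftInverse _ _).symm
  exact ⟨_, c.contDiffOn_express hg', (Subtype.ext (funext fun q => (hg q).symm)).trans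
    (c.ofSmooth_eq_pull g hg')⟩

/-- The chain rule. -/
theorem apply_pull [T2Space M] [IsManifold (𝓡 m₀) ∞ M] {X : Endo m₀ F E U} {k : ℤ}
    (hX : X ∈ vectorFieldsOfDegree m₀ F E U k) (H : EuclideanSpace ℝ (Fin m₀) → ℝ)
    (hH : ContDiffOn ℝ ∞ H c.chart.target) (q : U) :
    (X (c.pull H hH)).1 q = ∑ α, fderiv ℝ H (c.chart q) (EuclideanSpace.single α 1) •
      (X (c.x α)).1 q := by
  obtain ⟨g, O, hg, hO, hqO, hOt, hHg⟩ :=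
    exists_hadamard_factor c.chart.open_target hH (c.chart_mem_target q)
  set y₀ := c.chart q with hy₀
  have hgα : ∀ α, ContDiffOn ℝ ∞ (fun y => g y (EuclideanSpace.single α 1)) c.chart.target :=
    fun α => (hg.clm_apply contDiff_const).contDiffOn
  let N : Opens M := ⟨c.chart.source ∩ c.chart ⁻¹' O, c.chart.isOpen_inter_preimage hO⟩
  have hN : N ≤ U := fun p hp => by
    have := hp.1
    rwa [c.chart_source] at this
  have hqN : (q : M) ∈ N := ⟨by rw [c.chart_source]; exact q.2, hqO⟩
  have hexp : ∀ y v, g y v = ∑ α, v α * g y (EuclideanSpace.single α 1) := fun y v => by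
    conv_lhs => rw [← (EuclideanSpace.basisFun (Fin m₀) ℝ).sum_repr v, map_sum]
    simp
  have hd : fderiv ℝ H y₀ = g y₀ := by
    have h1 : HasFDerivAt (fun y => g y (y - y₀)) (g y₀) y₀ := by
      have h2 := ((hg.differentiable (by simp) y₀).hasFDerivAt).clm_apply
        ((hasFDerivAt_id (𝕜 := ℝ) y₀).sub_const y₀)
      refine h2.congr_fderiv (ContinuousLinearMap.ext fun v => ?_)
      simp
    refine ((h1.const_add (H y₀)).congr_of_eventuallyEq ?_).fderiv
    filter_upwards [hO.mem_nhds hqO] with y hy using hHg y hy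
  -- Hadamard: H = H(y₀) + Σ g_α (x^α - y₀^α) near q. After applying X, constants disappear and so
  -- do, at q, the terms X(g_α)(x^α - y₀^α), leaving g_α(y₀) = ∂_α H(y₀) as coefficient of X(x^α).
  have hloc : restrict hN (c.pull H hH) = restrict hN (algebraMap ℝ _ (H y₀) +
      ∑ α, c.pull _ (hgα α) * (c.x α - algebraMap ℝ _ (y₀ α))) := by
    refine Subtype.ext (funext fun p => ?_)
    rw [restrict_apply, restrict_apply, pull_apply, hHg _ p.2.2, hexp, map_add]
    change _ = algebraMap ℝ _ (H y₀) + (∑ α, c.pull _ (hgα α) *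
      (c.x α - algebraMap ℝ _ (y₀ α))).1 _
    rw [sum_apply, map_sum]
    congr 1
    refine Finset.sum_congr rfl fun α _ => ?_
    change _ = algebraMap ℝ (Fibre E (p : M)) (g (c.chart p) (EuclideanSpace.single α 1)) *
      (algebraMap ℝ _ (c.chart p α) - algebraMap ℝ _ (y₀ α))
    rw [← map_sub, ← map_mul, mul_comm]
    rfl
  rw [apply_congr hN (mem_vectorFields_of_degree hX) hloc hqN, map_add, apply_algebraMap hX,
    zero_add, map_sum, sum_apply]
  refine Finset.sum_congr rfl fun α _ => ?_
  rw [hX.leibniz 0 (c.pull _ (hgα α)) (c.pull_mem _ _), map_sub, apply_algebraMap hX, sub_zero, zero_mul,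
    zpow_zero, one_smul, hd]
  change (X (c.pull _ (hgα α))).1 q * (algebraMap ℝ _ (c.chart q α) - algebraMap ℝ _ (y₀ α)) +
    algebraMap ℝ _ (g (c.chart q) (EuclideanSpace.single α 1)) * (X (c.x α)).1 q = _
  rw [← hy₀, sub_self, mul_zero, zero_add, Algebra.smul_def]

/-- The value of a function at a point, in the model algebra. -/
def value (f : functions m₀ F E U) (p : U) : OddAlgebra m₁ := (c.fibreEquiv p).symm (f.1 p)

theorem fibreEquiv_value (f : functions m₀ F E U) (p : U) :
    c.fibreEquiv p (c.value f p) = f.1 p := (c.fibreEquiv p).apply_symm_apply _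

theorem value_add (f g : functions m₀ F E U) (p : U) :
    c.value (f + g) p = c.value f p + c.value g p := map_add (c.fibreEquiv p).symm _ _

theorem value_smul (r : ℝ) (f : functions m₀ F E U) (p : U) :
    c.value (r • f) p = r • c.value f p := map_smul (c.fibreEquiv p).symm _ _

theorem value_mul (f g : functions m₀ F E U) (p : U) :
    c.value (f * g) p = c.value f p * c.value g p := map_mul (c.fibreEquiv p).symm _ _

theorem value_frameHom (a : OddAlgebra m₁) (p : U) : c.value (c.frameHom a) p = a := by
  rw [value, frameHom_apply, AlgEquiv.symm_apply_apply]

theorem value_e (β : Fin m₁) (p : U) :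
    c.value (c.e β) p = ExteriorAlgebra.ι ℝ (Pi.single β 1) := by
  rw [← c.frameHom_ι_single, value_frameHom]

theorem value_ofSmooth (g : U → ℝ) (hg : ContMDiff (𝓡 m₀) 𝓘(ℝ, ℝ) ∞ g) (p : U) :
    c.value (ofSmooth m₀ F E g hg) p = algebraMap ℝ _ (g p) :=
  (c.fibreEquiv p).symm.commutes (g p)

theorem value_mem {f : functions m₀ F E U} {l : ℕ} (hf : f ∈ homogeneous m₀ F E U l) (p : U) :
    c.value f p ∈ ⋀[ℝ]^l (Fin m₁ → ℝ) := c.fibreEquiv_symm_mem (hf p)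

theorem ext_value {f g : functions m₀ F E U} (h : ∀ p, c.value f p = c.value g p) : f = g :=
  Subtype.ext (funext fun p => (c.fibreEquiv p).symm.injective (h p))

theorem contDiffOn_express_value (ψ : Module.Dual ℝ (OddAlgebra m₁)) (f : functions m₀ F E U) :
    ContDiffOn ℝ ∞ (c.express fun p => ψ (c.value f p)) c.chart.target :=
  c.contDiffOn_express (c.contMDiff_component ψ f)

theorem differentiableAt_express_value (ψ : Module.Dual ℝ (OddAlgebra m₁))
    (f : functions m₀ F E U) (p : U) :
    DifferentiableAt ℝ (c.express fun p => ψ (c.value f p)) (c.chart p) :=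
  ((c.contDiffOn_express_value ψ f).contDiffAt
    (c.chart.open_target.mem_nhds (c.chart_mem_target p))).differentiableAt (by simp)

/-- The derivative of the value of a function in the direction of a coordinate. -/
def dvalue (α : Fin m₀) (f : functions m₀ F E U) (p : U) : OddAlgebra m₁ :=
  ∑ i, (fderiv ℝ (c.express fun p => (Module.finBasis ℝ (OddAlgebra m₁)).coord i (c.value f p))
    (c.chart p) (EuclideanSpace.single α 1)) • Module.finBasis ℝ (OddAlgebra m₁) i

/-- Every functional is a combination of the basis coordinates used in the definition. The rules for
`dvalue` thereby reduce to rules for derivatives of real functions. -/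
theorem dual_dvalue (ψ : Module.Dual ℝ (OddAlgebra m₁)) (α : Fin m₀) (f : functions m₀ F E U)
    (p : U) : ψ (c.dvalue α f p) = fderiv ℝ (c.express fun p => ψ (c.value f p))
      (c.chart p) (EuclideanSpace.single α 1) := by
  set b := Module.finBasis ℝ (OddAlgebra m₁)
  have h1 : EqOn (c.express fun p => ψ (c.value f p)) (fun y => ∑ i, ψ (b i) *
      (c.express fun p => b.coord i (c.value f p)) y) c.chart.target := fun y hy => by
    simp only [c.express_of_mem _ hy]
    conv_lhs => rw [← b.sum_repr (c.value f ⟨c.chart.symm y, c.symm_mem hy⟩), map_sum]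
    refine Finset.sum_congr rfl fun i _ => ?_
    rw [map_smul, smul_eq_mul, mul_comm]
    rfl
  have h2 : HasFDerivAt (fun y => ∑ i, ψ (b i) *
      (c.express fun p => b.coord i (c.value f p)) y) _ (c.chart p) :=
    HasFDerivAt.fun_sum fun i _ =>
      (c.differentiableAt_express_value (b.coord i) f p).hasFDerivAt.const_mul (ψ (b i))
  rw [(h1.eventuallyEq_of_mem (c.chart.open_target.mem_nhds (c.chart_mem_target p))).fderiv_eq,
    h2.fderiv]
  simp only [dvalue, map_sum, map_smul, smul_eq_mul, FunLike.coe_sum,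
    Finset.sum_apply, FunLike.coe_smul, Pi.smul_apply]
  exact Finset.sum_congr rfl fun i _ => mul_comm _ _

theorem ext_dual {x y : OddAlgebra m₁} (h : ∀ ψ : Module.Dual ℝ (OddAlgebra m₁), ψ x = ψ y) :
    x = y :=
  (Module.finBasis ℝ (OddAlgebra m₁)).ext_elem fun i => h ((Module.finBasis ℝ _).coord i)

theorem dual_mul {n : ℕ} (b : Module.Basis (Fin n) ℝ (OddAlgebra m₁))
    (ψ : Module.Dual ℝ (OddAlgebra m₁)) (x y : OddAlgebra m₁) :
    ψ (x * y) = ∑ i, ∑ j, (b.coord i x * b.coord j y) * ψ (b i * b j) := by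
  conv_lhs => rw [← b.sum_repr x, ← b.sum_repr y]
  simp only [Finset.sum_mul_sum, map_sum, smul_mul_smul_comm, map_smul, smul_eq_mul,
    Module.Basis.coord_apply]

theorem dvalue_mul (α : Fin m₀) (f g : functions m₀ F E U) (p : U) :
    c.dvalue α (f * g) p = c.dvalue α f p * c.value g p + c.value f p * c.dvalue α g p := by
  refine ext_dual fun ψ => ?_
  set b := Module.finBasis ℝ (OddAlgebra m₁)
  rw [dual_dvalue, map_add, dual_mul b, dual_mul b]
  have h1 : EqOn (c.express fun p => ψ (c.value (f * g) p)) (fun y => ∑ i, ∑ j,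
      ((c.express fun p => b.coord i (c.value f p)) y *
        (c.express fun p => b.coord j (c.value g p)) y) * ψ (b i * b j)) c.chart.target :=
    fun y hy => by
      simp only [c.express_of_mem _ hy]
      rw [value_mul, dual_mul b]
  have h2 : HasFDerivAt (fun y => ∑ i, ∑ j,
      ((c.express fun p => b.coord i (c.value f p)) y *
        (c.express fun p => b.coord j (c.value g p)) y) * ψ (b i * b j)) _ (c.chart p) :=
    HasFDerivAt.fun_sum fun i _ => HasFDerivAt.fun_sum fun j _ =>
      ((c.differentiableAt_express_value (b.coord i) f p).hasFDerivAt.mul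
      (c.differentiableAt_express_value (b.coord j) g p).hasFDerivAt).mul_const (ψ (b i * b j))
  rw [(h1.eventuallyEq_of_mem (c.chart.open_target.mem_nhds (c.chart_mem_target p))).fderiv_eq,
    h2.fderiv]
  simp only [FunLike.coe_sum, Finset.sum_apply, FunLike.coe_smul, Pi.smul_apply,
    FunLike.coe_add, Pi.add_apply, smul_eq_mul, dual_dvalue, express_chart,
    ← Finset.sum_add_distrib]
  refine Finset.sum_congr rfl fun i _ => Finset.sum_congr rfl fun j _ => ?_
  ring

theorem dvalue_add (α : Fin m₀) (f g : functions m₀ F E U) (p : U) :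
    c.dvalue α (f + g) p = c.dvalue α f p + c.dvalue α g p := by
  refine ext_dual fun ψ => ?_
  rw [map_add, dual_dvalue, dual_dvalue, dual_dvalue]
  have h1 : EqOn (c.express fun p => ψ (c.value (f + g) p))
      ((c.express fun p => ψ (c.value f p)) + c.express fun p => ψ (c.value g p))
      c.chart.target := fun y hy => by
    simp only [c.express_of_mem _ hy, Pi.add_apply, value_add, map_add]
  rw [(h1.eventuallyEq_of_mem (c.chart.open_target.mem_nhds (c.chart_mem_target p))).fderiv_eq,
    fderiv_add (c.differentiableAt_express_value ψ f p) (c.differentiableAt_express_value ψ g p)]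
  rfl

theorem dvalue_smul (α : Fin m₀) (r : ℝ) (f : functions m₀ F E U) (p : U) :
    c.dvalue α (r • f) p = r • c.dvalue α f p := by
  refine ext_dual fun ψ => ?_
  rw [map_smul, dual_dvalue, dual_dvalue]
  have h1 : EqOn (c.express fun p => ψ (c.value (r • f) p))
      (r • c.express fun p => ψ (c.value f p)) c.chart.target := fun y hy => by
    simp only [c.express_of_mem _ hy, Pi.smul_apply, value_smul, map_smul]
  rw [(h1.eventuallyEq_of_mem (c.chart.open_target.mem_nhds (c.chart_mem_target p))).fderiv_eq,
    fderiv_const_smul (c.differentiableAt_express_value ψ f p)]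
  rfl

/-- A subspace is cut out by the functionals annihilating it; those annihilating ⋀ˡ vanish on all
values of f, hence on their derivatives. -/
theorem dvalue_mem (α : Fin m₀) {f : functions m₀ F E U} {l : ℕ}
    (hf : f ∈ homogeneous m₀ F E U l) (p : U) : c.dvalue α f p ∈ ⋀[ℝ]^l (Fin m₁ → ℝ) := by
  rw [← Subspace.forall_mem_dualAnnihilator_apply_eq_zero_iff]
  intro ψ hψ
  rw [dual_dvalue]
  have h1 : EqOn (c.express fun p => ψ (c.value f p)) (fun _ => 0) c.chart.target :=
    fun y hy => by
      rw [c.express_of_mem _ hy]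
      exact (Submodule.mem_dualAnnihilator ψ).1 hψ _ (c.value_mem hf _)
  rw [(h1.eventuallyEq_of_mem (c.chart.open_target.mem_nhds (c.chart_mem_target p))).fderiv_eq]
  simp

theorem dvalue_pull (α : Fin m₀) (H : EuclideanSpace ℝ (Fin m₀) → ℝ)
    (hH : ContDiffOn ℝ ∞ H c.chart.target) (p : U) : c.dvalue α (c.pull H hH) p =
      algebraMap ℝ _ (fderiv ℝ H (c.chart p) (EuclideanSpace.single α 1)) := by
  refine ext_dual fun ψ => ?_
  rw [dual_dvalue, Algebra.algebraMap_eq_smul_one, map_smul, smul_eq_mul, mul_comm]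
  have h1 : EqOn (c.express fun p => ψ (c.value (c.pull H hH) p)) (ψ 1 • H) c.chart.target :=
    fun y hy => by
      rw [c.express_of_mem _ hy, pull, value_ofSmooth, Algebra.algebraMap_eq_smul_one, map_smul]
      simp [c.chart.right_inv hy, mul_comm]
  rw [(h1.eventuallyEq_of_mem (c.chart.open_target.mem_nhds (c.chart_mem_target p))).fderiv_eq,
    fderiv_const_smul ((hH.contDiffAt
      (c.chart.open_target.mem_nhds (c.chart_mem_target p))).differentiableAt (by simp))]
  rfl

theorem dvalue_frameHom (α : Fin m₀) (a : OddAlgebra m₁) (p : U) :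
    c.dvalue α (c.frameHom a) p = 0 := by
  refine ext_dual fun ψ => ?_
  rw [dual_dvalue, map_zero]
  have h1 : EqOn (c.express fun p => ψ (c.value (c.frameHom a) p)) (fun _ => ψ a)
      c.chart.target := fun y hy => by
    rw [c.express_of_mem _ hy, value_frameHom]
  rw [(h1.eventuallyEq_of_mem (c.chart.open_target.mem_nhds (c.chart_mem_target p))).fderiv_eq]
  simp

theorem value_ofComponents (a : U → OddAlgebra m₁) (ha : ∀ ψ : Module.Dual ℝ (OddAlgebra m₁),
    ContMDiff (𝓡 m₀) 𝓘(ℝ, ℝ) ∞ fun p : U => ψ (a p)) (p : U) :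
    c.value (c.ofComponents a ha) p = a p := (c.fibreEquiv p).symm_apply_apply _

theorem mem_of_value_mem {f : functions m₀ F E U} {l : ℕ}
    (h : ∀ p, c.value f p ∈ ⋀[ℝ]^l (Fin m₁ → ℝ)) : f ∈ homogeneous m₀ F E U l := fun p => by
  rw [← c.fibreEquiv_value]
  exact c.fibreEquiv_mem (h p)

/-- The coordinate vector field `∂/∂x^α`. -/
def partialX (α : Fin m₀) : Endo m₀ F E U where
  toFun f := c.ofComponents (c.dvalue α f) fun ψ => by
    simp only [dual_dvalue]
    refine c.contMDiff_comp_chart (H := fun y => fderiv ℝ _ y (EuclideanSpace.single α 1)) ?_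
    exact ((c.contDiffOn_express_value _ f).fderiv_of_isOpen c.chart.open_target
      (by simp)).clm_apply contDiffOn_const
  map_add' f g := c.ext_value fun p => by
    rw [value_add, value_ofComponents, value_ofComponents, value_ofComponents, dvalue_add]
  map_smul' r f := c.ext_value fun p => by
    rw [RingHom.id_apply, value_smul, value_ofComponents, value_ofComponents, dvalue_smul]

theorem value_partialX (α : Fin m₀) (f : functions m₀ F E U) (p : U) :
    c.value (c.partialX α f) p = c.dvalue α f p :=
  (c.fibreEquiv p).symm_apply_apply _

theorem x_eq_pull (α : Fin m₀) : c.x α = c.pull (fun y => y α) (by fun_prop) := rfl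

theorem isPartialX_partialX (α : Fin m₀) : c.IsPartialX α (c.partialX α) where
  mem := by
    refine ⟨fun i f hf => ?_, fun i f hf g => c.ext_value fun p => ?_⟩
    · rw [add_zero]
      cases i with
      | ofNat l => exact c.mem_of_value_mem fun p => c.value_partialX α f p ▸ c.dvalue_mem α hf p
      | negSucc l =>
        have : f = 0 := hf
        rw [this, map_zero]
        exact Submodule.zero_mem _
    · rw [mul_zero, zpow_zero, one_smul, value_add, value_mul, value_mul, value_partialX,
        value_partialX, value_partialX, dvalue_mul]
  apply_x α' := c.ext_value fun p => by
    rw [value_partialX, x_eq_pull, dvalue_pull]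
    have h1 : HasFDerivAt (fun y : EuclideanSpace ℝ (Fin m₀) => y α')
        (EuclideanSpace.proj α' : _ →L[ℝ] ℝ) (c.chart p) :=
      (EuclideanSpace.proj (𝕜 := ℝ) α').hasFDerivAt
    rw [h1.fderiv]
    change algebraMap ℝ _ ((EuclideanSpace.single α (1 : ℝ) : EuclideanSpace ℝ (Fin m₀)) α') = _
    rw [PiLp.single_apply]
    by_cases h : α = α'
    · rw [if_pos h, if_pos h.symm, map_one]
      exact (map_one (c.fibreEquiv p).symm).symm
    · rw [if_neg h, if_neg (Ne.symm h), map_zero]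
      exact (map_zero (c.fibreEquiv p).symm).symm
  apply_e β := c.ext_value fun p => by
    rw [value_partialX, ← c.frameHom_ι_single, dvalue_frameHom]
    exact (map_zero (c.fibreEquiv p).symm).symm

theorem neg_one_zpow_mul_neg_one (l : ℕ) : (-1 : ℝ) ^ ((l : ℤ) * -1) = (-1) ^ l := by
  rw [mul_neg_one, zpow_neg, zpow_natCast, ← inv_pow, inv_neg_one]

theorem contMDiff_map_value (T : OddAlgebra m₁ →ₗ[ℝ] OddAlgebra m₁)
    (ψ : Module.Dual ℝ (OddAlgebra m₁)) (f : functions m₀ F E U) :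
    ContMDiff (𝓡 m₀) 𝓘(ℝ, ℝ) ∞ fun p : U => ψ (T (c.value f p)) :=
  c.contMDiff_component (ψ ∘ₗ T) f

/-- The `β`-th coordinate of a vector. -/
def coordDual (β : Fin m₁) : Module.Dual ℝ (Fin m₁ → ℝ) := LinearMap.proj β

/-- The coordinate vector field `∂/∂e^β`. -/
def partialE (β : Fin m₁) : Endo m₀ F E U where
  toFun f := c.ofComponents (fun p => contract (coordDual β) (c.value f p)) fun ψ =>
    c.contMDiff_map_value (contract (coordDual β)) ψ f
  map_add' f g := c.ext_value fun p => by
    rw [value_add, value_ofComponents, value_ofComponents, value_ofComponents, value_add, map_add]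
  map_smul' r f := c.ext_value fun p => by
    rw [RingHom.id_apply, value_smul, value_ofComponents, value_ofComponents, value_smul, map_smul]

theorem value_partialE (β : Fin m₁) (f : functions m₀ F E U) (p : U) :
    c.value (c.partialE β f) p = contract (coordDual β) (c.value f p) :=
  (c.fibreEquiv p).symm_apply_apply _

theorem isPartialE_partialE (β : Fin m₁) : c.IsPartialE β (c.partialE β) where
  mem := by
    refine ⟨fun i f hf => ?_, fun i f hf g => c.ext_value fun p => ?_⟩
    · cases i with
      | ofNat l =>
        cases l with
        -- In the target degree 0 - 1 the only homogeneous function is 0, so membership amounts to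
        -- vanishing.
        | zero =>
          have : c.partialE β f = 0 := c.ext_value fun p => by
            rw [value_partialE, contract_of_mem_zero _ (c.value_mem hf p)]
            exact (map_zero (c.fibreEquiv p).symm).symm
          rw [this]
          exact Submodule.zero_mem _
        | succ l =>
          have h : Int.ofNat (l + 1) + -1 = (l : ℤ) := by simp
          rw [h]
          exact c.mem_of_value_mem fun p => c.value_partialE β f p ▸ contract_mem _ (c.value_mem hf p)
      | negSucc l =>
        have : f = 0 := hf
        rw [this, map_zero]
        exact Submodule.zero_mem _
    · cases i with
      | ofNat l =>
        have h := neg_one_zpow_mul_neg_one l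
        simp only [Int.ofNat_eq_natCast] at *
        rw [h, value_add, value_smul, value_mul, value_mul, value_partialE, value_partialE,
          value_partialE, value_mul, contract_mul_of_mem _ (c.value_mem hf p)]
      | negSucc l =>
        have : f = 0 := hf
        simp [this]
  apply_x α := c.ext_value fun p => by
    rw [value_partialE, contract_of_mem_zero _ (c.value_mem (c.x_mem α) p)]
    exact (map_zero (c.fibreEquiv p).symm).symm
  apply_e β' := c.ext_value fun p => by
    rw [value_partialE, value_e, contract_ι, coordDual, LinearMap.proj_apply, Pi.single_apply]
    by_cases h : β = β'
    · rw [if_pos h, if_pos h, map_one]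
      exact (map_one (c.fibreEquiv p).symm).symm
    · rw [if_neg h, if_neg h, map_zero]
      exact (map_zero (c.fibreEquiv p).symm).symm

end Coordinates

end

end DegreeOne

/-! ### Vector fields are combinations of coordinate vector fields -/

namespace DegreeOne

noncomputable section

open Set Filter Topology

variable {m₀ : ℕ} {M : Type*} [TopologicalSpace M]
  [ChartedSpace (EuclideanSpace ℝ (Fin m₀)) M]
  {F : Type*} [NormedAddCommGroup F] [NormedSpace ℝ F] [FiniteDimensional ℝ F]
  {E : M → Type*} [∀ p, AddCommGroup (E p)] [∀ p, Module ℝ (E p)]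
  [∀ p, TopologicalSpace (E p)] [TopologicalSpace (Bundle.TotalSpace F E)]
  [FiberBundle F E] [VectorBundle ℝ F E]

theorem mul_leibniz_zero {A : Type*} [Semiring A] {h f : A} (hc : h * f = f * h) (a b g : A) :
    f * (a * g + h * b) = f * a * g + h * (f * b) := by
  rw [mul_add, ← mul_assoc, ← mul_assoc, ← hc, mul_assoc h]

theorem mul_leibniz_one {A : Type*} [Semiring A] [Algebra ℝ A] {f w : A} {s r t : ℝ}
    (h : f * w = s • (w * f)) (b g : A) :
    f * (r • (1 : A) * g + t • (w * b)) = r • (f * g) + (t * s) • (w * (f * b)) := by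
  rw [mul_add, smul_mul_assoc, one_mul, mul_smul_comm, mul_smul_comm, ← mul_assoc, h,
    smul_mul_assoc, mul_assoc, smul_smul]

theorem sum_leibniz_one {A ι κ : Type*} [Semiring A] [Algebra ℝ A] [Fintype ι] [Fintype κ]
    (s : ℝ) (w : A) (a : ι → A) (b d : κ → A) :
    ∑ i, s • (w * a i) + ∑ j, (b j + s • (w * d j)) =
      ∑ j, b j + s • (w * (∑ i, a i + ∑ j, d j)) := by
  rw [Finset.sum_add_distrib, ← Finset.smul_sum, ← Finset.smul_sum, ← Finset.mul_sum,
    ← Finset.mul_sum, mul_add, smul_add, add_left_comm]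

theorem sum_leibniz_zero {A ι κ : Type*} [Semiring A] [Fintype ι] [Fintype κ]
    (g h : A) (a b : ι → A) (a' b' : κ → A) :
    ∑ i, (a i * g + h * b i) + ∑ j, (a' j * g + h * b' j) =
      (∑ i, a i + ∑ j, a' j) * g + h * (∑ i, b i + ∑ j, b' j) := by
  rw [Finset.sum_add_distrib, Finset.sum_add_distrib, ← Finset.sum_mul, ← Finset.sum_mul,
    ← Finset.mul_sum, ← Finset.mul_sum, mul_add, add_mul, add_add_add_comm]

theorem map_sum_smul_mul {A ι : Type*} [Semiring A] [Algebra ℝ A] [Fintype ι] (Z : A →ₗ[ℝ] A)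
    (v : ι → ℝ) (e : ι → A) (g : A) : Z (∑ i, v i • e i) * g = ∑ i, v i • (Z (e i) * g) := by
  rw [map_sum, Finset.sum_mul]
  exact Finset.sum_congr rfl fun i _ => by rw [map_smul, smul_mul_assoc]

theorem mul_one_form {U : Opens M} {f w : functions m₀ F E U} {j : ℤ}
    (hf : f ∈ homogeneous m₀ F E U j) (hw : w ∈ homogeneous m₀ F E U 1) :
    f * w = (-1 : ℝ) ^ j • (w * f) := by
  cases j with
  | ofNat l =>
    refine Subtype.ext (funext fun p => ?_)
    have h : w.1 p ∈ ⋀[ℝ]^1 (Module.Dual ℝ (E (p : M))) := hw p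
    rw [ExteriorAlgebra.exteriorPower, pow_one] at h
    obtain ⟨v, hv⟩ := h
    have h2 := mul_ι_of_mem (hf p) v
    rw [hv] at h2
    rw [Int.ofNat_eq_natCast, zpow_natCast]
    exact h2
  | negSucc l =>
    have : f = 0 := hf
    rw [this, zero_mul, mul_zero, smul_zero]

theorem mul_comm_of_mem_zero {U : Opens M} {f : functions m₀ F E U}
    (hf : f ∈ homogeneous m₀ F E U 0) (g : functions m₀ F E U) : f * g = g * f := by
  refine Subtype.ext (funext fun p => ?_)
  change f.1 p * g.1 p = g.1 p * f.1 p
  rw [← algebraMap_algebraMapInv_of_mem (hf p)]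
  exact Algebra.commutes _ _

theorem leibniz_zero {U : Opens M} {X : Endo m₀ F E U} {k : ℤ}
    (hX : X ∈ vectorFieldsOfDegree m₀ F E U k) {f : functions m₀ F E U}
    (hf : f ∈ homogeneous m₀ F E U 0) (g : functions m₀ F E U) : X (f * g) = X f * g + f * X g := by
  rw [hX.leibniz 0 f hf g, zero_mul, zpow_zero, one_smul]

theorem leibniz_one {U : Opens M} {X : Endo m₀ F E U} {k : ℤ}
    (hX : X ∈ vectorFieldsOfDegree m₀ F E U k) {f : functions m₀ F E U}
    (hf : f ∈ homogeneous m₀ F E U 1) (g : functions m₀ F E U) :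
    X (f * g) = X f * g + (-1 : ℝ) ^ k • (f * X g) := by
  rw [hX.leibniz 1 f hf g, one_mul]

namespace Coordinates

variable {m₁ : ℕ} {U : Opens M} (c : Coordinates m₀ F E m₁ U)

theorem frameHom_ι_mem (v : Fin m₁ → ℝ) :
    c.frameHom (ExteriorAlgebra.ι ℝ v) ∈ homogeneous m₀ F E U 1 := by
  rw [frameHom_ι]
  exact Submodule.sum_mem _ fun β _ => Submodule.smul_mem _ _ (c.e_mem β)

variable {c} [T2Space M] [IsManifold (𝓡 m₀) ∞ M]

theorem apply_pull_eq {X : Fin m₀ → Endo m₀ F E U} {Y : Fin m₁ → Endo m₀ F E U}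
    (hX : ∀ α, c.IsPartialX α (X α)) (hY : ∀ β, c.IsPartialE β (Y β)) {Z : Endo m₀ F E U} {k : ℤ}
    (hZ : Z ∈ vectorFieldsOfDegree m₀ F E U k) (H : EuclideanSpace ℝ (Fin m₀) → ℝ)
    (hH : ContDiffOn ℝ ∞ H c.chart.target) :
    Z (c.pull H hH) = ∑ α, Z (c.x α) * X α (c.pull H hH) +
      ∑ β, Z (c.e β) * Y β (c.pull H hH) := by
  refine Subtype.ext (funext fun q => ?_)
  change _ = (∑ α, Z (c.x α) * X α (c.pull H hH)).1 q +
      (∑ β, Z (c.e β) * Y β (c.pull H hH)).1 q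
  rw [sum_apply, sum_apply, c.apply_pull hZ]
  have h1 : ∀ α, (X α (c.pull H hH)).1 q =
      algebraMap ℝ _ (fderiv ℝ H (c.chart q) (EuclideanSpace.single α 1)) := fun α => by
    rw [c.apply_pull (hX α).mem, Finset.sum_eq_single α]
    · rw [(hX α).apply_x, if_pos rfl, Algebra.algebraMap_eq_smul_one]
      rfl
    · intro α' _ h
      rw [(hX α).apply_x, if_neg (Ne.symm h)]
      exact smul_zero _
    · simp
  have h2 : ∀ β, (Y β (c.pull H hH)).1 q = 0 := fun β => by
    rw [c.apply_pull (hY β).mem]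
    refine Finset.sum_eq_zero fun α _ => ?_
    rw [(hY β).apply_x]
    exact smul_zero _
  have h3 : ∑ β, (Z (c.e β) * Y β (c.pull H hH)).1 q = 0 :=
    Finset.sum_eq_zero fun β _ => by
      change (Z (c.e β)).1 q * (Y β (c.pull H hH)).1 q = 0
      rw [h2, mul_zero]
  rw [h3, add_zero]
  refine Finset.sum_congr rfl fun α _ => ?_
  change _ = (Z (c.x α)).1 q * (X α (c.pull H hH)).1 q
  rw [h1, ← Algebra.commutes, Algebra.smul_def]

/-- Both sides obey the same signed Leibniz rule on w g, for w a constant combination of the frame.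
On the right the sign arises from moving w to the left past the coefficients Z(x^α), Z(e^β) and from
the degrees of the coordinate fields. -/
theorem apply_oneForm_mul_eq {X : Fin m₀ → Endo m₀ F E U} {Y : Fin m₁ → Endo m₀ F E U}
    (hX : ∀ α, c.IsPartialX α (X α)) (hY : ∀ β, c.IsPartialE β (Y β)) {Z : Endo m₀ F E U} {k : ℤ}
    (hZ : Z ∈ vectorFieldsOfDegree m₀ F E U k) {w g : functions m₀ F E U} {v : Fin m₁ → ℝ}
    (hwm : w ∈ homogeneous m₀ F E U 1) (hws : w = ∑ β, v β • c.e β)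
    (ih : Z g = ∑ α, Z (c.x α) * X α g + ∑ β, Z (c.e β) * Y β g) :
    Z (w * g) = ∑ α, Z (c.x α) * X α (w * g) + ∑ β, Z (c.e β) * Y β (w * g) := by
  have h1 : ∀ α, Z (c.x α) * X α (w * g) = (-1 : ℝ) ^ k • (w * (Z (c.x α) * X α g)) :=
    fun α => by
      have h3 : X α w = 0 := by
        rw [hws, map_sum]
        exact Finset.sum_eq_zero fun β _ => by rw [map_smul, (hX α).apply_e, smul_zero]
      have h4 := hZ.degree 0 _ (c.x_mem α)
      rw [zero_add] at h4
      have h5 := mul_leibniz_one (r := 0) (t := 1) (mul_one_form h4 hwm) (X α g) g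
      rw [leibniz_one (hX α).mem hwm, h3, zpow_zero, ← zero_smul ℝ (1 : functions m₀ F E U), h5, one_mul,
        zero_smul, zero_add]
  have h2 : ∀ β, Z (c.e β) * Y β (w * g) = v β • (Z (c.e β) * g) +
      (-1 : ℝ) ^ k • (w * (Z (c.e β) * Y β g)) := fun β => by
    have h3 : Y β w = v β • 1 := by
      rw [hws, map_sum, Finset.sum_eq_single β]
      · rw [map_smul, (hY β).apply_e, if_pos rfl]
      · intro β' _ h
        rw [map_smul, (hY β).apply_e, if_neg (Ne.symm h), smul_zero]
      · exact fun h => absurd (Finset.mem_univ _) h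
    have h4 := hZ.degree 1 _ (c.e_mem β)
    -- Moving w past Z(e^β), of degree 1 + k, costs (-1)^(1+k); the extra sign is cancelled by that
    -- of the odd field Y β.
    have h5 : (-1 : ℝ) ^ (1 + k) = -(-1 : ℝ) ^ k := by
      rw [zpow_add₀ (by norm_num), zpow_one, neg_one_mul]
    have h6 := mul_leibniz_one (r := v β) (t := (-1) ^ (-1 : ℤ)) (mul_one_form h4 hwm) (Y β g) g
    rw [leibniz_one (hY β).mem hwm, h3, h6, h5, zpow_neg_one, inv_neg_one, neg_one_mul, neg_neg]
  have h6 : Z w * g = ∑ β, v β • (Z (c.e β) * g) := by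
    rw [hws, map_sum_smul_mul]
  refine (leibniz_one hZ hwm g).trans ?_
  rw [h6, ih]
  refine (sum_leibniz_one _ _ _ _ _).symm.trans ?_
  exact congrArg₂ (· + ·) (Finset.sum_congr rfl fun α _ => (h1 α).symm)
    (Finset.sum_congr rfl fun β _ => (h2 β).symm)

theorem apply_frameHom_eq {X : Fin m₀ → Endo m₀ F E U} {Y : Fin m₁ → Endo m₀ F E U}
    (hX : ∀ α, c.IsPartialX α (X α)) (hY : ∀ β, c.IsPartialE β (Y β)) {Z : Endo m₀ F E U} {k : ℤ}
    (hZ : Z ∈ vectorFieldsOfDegree m₀ F E U k) (a : OddAlgebra m₁) :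
    Z (c.frameHom a) = ∑ α, Z (c.x α) * X α (c.frameHom a) +
      ∑ β, Z (c.e β) * Y β (c.frameHom a) := by
  induction a using CliffordAlgebra.left_induction with
  | algebraMap r =>
    have h : c.frameHom (algebraMap ℝ (OddAlgebra m₁) r) = algebraMap ℝ _ r :=
      c.frameHom.commutes r
    have h' := fun {T : Endo m₀ F E U} {k : ℤ} (hT : T ∈ vectorFieldsOfDegree m₀ F E U k) =>
      apply_algebraMap hT r
    rw [← h] at h'
    have h1 : ∀ α, Z (c.x α) * X α (c.frameHom (algebraMap ℝ (OddAlgebra m₁) r)) = 0 := fun α => by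
      rw [h' (hX α).mem, mul_zero]
    have h2 : ∀ β, Z (c.e β) * Y β (c.frameHom (algebraMap ℝ (OddAlgebra m₁) r)) = 0 := fun β => by
      rw [h' (hY β).mem, mul_zero]
    refine (h' hZ).trans ?_
    exact ((congrArg₂ (· + ·) (Finset.sum_eq_zero fun α _ => h1 α)
      (Finset.sum_eq_zero fun β _ => h2 β)).trans (add_zero _)).symm
  | add x y hx hy =>
    simp only [map_add, hx, hy, mul_add, Finset.sum_add_distrib]
    abel
  | ι_mul a v ih =>
    change Z (c.frameHom (ExteriorAlgebra.ι ℝ v * a)) =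
      ∑ α, Z (c.x α) * X α (c.frameHom (ExteriorAlgebra.ι ℝ v * a)) +
      ∑ β, Z (c.e β) * Y β (c.frameHom (ExteriorAlgebra.ι ℝ v * a))
    rw [map_mul]
    exact apply_oneForm_mul_eq hX hY hZ (c.frameHom_ι_mem v) (c.frameHom_ι v) ih

/-- A factor h of degree 0 commutes with everything, so both sides satisfy the unsigned Leibniz rule
on h g. The factor g is covered by `apply_frameHom_eq`, and h by the chain rule. -/
theorem apply_mul_frameHom_eq {X : Fin m₀ → Endo m₀ F E U} {Y : Fin m₁ → Endo m₀ F E U}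
    (hX : ∀ α, c.IsPartialX α (X α)) (hY : ∀ β, c.IsPartialE β (Y β)) {Z : Endo m₀ F E U} {k : ℤ}
    (hZ : Z ∈ vectorFieldsOfDegree m₀ F E U k) {h : functions m₀ F E U}
    (hm : h ∈ homogeneous m₀ F E U 0) (a : OddAlgebra m₁) :
    Z (h * c.frameHom a) = ∑ α, Z (c.x α) * X α (h * c.frameHom a) +
      ∑ β, Z (c.e β) * Y β (h * c.frameHom a) := by
  have h0 := apply_frameHom_eq hX hY hZ a
  generalize c.frameHom a = g at h0 ⊢
  have key : ∀ {T : Endo m₀ F E U} {l : ℤ}, T ∈ vectorFieldsOfDegree m₀ F E U l →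
      ∀ f g : functions m₀ F E U, f * T (h * g) = f * T h * g + h * (f * T g) :=
    fun {T l} hT f g => by
      rw [leibniz_zero hT hm, mul_leibniz_zero (mul_comm_of_mem_zero hm f)]
  rw [Finset.sum_congr rfl fun α _ => key (hX α).mem _ _,
    Finset.sum_congr rfl fun β _ => key (hY β).mem _ _, sum_leibniz_zero, ← h0,
    leibniz_zero hZ hm]
  obtain ⟨H, hH, rfl⟩ := c.exists_eq_pull hm
  rw [← apply_pull_eq hX hY hZ H hH]

/-- Every vector field is a combination of the coordinate vector fields. -/
theorem eq_sum_partials {X : Fin m₀ → Endo m₀ F E U} {Y : Fin m₁ → Endo m₀ F E U}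
    (hX : ∀ α, c.IsPartialX α (X α)) (hY : ∀ β, c.IsPartialE β (Y β)) {Z : Endo m₀ F E U}
    (hZ : Z ∈ vectorFields m₀ F E U) :
    Z = ∑ α, Z (c.x α) • X α + ∑ β, Z (c.e β) • Y β := by
  refine Submodule.iSup_induction (p := fun k : ℤ => vectorFieldsOfDegree m₀ F E U k)
    (motive := fun Z => Z = ∑ α, Z (c.x α) • X α + ∑ β, Z (c.e β) • Y β) hZ
    (fun k Z hZ => LinearMap.ext fun f => ?_) (by simp) fun Z₁ Z₂ h₁ h₂ => ?_
  · have h1 : ∀ g : functions m₀ F E U, (∑ α, Z (c.x α) • X α + ∑ β, Z (c.e β) • Y β) g =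
        ∑ α, Z (c.x α) * X α g + ∑ β, Z (c.e β) * Y β g := fun g => by
      simp only [LinearMap.add_apply, LinearMap.sum_apply, LinearMap.smul_apply, smul_eq_mul]
    generalize ∑ α, Z (c.x α) • X α + ∑ β, Z (c.e β) • Y β = R at h1
    -- The identity is linear in f, so f may be a product of a degree 0 function and one with
    -- constant coefficients.
    rw [c.eq_sum_components (Module.finBasis ℝ (OddAlgebra m₁)) f, map_sum, map_sum]
    refine Finset.sum_congr rfl fun i _ => ?_
    rw [h1]
    exact apply_mul_frameHom_eq hX hY hZ (ofSmooth_mem _ _) _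
  · conv_lhs => rw [h₁, h₂]
    simp only [LinearMap.add_apply, add_smul, Finset.sum_add_distrib]
    abel

end Coordinates

end

end DegreeOne

/-! ### Existence and change of coordinates -/

namespace DegreeOne

noncomputable section

open Set Filter Topology

variable {m₀ : ℕ} {M : Type*} [TopologicalSpace M]
  [ChartedSpace (EuclideanSpace ℝ (Fin m₀)) M]
  {F : Type*} [NormedAddCommGroup F] [NormedSpace ℝ F] [FiniteDimensional ℝ F]
  {E : M → Type*} [∀ p, AddCommGroup (E p)] [∀ p, Module ℝ (E p)]
  [∀ p, TopologicalSpace (E p)] [TopologicalSpace (Bundle.TotalSpace F E)]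
  [FiberBundle F E] [VectorBundle ℝ F E]

/-- Coordinates are changed by a local diffeomorphism of the base and a change of the frame. -/
theorem Coordinates.exists_change [IsManifold (𝓡 m₀) ∞ M] {m₁ : ℕ} {U : Opens M}
    (c : Coordinates m₀ F E m₁ U) {U' : Opens M} (h : U' ≤ U)
    (Ψ : OpenPartialHomeomorph (EuclideanSpace ℝ (Fin m₀)) (EuclideanSpace ℝ (Fin m₀)))
    (hΨ : ContDiffOn ℝ ∞ Ψ Ψ.source) (hΨ' : ContDiffOn ℝ ∞ Ψ.symm Ψ.target)
    (hU' : ∀ q ∈ U', c.chart q ∈ Ψ.source) (e' : Fin m₁ → functions m₀ F E U')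
    (he' : ∀ β, e' β ∈ homogeneous m₀ F E U' 1)
    (hs : ∀ (q : U') β, (c.e β).1 (Opens.inclusion h q) ∈
      Submodule.span ℝ (range fun γ => (e' γ).1 q)) :
    ∃ c' : Coordinates m₀ F E m₁ U', (∀ q, c'.chart q = Ψ (c.chart q)) ∧
      c'.chart.target = {y ∈ Ψ.target | c.chart.symm (Ψ.symm y) ∈ U' ∧
        Ψ.symm y ∈ c.chart.target} ∧ c'.e = e' := by
  have hspan : ∀ q : U', Submodule.span ℝ (range fun β => (e' β).1 q) =
      ⋀[ℝ]^1 (Module.Dual ℝ (E (q : M))) := fun q => by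
    refine le_antisymm (Submodule.span_le.2 ?_) ?_
    · rintro _ ⟨β, rfl⟩
      exact he' β q
    · have h1 := c.span_eq (Opens.inclusion h q)
      refine h1.symm.le.trans (Submodule.span_le.2 ?_)
      rintro _ ⟨β, rfl⟩
      exact hs q β
  let Φ := (c.chart.trans Ψ).restrOpen U' U'.isOpen
  have hsrc : Φ.source = U' := by
    rw [OpenPartialHomeomorph.restrOpen_source, OpenPartialHomeomorph.trans_source, c.chart_source]
    exact inter_eq_right.2 fun q hq => ⟨h hq, hU' q hq⟩
  have htgt : Φ.target = {y ∈ Ψ.target | c.chart.symm (Ψ.symm y) ∈ U' ∧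
        Ψ.symm y ∈ c.chart.target} := by
    ext y
    refine ⟨fun hy => ?_, fun hy => ?_⟩
    · have h1 : y ∈ (c.chart.trans Ψ).target := hy.1
      rw [OpenPartialHomeomorph.trans_target] at h1
      exact ⟨h1.1, hy.2, h1.2⟩
    · refine ⟨?_, hy.2.1⟩
      have h1 : y ∈ (c.chart.trans Ψ).target := by
        rw [OpenPartialHomeomorph.trans_target]
        exact ⟨hy.1, hy.2.2⟩
      exact h1
  refine ⟨{ chart := Φ
            chart_mem := ?_
            chart_source := hsrc
            e := e'
            e_mem := he'
            linearIndependent := fun q => ?_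
            span_eq := hspan }, fun q => rfl, htgt, rfl⟩
  · refine OpenPartialHomeomorph.mem_maximalAtlas_of_contMDiffOn _ ?_ ?_
    · have h1 : ContMDiffOn (𝓡 m₀) (𝓡 m₀) ∞ c.chart Φ.source :=
        (contMDiffOn_of_mem_maximalAtlas c.chart_mem).mono (by rwa [hsrc, c.chart_source])
      have h2 : ContMDiffOn (𝓡 m₀) (𝓡 m₀) ∞ Ψ Ψ.source := contMDiffOn_iff_contDiffOn.2 hΨ
      exact h2.comp h1 fun q hq => hU' q (by rwa [hsrc] at hq)
    · have h1 : ContMDiffOn (𝓡 m₀) (𝓡 m₀) ∞ Ψ.symm Φ.target :=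
        (contMDiffOn_iff_contDiffOn.2 hΨ').mono (by rw [htgt]; exact fun y hy => hy.1)
      have h2 : ContMDiffOn (𝓡 m₀) (𝓡 m₀) ∞ c.chart.symm c.chart.target :=
        contMDiffOn_symm_of_mem_maximalAtlas c.chart_mem
      exact h2.comp h1 fun y hy => by
        rw [htgt] at hy
        exact hy.2.2
  -- The new frame consists of m₁ vectors spanning a space of dimension m₁, the dimension being
  -- counted with the old frame.
  · rw [linearIndependent_iff_card_eq_finrank_span, Set.finrank, hspan]
    have h1 := linearIndependent_iff_card_eq_finrank_span.1 (c.linearIndependent (Opens.inclusion h q))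
    rwa [Set.finrank, c.span_eq] at h1

/-- The `1`-form on `E` given by a linear form in a local trivialization. -/
def trivializationForm [ContMDiffVectorBundle ∞ F E (𝓡 m₀)]
    (t : Bundle.Trivialization F (Bundle.TotalSpace.proj : Bundle.TotalSpace F E → M))
    [MemTrivializationAtlas t] {U : Opens M} (hU : (U : Set M) ⊆ t.baseSet)
    (L : Module.Dual ℝ F) : functions m₀ F E U :=
  ⟨fun q => ExteriorAlgebra.ι ℝ (L ∘ₗ t.linearMapAt ℝ (q : M)), fun p₀ φ => by
    let t₀ := trivializationAt F E (p₀ : M)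
    -- In the trivialization around p₀ the form is L composed with the transition map. Its
    -- components are thus a fixed linear functional of the transition map, which is smooth.
    let ℓ : (F →L[ℝ] F) →ₗ[ℝ] ℝ := φ ∘ₗ ExteriorAlgebra.ι ℝ ∘ₗ
      (LinearMap.llcomp ℝ F F ℝ L) ∘ₗ ContinuousLinearMap.coeLM ℝ
    have hp₀ : (p₀ : M) ∈ t₀.baseSet := FiberBundle.mem_baseSet_trivializationAt' (p₀ : M)
    have h1 : ContMDiffAt (𝓡 m₀) 𝓘(ℝ, F →L[ℝ] F) ∞
        (fun q : U => (t₀.coordChangeL ℝ t (q : M) : F →L[ℝ] F)) p₀ :=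
      (contMDiffAt_coordChangeL hp₀ (hU p₀.2)).comp p₀ contMDiff_subtype_val.contMDiffAt
    refine ((LinearMap.toContinuousLinearMap ℓ).contMDiff.contMDiffAt.comp p₀ h1
      ).congr_of_eventuallyEq ?_
    filter_upwards [(t₀.open_baseSet.preimage continuous_subtype_val).mem_nhds hp₀] with q hq
    have h2 : (L ∘ₗ t.linearMapAt ℝ (q : M)) ∘ₗ t₀.symmₗ ℝ (q : M) =
        L ∘ₗ ((t₀.coordChangeL ℝ t (q : M) : F →L[ℝ] F) : F →ₗ[ℝ] F) := by
      refine LinearMap.ext fun v => congrArg L ?_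
      refine Eq.trans ?_ (t₀.coordChangeL_apply t ⟨hq, hU q.2⟩ v).symm
      rw [t.linearMapAt_apply, if_pos (hU q.2), t₀.symmₗ_apply hq]
    rw [localRep, ExteriorAlgebra.map_apply_ι]
    exact congrArg (fun x => φ (ExteriorAlgebra.ι ℝ x)) h2⟩

/-- A basis of F* pulled back through a local trivialization is a frame of E*; the chart is shrunk
to the common domain. -/
theorem exists_coordinates [IsManifold (𝓡 m₀) ∞ M] [ContMDiffVectorBundle ∞ F E (𝓡 m₀)]
    {m₁ : ℕ} (hF : Module.finrank ℝ F = m₁) {W : Opens M} {p : M} (hp : p ∈ W) :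
    ∃ U : Opens M, p ∈ U ∧ U ≤ W ∧ Nonempty (Coordinates m₀ F E m₁ U) := by
  subst hF
  let t := trivializationAt F E p
  let U : Opens M := ⟨(chartAt (EuclideanSpace ℝ (Fin m₀)) p).source ∩ (W ∩ t.baseSet),
    (chartAt _ p).open_source.inter (W.isOpen.inter t.open_baseSet)⟩
  have hU : (U : Set M) ⊆ t.baseSet := fun q hq => hq.2.2
  let b := (Module.finBasis ℝ F).dualBasis
  let B : ∀ q : U, Module.Basis (Fin (Module.finrank ℝ F)) ℝ (Module.Dual ℝ (E (q : M))) :=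
    fun q => b.map (t.linearEquivAt ℝ (q : M) (hU q.2)).dualMap
  have hB : ∀ (q : U) β, (trivializationForm (m₀ := m₀) t hU (b β)).1 q =
      ExteriorAlgebra.ι ℝ (B q β) := fun q β => by
    refine congrArg (ExteriorAlgebra.ι ℝ) (LinearMap.ext fun v => congrArg (b β) ?_)
    rw [t.linearMapAt_apply, if_pos (hU q.2)]
    rfl
  refine ⟨U, ⟨mem_chart_source _ p, hp, FiberBundle.mem_baseSet_trivializationAt' p⟩,
    fun q hq => hq.2.1, ⟨{
      chart := (chartAt (EuclideanSpace ℝ (Fin m₀)) p).restrOpen U U.isOpen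
      chart_mem := ?_
      chart_source := ?_
      e := fun β => trivializationForm t hU (b β)
      e_mem := fun β q => ?_
      linearIndependent := fun q => ?_
      span_eq := fun q => ?_ }⟩⟩
  · have h1 := IsManifold.chart_mem_maximalAtlas (I := 𝓡 m₀) (n := ∞) p
    refine OpenPartialHomeomorph.mem_maximalAtlas_of_contMDiffOn _ ?_ ?_
    · exact (contMDiffOn_of_mem_maximalAtlas h1).mono fun q hq => hq.1
    · exact (contMDiffOn_symm_of_mem_maximalAtlas h1).mono fun q hq => hq.1
  · rw [OpenPartialHomeomorph.restrOpen_source]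
    exact inter_eq_right.2 fun q hq => hq.1
  · exact ι_mem_exteriorPower_one _
  · rw [funext (hB q)]
    exact (B q).linearIndependent.map' (ExteriorAlgebra.ι ℝ)
      (LinearMap.ker_eq_bot.2 (ExteriorAlgebra.ι_leftInverse.injective))
  · rw [funext (hB q), range_comp' (ExteriorAlgebra.ι ℝ), Submodule.span_image, (B q).span_eq,
      Submodule.map_top, ExteriorAlgebra.exteriorPower, pow_one]

end

end DegreeOne

/-! ### Symbol, connection and odd symbol of a vector field -/

namespace DegreeOne

noncomputable section

open Set Filter Topology

variable {m₀ : ℕ} {M : Type*} [TopologicalSpace M]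
  [ChartedSpace (EuclideanSpace ℝ (Fin m₀)) M]
  {F : Type*} [NormedAddCommGroup F] [NormedSpace ℝ F] [FiniteDimensional ℝ F]
  {E : M → Type*} [∀ p, AddCommGroup (E p)] [∀ p, Module ℝ (E p)]
  [∀ p, TopologicalSpace (E p)] [TopologicalSpace (Bundle.TotalSpace F E)]
  [FiberBundle F E] [VectorBundle ℝ F E]

/-- The image has degree -1, and the space of functions of negative degree is zero by definition. -/
theorem apply_eq_zero_of_degree_neg {U : Opens M} {Y : Endo m₀ F E U}
    (hY : Y ∈ vectorFieldsOfDegree m₀ F E U (-1)) {f : functions m₀ F E U}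
    (hf : f ∈ homogeneous m₀ F E U 0) : Y f = 0 := hY.degree 0 f hf

theorem sum_proj_smul {n : ℕ} (ξ : (Fin n → ℝ) →L[ℝ] ℝ) :
    ∑ β, ξ (Pi.single β 1) • (ContinuousLinearMap.proj β : (Fin n → ℝ) →L[ℝ] ℝ) = ξ := by
  refine ContinuousLinearMap.ext fun w => ?_
  conv_rhs => rw [← Finset.univ_sum_single w, map_sum]
  rw [FunLike.coe_sum, Finset.sum_apply]
  refine Finset.sum_congr rfl fun β _ => ?_
  have h : (Pi.single β (w β) : Fin n → ℝ) = w β • Pi.single β 1 := by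
    rw [← Pi.single_smul, smul_eq_mul, mul_one]
  rw [h, map_smul]
  exact mul_comm _ _

namespace Coordinates

variable {m₁ : ℕ} {U : Opens M} (c : Coordinates m₀ F E m₁ U)

/-- The element of degree `1` of the fibre at `q` with given components. -/
def odd (q : U) : ((Fin m₁ → ℝ) →L[ℝ] ℝ) →ₗ[ℝ] Fibre E (q : M) where
  toFun ξ := ∑ β, ξ (Pi.single β 1) • (c.e β).1 q
  map_add' ξ η := by
    rw [← Finset.sum_add_distrib]
    exact Finset.sum_congr rfl fun β _ => add_smul _ _ _
  map_smul' r ξ := by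
    rw [RingHom.id_apply, Finset.smul_sum]
    exact Finset.sum_congr rfl fun β _ => mul_smul _ _ _

theorem odd_apply (q : U) (ξ : (Fin m₁ → ℝ) →L[ℝ] ℝ) :
    c.odd q ξ = ∑ β, ξ (Pi.single β 1) • (c.e β).1 q := rfl

theorem odd_proj (q : U) (β : Fin m₁) : c.odd q (ContinuousLinearMap.proj β) = (c.e β).1 q := by
  rw [odd_apply, Finset.sum_eq_single β]
  · simp
  · intro γ _ h
    simp [Ne.symm h]
  · simp

theorem odd_injective (q : U) : Function.Injective (c.odd q) := by
  rw [← LinearMap.ker_eq_bot, LinearMap.ker_eq_bot']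
  intro ξ hξ
  have h1 := Fintype.linearIndependent_iff.1 (c.linearIndependent q) _ hξ
  rw [← sum_proj_smul ξ]
  exact Finset.sum_eq_zero fun β _ => by rw [h1, zero_smul]

theorem odd_mem (q : U) (ξ : (Fin m₁ → ℝ) →L[ℝ] ℝ) :
    c.odd q ξ ∈ ⋀[ℝ]^1 (Module.Dual ℝ (E (q : M))) := by
  rw [odd_apply]
  exact Submodule.sum_mem _ fun β _ => Submodule.smul_mem _ _ (c.e_mem β q)

theorem exists_eq_odd {f : functions m₀ F E U} (hf : f ∈ homogeneous m₀ F E U 1) :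
    ∃ ξ : EuclideanSpace ℝ (Fin m₀) → (Fin m₁ → ℝ) →L[ℝ] ℝ, ContDiffOn ℝ ∞ ξ c.chart.target ∧
      ∀ q, f.1 q = c.odd q (ξ (c.chart q)) := by
  let ψ : Fin m₁ → Module.Dual ℝ (OddAlgebra m₁) := fun γ =>
    LinearMap.proj γ ∘ₗ ExteriorAlgebra.ιInv
  refine ⟨fun y => ∑ γ, c.express (fun p => ψ γ (c.value f p)) y • ContinuousLinearMap.proj γ,
    ContDiffOn.sum fun γ _ => (c.contDiffOn_express_value (ψ γ) f).smul contDiffOn_const,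
    fun q => ?_⟩
  have h1 : c.value f q ∈ ⋀[ℝ]^1 (Fin m₁ → ℝ) := c.value_mem (l := 1) hf q
  rw [ExteriorAlgebra.exteriorPower, pow_one] at h1
  obtain ⟨v, hv⟩ := h1
  rw [map_sum, ← c.fibreEquiv_value f q, ← hv, fibreEquiv_ι]
  refine Finset.sum_congr rfl fun γ _ => ?_
  rw [map_smul, odd_proj, express_chart]
  have h2 : ψ γ (c.value f q) = v γ := by
    rw [← hv]
    exact congrFun (ExteriorAlgebra.ι_leftInverse v) γ
  rw [h2]

/-- The function of degree `1` with given components. -/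
def form (ξ : EuclideanSpace ℝ (Fin m₀) → (Fin m₁ → ℝ) →L[ℝ] ℝ)
    (hξ : ContDiffOn ℝ ∞ ξ c.chart.target) : functions m₀ F E U :=
  ∑ β, c.pull (fun y => ξ y (Pi.single β 1)) (hξ.clm_apply contDiffOn_const) * c.e β

variable {ξ : EuclideanSpace ℝ (Fin m₀) → (Fin m₁ → ℝ) →L[ℝ] ℝ}
  (hξ : ContDiffOn ℝ ∞ ξ c.chart.target)

theorem form_apply (q : U) : (c.form ξ hξ).1 q = c.odd q (ξ (c.chart q)) := by
  rw [form, sum_apply, odd_apply]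
  refine Finset.sum_congr rfl fun β _ => ?_
  change algebraMap ℝ _ _ * (c.e β).1 q = _
  rw [← Algebra.smul_def]

theorem form_mem : c.form ξ hξ ∈ homogeneous m₀ F E U 1 := fun q => by
  rw [form_apply]
  exact c.odd_mem q _

/-- The components of a vector field of degree `0` in the direction of the base. -/
def HasSymbol (X : Endo m₀ F E U) (v : EuclideanSpace ℝ (Fin m₀) → EuclideanSpace ℝ (Fin m₀)) :
    Prop :=
  ∀ (q : U) α, (X (c.x α)).1 q = algebraMap ℝ _ (v (c.chart q) α)

/-- The components of a vector field of degree `0` in the direction of the fibres. -/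
def HasConnection (X : Endo m₀ F E U)
    (K : EuclideanSpace ℝ (Fin m₀) → (Fin m₁ → ℝ) →L[ℝ] (Fin m₁ → ℝ)) : Prop :=
  ∀ (q : U) β, (X (c.e β)).1 q = c.odd q ((ContinuousLinearMap.proj β).comp (K (c.chart q)))

/-- The components of a vector field of degree `-1`. -/
def HasOddSymbol (Y : Endo m₀ F E U) (w : EuclideanSpace ℝ (Fin m₀) → Fin m₁ → ℝ) : Prop :=
  ∀ (q : U) β, (Y (c.e β)).1 q = algebraMap ℝ _ (w (c.chart q) β)

theorem exists_hasSymbol {X : Endo m₀ F E U} (hX : X ∈ vectorFieldsOfDegree m₀ F E U 0) :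
    ∃ v, ContDiffOn ℝ ∞ v c.chart.target ∧ c.HasSymbol X v := by
  choose v hv hXv using fun α => c.exists_eq_pull (hX.degree 0 _ (c.x_mem α))
  refine ⟨fun y => WithLp.toLp 2 fun α => v α y, ?_, fun q α => by rw [hXv]; rfl⟩
  rw [contDiffOn_euclidean]
  exact hv

theorem exists_hasOddSymbol {Y : Endo m₀ F E U} (hY : Y ∈ vectorFieldsOfDegree m₀ F E U (-1)) :
    ∃ w, ContDiffOn ℝ ∞ w c.chart.target ∧ c.HasOddSymbol Y w := by
  choose w hw hYw using fun β => c.exists_eq_pull (f := Y (c.e β)) (hY.degree 1 _ (c.e_mem β))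
  refine ⟨fun y β => w β y, contDiffOn_pi.2 hw, fun q β => by rw [hYw]; rfl⟩

theorem exists_hasConnection {X : Endo m₀ F E U} (hX : X ∈ vectorFieldsOfDegree m₀ F E U 0) :
    ∃ K, ContDiffOn ℝ ∞ K c.chart.target ∧ c.HasConnection X K := by
  choose K hK hXK using fun β => c.exists_eq_odd (f := X (c.e β)) (hX.degree 1 _ (c.e_mem β))
  refine ⟨fun y => ContinuousLinearMap.pi fun β => K β y, ?_, fun q β => hXK β q⟩
  exact contDiffOn_clm_apply.2 fun u => contDiffOn_pi.2 fun β => (hK β).clm_apply contDiffOn_const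

variable [T2Space M] [IsManifold (𝓡 m₀) ∞ M] {c}

theorem HasSymbol.apply_pull {X : Endo m₀ F E U}
    {v : EuclideanSpace ℝ (Fin m₀) → EuclideanSpace ℝ (Fin m₀)} (hv : c.HasSymbol X v)
    (hX : X ∈ vectorFieldsOfDegree m₀ F E U 0) (H : EuclideanSpace ℝ (Fin m₀) → ℝ)
    (hH : ContDiffOn ℝ ∞ H c.chart.target) (q : U) :
    (X (c.pull H hH)).1 q = algebraMap ℝ _ (fderiv ℝ H (c.chart q) (v (c.chart q))) := by
  rw [c.apply_pull hX]
  conv_rhs => rw [← (EuclideanSpace.basisFun (Fin m₀) ℝ).sum_repr (v (c.chart q)), map_sum,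
    map_sum]
  refine Finset.sum_congr rfl fun α _ => ?_
  rw [hv q α, Algebra.smul_def, ← map_mul, map_smul, EuclideanSpace.basisFun_apply,
    EuclideanSpace.basisFun_repr, smul_eq_mul, mul_comm]

/-- The coefficients of a form have degree 0 and are killed by Y, so only the frame contributes. -/
theorem HasOddSymbol.apply_form {Y : Endo m₀ F E U} {w : EuclideanSpace ℝ (Fin m₀) → Fin m₁ → ℝ}
    (hw : c.HasOddSymbol Y w) (hY : Y ∈ vectorFieldsOfDegree m₀ F E U (-1)) (q : U) :
    (Y (c.form ξ hξ)).1 q = algebraMap ℝ _ (ξ (c.chart q) (w (c.chart q))) := by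
  rw [form, map_sum, sum_apply]
  conv_rhs => rw [← sum_proj_smul (ξ (c.chart q)), FunLike.coe_sum, Finset.sum_apply,
    map_sum]
  refine Finset.sum_congr rfl fun β _ => ?_
  rw [leibniz_zero hY (c.pull_mem _ _), apply_eq_zero_of_degree_neg hY (c.pull_mem _ _), zero_mul,
    zero_add]
  change algebraMap ℝ _ _ * (Y (c.e β)).1 q = _
  rw [hw, ← map_mul]
  rfl

/-- The action of a vector field of degree `0` on forms, in components. -/
def nabla {R : Type*} [NormedAddCommGroup R] [NormedSpace ℝ R]
    (v : EuclideanSpace ℝ (Fin m₀) → EuclideanSpace ℝ (Fin m₀))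
    (K : EuclideanSpace ℝ (Fin m₀) → (Fin m₁ → ℝ) →L[ℝ] (Fin m₁ → ℝ))
    (ξ : EuclideanSpace ℝ (Fin m₀) → (Fin m₁ → ℝ) →L[ℝ] R) (y : EuclideanSpace ℝ (Fin m₀)) :
    (Fin m₁ → ℝ) →L[ℝ] R :=
  fderiv ℝ ξ y (v y) + (ξ y).comp (K y)

/-- The Leibniz rule on Σ ξ_β e^β: the coefficients contribute dξ(v), the frame contributes ξ ∘ K.
-/
theorem HasConnection.apply_form {X : Endo m₀ F E U}
    {v : EuclideanSpace ℝ (Fin m₀) → EuclideanSpace ℝ (Fin m₀)}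
    {K : EuclideanSpace ℝ (Fin m₀) → (Fin m₁ → ℝ) →L[ℝ] (Fin m₁ → ℝ)}
    (hK : c.HasConnection X K) (hv : c.HasSymbol X v)
    (hX : X ∈ vectorFieldsOfDegree m₀ F E U 0) (q : U) :
    (X (c.form ξ hξ)).1 q = c.odd q (nabla v K ξ (c.chart q)) := by
  have hd : HasFDerivAt ξ (fderiv ℝ ξ (c.chart q)) (c.chart q) :=
    ((hξ.contDiffAt (c.chart.open_target.mem_nhds (c.chart_mem_target q))).differentiableAt
      (by simp)).hasFDerivAt
  have h1 : (ξ (c.chart q)).comp (K (c.chart q)) = ∑ β, ξ (c.chart q) (Pi.single β 1) •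
      (ContinuousLinearMap.proj β : (Fin m₁ → ℝ) →L[ℝ] ℝ).comp (K (c.chart q)) := by
    conv_lhs => rw [← sum_proj_smul (ξ (c.chart q))]
    refine ContinuousLinearMap.ext fun w => ?_
    simp
  rw [nabla, map_add, h1, map_sum, form, map_sum, sum_apply, odd_apply, ← Finset.sum_add_distrib]
  refine Finset.sum_congr rfl fun β _ => ?_
  rw [leibniz_zero hX (c.pull_mem _ _), map_smul, ← hK q β]
  change (X (c.pull _ _)).1 q * (c.e β).1 q + algebraMap ℝ _ _ * (X (c.e β)).1 q = _
  rw [hv.apply_pull hX, ← Algebra.smul_def, ← Algebra.smul_def,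
    (hd.clm_apply (hasFDerivAt_const (Pi.single β (1 : ℝ) : Fin m₁ → ℝ) _)).fderiv]
  simp

theorem nabla_contDiffOn {R : Type*} [NormedAddCommGroup R] [NormedSpace ℝ R]
    {O : Set (EuclideanSpace ℝ (Fin m₀))} (hO : IsOpen O)
    {v : EuclideanSpace ℝ (Fin m₀) → EuclideanSpace ℝ (Fin m₀)}
    {K : EuclideanSpace ℝ (Fin m₀) → (Fin m₁ → ℝ) →L[ℝ] (Fin m₁ → ℝ)}
    {ξ : EuclideanSpace ℝ (Fin m₀) → (Fin m₁ → ℝ) →L[ℝ] R} (hv : ContDiffOn ℝ ∞ v O)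
    (hK : ContDiffOn ℝ ∞ K O) (hξ : ContDiffOn ℝ ∞ ξ O) : ContDiffOn ℝ ∞ (nabla v K ξ) O :=
  ((hξ.fderiv_of_isOpen hO (by simp)).clm_apply hv).add (hξ.clm_comp hK)

end Coordinates

end

end DegreeOne

/-! ### Local frames of a distribution, their restriction and independence -/

namespace DegreeOne

noncomputable section

open Set Filter Topology

variable {m₀ : ℕ} {M : Type*} [TopologicalSpace M]
  [ChartedSpace (EuclideanSpace ℝ (Fin m₀)) M]
  {F : Type*} [NormedAddCommGroup F] [NormedSpace ℝ F] [FiniteDimensional ℝ F]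
  {E : M → Type*} [∀ p, AddCommGroup (E p)] [∀ p, Module ℝ (E p)]
  [∀ p, TopologicalSpace (E p)] [TopologicalSpace (Bundle.TotalSpace F E)]
  [FiberBundle F E] [VectorBundle ℝ F E] {d₀ d₁ : ℕ}

/-- The vector fields `X` and `Y`, of degrees `0` and `-1`, belong to the distribution and span
it pointwise. -/
structure Distribution.IsLocalFrame (D : Distribution m₀ F E d₀ d₁) {U : Opens M}
    (X : Fin d₀ → Endo m₀ F E U) (Y : Fin d₁ → Endo m₀ F E U) : Prop where
  degree_even : ∀ i, X i ∈ vectorFieldsOfDegree m₀ F E U 0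
  degree_odd : ∀ j, Y j ∈ vectorFieldsOfDegree m₀ F E U (-1)
  even_mem : ∀ i, X i ∈ D.sections U
  odd_mem : ∀ j, Y j ∈ D.sections U
  spannedBy : D.SpannedBy X Y

variable {D : Distribution m₀ F E d₀ d₁} {U : Opens M} {X : Fin d₀ → Endo m₀ F E U}
  {Y : Fin d₁ → Endo m₀ F E U}

theorem Distribution.SpannedBy.change (h : D.SpannedBy X Y) {X' : Fin d₀ → Endo m₀ F E U}
    {Y' : Fin d₁ → Endo m₀ F E U}
    (hX : ∀ (q : U) i, ∃ r : Fin d₀ → ℝ, ∀ s, (X i s).1 q = ∑ k, r k • (X' k s).1 q)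
    (hY : ∀ (q : U) j, ∃ r : Fin d₁ → ℝ, ∀ s, (Y j s).1 q = ∑ k, r k • (Y' k s).1 q) :
    D.SpannedBy X' Y' := by
  intro U' hU Z hZ q
  obtain ⟨f, g, hfg⟩ := h U' hU Z hZ q
  choose r hr using hX (Opens.inclusion hU q)
  choose t ht using hY (Opens.inclusion hU q)
  refine ⟨fun k => ∑ i, r i k • f i, fun k => ∑ j, t j k • g j, fun s => ?_⟩
  rw [hfg s]
  congr 1
  · rw [Finset.sum_congr rfl fun i _ => by rw [hr i s, Finset.mul_sum], Finset.sum_comm]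
    refine Finset.sum_congr rfl fun k _ => ?_
    rw [Finset.sum_mul]
    exact Finset.sum_congr rfl fun i _ => by rw [smul_mul_assoc, mul_smul_comm]
  · rw [Finset.sum_congr rfl fun i _ => by rw [ht i s, Finset.mul_sum], Finset.sum_comm]
    refine Finset.sum_congr rfl fun k _ => ?_
    rw [Finset.sum_mul]
    exact Finset.sum_congr rfl fun i _ => by rw [smul_mul_assoc, mul_smul_comm]

theorem smul_mem_of_mem_zero {f : functions m₀ F E U} (hf : f ∈ homogeneous m₀ F E U 0)
    {Z : Endo m₀ F E U} {k : ℤ} (hZ : Z ∈ vectorFieldsOfDegree m₀ F E U k) :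
    f • Z ∈ vectorFieldsOfDegree m₀ F E U k := by
  refine ⟨fun i g hg => ?_, fun i g hg s => ?_⟩
  · have h1 := hZ.degree i g hg
    change f * Z g ∈ _
    generalize Z g = z at h1
    cases h : i + k with
    | ofNat l =>
      rw [h] at h1
      intro p
      have h2 : f.1 p * z.1 p ∈ ⋀[ℝ]^((0 : ℕ) + l) (Module.Dual ℝ (E (p : M))) :=
        mul_mem_exteriorPower (hf p) (h1 p)
      rwa [zero_add] at h2
    | negSucc l =>
      rw [h] at h1
      have h2 : z = 0 := h1
      rw [h2, mul_zero]
      exact Submodule.zero_mem _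
  · change f * Z (g * s) = f * Z g * s + (-1 : ℝ) ^ (i * k) • (g * (f * Z s))
    rw [hZ.leibniz i g hg s, mul_add, mul_smul_comm, ← mul_assoc, ← mul_assoc, ← mul_assoc,
      mul_comm_of_mem_zero hf g]

theorem Distribution.IsLocalFrame.exists_restrict [T2Space M] [IsManifold (𝓡 m₀) ∞ M]
    (hD : D.IsLocalFrame X Y) {U' : Opens M} (h : U' ≤ U) :
    ∃ (X' : Fin d₀ → Endo m₀ F E U') (Y' : Fin d₁ → Endo m₀ F E U'), D.IsLocalFrame X' Y' ∧
      (∀ i, IsRestriction h (X i) (X' i)) ∧ ∀ j, IsRestriction h (Y j) (Y' j) := by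
  choose X' hX' hX using fun i => exists_isRestriction h (hD.degree_even i)
  choose Y' hY' hY using fun i => exists_isRestriction h (hD.degree_odd i)
  have hX'' := fun i => mem_vectorFields_of_degree (hX' i)
  have hY'' := fun i => mem_vectorFields_of_degree (hY' i)
  exact ⟨X', Y', ⟨hX', hY', fun i => D.restriction h _ (hD.even_mem i) _ (hX'' i) (hX i),
    fun i => D.restriction h _ (hD.odd_mem i) _ (hY'' i) (hY i),
    hD.spannedBy.restrict h hX hY hX'' hY''⟩, hX, hY⟩

namespace Coordinates

variable {m₁ : ℕ} (c : Coordinates m₀ F E m₁ U)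

/-- Coordinates on `U'` are a restriction of coordinates on `U`. -/
structure IsRestrictionOf {U' : Opens M} (c' : Coordinates m₀ F E m₁ U') (h : U' ≤ U) : Prop where
  chart_eq : ∀ q, c'.chart q = c.chart q
  target_subset : c'.chart.target ⊆ c.chart.target
  e_eq : ∀ β, c'.e β = restrict h (c.e β)

theorem exists_restrict [IsManifold (𝓡 m₀) ∞ M] {N : Set (EuclideanSpace ℝ (Fin m₀))}
    (hN : IsOpen N) : ∃ (U' : Opens M) (h : U' ≤ U) (c' : Coordinates m₀ F E m₁ U'),
      c.IsRestrictionOf c' h ∧ (∀ q ∈ U, c.chart q ∈ N → q ∈ U') ∧ c'.chart.target ⊆ N := by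
  let U' : Opens M := ⟨c.chart.source ∩ c.chart ⁻¹' N, c.chart.isOpen_inter_preimage hN⟩
  have h : U' ≤ U := fun q hq => by
    have := hq.1
    rwa [c.chart_source] at this
  obtain ⟨c', h1, h2, h3⟩ := c.exists_change h (OpenPartialHomeomorph.refl _) contDiffOn_id
    contDiffOn_id (fun q _ => mem_univ _) (fun β => restrict h (c.e β))
    (fun β => restrict_mem_homogeneous h (c.e_mem β))
    (fun q β => Submodule.subset_span ⟨β, rfl⟩)
  refine ⟨U', h, c', ⟨h1, ?_, fun β => congrFun h3 β⟩, fun q hq hqN => ⟨?_, hqN⟩, ?_⟩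
  · rw [h2]
    exact fun y hy => hy.2.2
  · rw [c.chart_source]
    exact hq
  · rw [h2]
    intro y hy
    have h4 : c.chart (c.chart.symm y) ∈ N := hy.2.1.2
    have h5 : y ∈ c.chart.target := hy.2.2
    rwa [c.chart.right_inv h5] at h4

variable {c} {U' : Opens M} {c' : Coordinates m₀ F E m₁ U'} {h : U' ≤ U}

theorem IsRestrictionOf.x_eq (hc : c.IsRestrictionOf c' h) (α : Fin m₀) :
    c'.x α = restrict h (c.x α) :=
  Subtype.ext (funext fun q => congrArg (fun y : EuclideanSpace ℝ (Fin m₀) =>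
    algebraMap ℝ (Fibre E (q : M)) (y α)) (hc.chart_eq q))

theorem IsRestrictionOf.odd_eq (hc : c.IsRestrictionOf c' h) (q : U') :
    c'.odd q = c.odd (Opens.inclusion h q) := by
  refine LinearMap.ext fun ξ => ?_
  rw [odd_apply, odd_apply]
  exact Finset.sum_congr rfl fun β _ => by rw [hc.e_eq]; rfl

/-- Components are functions on the Euclidean space, so they stay literally the same under
restriction of the coordinates. -/
theorem HasSymbol.restrict {X : Endo m₀ F E U} {X' : Endo m₀ F E U'}
    {v : EuclideanSpace ℝ (Fin m₀) → EuclideanSpace ℝ (Fin m₀)} (hv : c.HasSymbol X v)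
    (hc : c.IsRestrictionOf c' h) (hX : IsRestriction h X X') : c'.HasSymbol X' v :=
  fun q α => by
    rw [hc.x_eq, hX, hc.chart_eq]
    exact hv (Opens.inclusion h q) α

theorem HasConnection.restrict {X : Endo m₀ F E U} {X' : Endo m₀ F E U'}
    {K : EuclideanSpace ℝ (Fin m₀) → (Fin m₁ → ℝ) →L[ℝ] (Fin m₁ → ℝ)}
    (hK : c.HasConnection X K)
    (hc : c.IsRestrictionOf c' h) (hX : IsRestriction h X X') : c'.HasConnection X' K :=
  fun q β => by
    rw [hc.e_eq, hX, hc.chart_eq, hc.odd_eq]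
    exact hK (Opens.inclusion h q) β

theorem HasOddSymbol.restrict {Y : Endo m₀ F E U} {Y' : Endo m₀ F E U'}
    {w : EuclideanSpace ℝ (Fin m₀) → Fin m₁ → ℝ} (hw : c.HasOddSymbol Y w)
    (hc : c.IsRestrictionOf c' h) (hY : IsRestriction h Y Y') : c'.HasOddSymbol Y' w :=
  fun q β => by
    rw [hc.e_eq, hY, hc.chart_eq]
    exact hw (Opens.inclusion h q) β

variable [T2Space M] [IsManifold (𝓡 m₀) ∞ M] {p : U}

theorem algebraMap_injective_fibre (q : U) :
    Function.Injective (algebraMap ℝ (Fibre E (q : M))) :=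
  (ExteriorAlgebra.algebraMap_leftInverse (R := ℝ) (Module.Dual ℝ (E (q : M)))).injective

/-- In the expansion by coordinate fields, the coefficients of ∂/∂e^β have degree 1 and disappear in
the degree 0 component; those of ∂/∂x^α vanish at p by assumption. -/
theorem tangentVector_eq_zero_of_even {Z : Endo m₀ F E U}
    (hZ : Z ∈ vectorFieldsOfDegree m₀ F E U 0) (h : ∀ α, (Z (c.x α)).1 p = 0) :
    tangentVector Z p = 0 := by
  refine LinearMap.ext fun f => ?_
  have h1 := DFunLike.congr_fun (eq_sum_partials c.isPartialX_partialX c.isPartialE_partialE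
    (mem_vectorFields_of_degree hZ)) f
  rw [LinearMap.add_apply, LinearMap.sum_apply, LinearMap.sum_apply] at h1
  have h2 : (Z f).1 p = ∑ α, (Z (c.x α)).1 p * (c.partialX α f).1 p +
      ∑ β, (Z (c.e β)).1 p * (c.partialE β f).1 p := by
    rw [h1]
    change (∑ α, (Z (c.x α) • c.partialX α) f).1 p + (∑ β, (Z (c.e β) • c.partialE β) f).1 p = _
    rw [sum_apply, sum_apply]
    rfl
  change ExteriorAlgebra.algebraMapInv ((Z f).1 p) = 0
  rw [h2, map_add, map_sum, map_sum]
  rw [Finset.sum_eq_zero fun α _ => by rw [h, zero_mul, map_zero],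
    Finset.sum_eq_zero fun β _ => ?_, add_zero]
  have h3 : (Z (c.e β)).1 p ∈ ⋀[ℝ]^1 (Module.Dual ℝ (E (p : M))) :=
    hZ.degree 1 _ (c.e_mem β) p
  rw [map_mul, algebraMapInv_of_mem_succ h3, zero_mul]

/-- Here the coefficients of ∂/∂x^α vanish identically, their degree being -1. -/
theorem tangentVector_eq_zero_of_odd {Z : Endo m₀ F E U}
    (hZ : Z ∈ vectorFieldsOfDegree m₀ F E U (-1)) (h : ∀ β, (Z (c.e β)).1 p = 0) :
    tangentVector Z p = 0 := by
  refine LinearMap.ext fun f => ?_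
  have h1 := DFunLike.congr_fun (eq_sum_partials c.isPartialX_partialX c.isPartialE_partialE
    (mem_vectorFields_of_degree hZ)) f
  rw [LinearMap.add_apply, LinearMap.sum_apply, LinearMap.sum_apply] at h1
  have h2 : (Z f).1 p = ∑ α, (Z (c.x α)).1 p * (c.partialX α f).1 p +
      ∑ β, (Z (c.e β)).1 p * (c.partialE β f).1 p := by
    rw [h1]
    change (∑ α, (Z (c.x α) • c.partialX α) f).1 p + (∑ β, (Z (c.e β) • c.partialE β) f).1 p = _
    rw [sum_apply, sum_apply]
    rfl
  change ExteriorAlgebra.algebraMapInv ((Z f).1 p) = 0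
  rw [h2, map_add, map_sum, map_sum]
  rw [Finset.sum_eq_zero fun α _ => ?_,
    Finset.sum_eq_zero fun β _ => by rw [h, zero_mul, map_zero], add_zero]
  rw [apply_eq_zero_of_degree_neg hZ (c.x_mem α)]
  exact (congrArg _ (zero_mul _)).trans (map_zero _)

theorem tangentVector_sum_smul {n : ℕ} (Z : Fin n → Endo m₀ F E U) (r : Fin n → ℝ) :
    tangentVector (∑ i, r i • Z i) p = ∑ i, r i • tangentVector (Z i) p := by
  refine LinearMap.ext fun f => ?_
  rw [LinearMap.sum_apply]
  change ExteriorAlgebra.algebraMapInv (((∑ i, r i • Z i) f).1 p) = _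
  rw [LinearMap.sum_apply, sum_apply, map_sum]
  exact Finset.sum_congr rfl fun i _ => map_smul ExteriorAlgebra.algebraMapInv (r i) _

/-- A linear relation between the symbols at p gives a constant combination of the fields whose
x-components vanish at p, hence a relation between tangent vectors. -/
theorem linearIndependent_symbol {n : ℕ} {Z : Fin n → Endo m₀ F E U}
    {v : Fin n → EuclideanSpace ℝ (Fin m₀) → EuclideanSpace ℝ (Fin m₀)}
    (hZ : ∀ i, Z i ∈ vectorFieldsOfDegree m₀ F E U 0) (hv : ∀ i, c.HasSymbol (Z i) (v i))
    (hli : LinearIndependent ℝ fun i => tangentVector (Z i) p) :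
    LinearIndependent ℝ fun i => v i (c.chart p) := by
  rw [Fintype.linearIndependent_iff] at hli ⊢
  intro r hr
  refine hli r ?_
  rw [← tangentVector_sum_smul]
  refine tangentVector_eq_zero_of_even (c := c)
    (Submodule.sum_mem _ fun i _ => Submodule.smul_mem _ _ (hZ i)) fun α => ?_
  rw [LinearMap.sum_apply, sum_apply]
  have h1 : ∀ i, ((r i • Z i) (c.x α)).1 p =
      algebraMap ℝ (Fibre E (p : M)) (r i * v i (c.chart p) α) := fun i => by
    rw [map_mul, ← hv i p α, ← Algebra.smul_def]
    rfl
  rw [Finset.sum_congr rfl fun i _ => h1 i, ← map_sum]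
  have h2 := congrArg (fun y : EuclideanSpace ℝ (Fin m₀) => y α) hr
  simp only [WithLp.ofLp_sum, Finset.sum_apply, PiLp.smul_apply, smul_eq_mul] at h2
  rw [h2]
  exact map_zero _

theorem linearIndependent_oddSymbol {n : ℕ} {Z : Fin n → Endo m₀ F E U}
    {w : Fin n → EuclideanSpace ℝ (Fin m₀) → Fin m₁ → ℝ}
    (hZ : ∀ i, Z i ∈ vectorFieldsOfDegree m₀ F E U (-1)) (hw : ∀ i, c.HasOddSymbol (Z i) (w i))
    (hli : LinearIndependent ℝ fun i => tangentVector (Z i) p) :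
    LinearIndependent ℝ fun i => w i (c.chart p) := by
  rw [Fintype.linearIndependent_iff] at hli ⊢
  intro r hr
  refine hli r ?_
  rw [← tangentVector_sum_smul]
  refine tangentVector_eq_zero_of_odd (c := c)
    (Submodule.sum_mem _ fun i _ => Submodule.smul_mem _ _ (hZ i)) fun β => ?_
  rw [LinearMap.sum_apply, sum_apply]
  have h1 : ∀ i, ((r i • Z i) (c.e β)).1 p =
      algebraMap ℝ (Fibre E (p : M)) (r i * w i (c.chart p) β) := fun i => by
    rw [map_mul, ← hw i p β, ← Algebra.smul_def]
    rfl
  rw [Finset.sum_congr rfl fun i _ => h1 i, ← map_sum]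
  have h2 := congrFun hr β
  simp only [Finset.sum_apply, Pi.smul_apply, smul_eq_mul] at h2
  rw [h2]
  exact map_zero _

end Coordinates

end

end DegreeOne

/-! ### Adapted frames and the meaning of involutivity in components -/

namespace DegreeOne

noncomputable section

open Set Filter Topology

variable {m₀ : ℕ} {M : Type*} [TopologicalSpace M]
  [ChartedSpace (EuclideanSpace ℝ (Fin m₀)) M]
  {F : Type*} [NormedAddCommGroup F] [NormedSpace ℝ F] [FiniteDimensional ℝ F]
  {E : M → Type*} [∀ p, AddCommGroup (E p)] [∀ p, Module ℝ (E p)]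
  [∀ p, TopologicalSpace (E p)] [TopologicalSpace (Bundle.TotalSpace F E)]
  [FiberBundle F E] [VectorBundle ℝ F E] {d₀ d₁ m₁ : ℕ}

variable {D : Distribution m₀ F E d₀ d₁} {U : Opens M} {X : Fin d₀ → Endo m₀ F E U}
  {Y : Fin d₁ → Endo m₀ F E U} {c : Coordinates m₀ F E m₁ U}

theorem contDiffOn_matrix_inv {n : ℕ} {A : EuclideanSpace ℝ (Fin m₀) → Matrix (Fin n) (Fin n) ℝ}
    {O : Set (EuclideanSpace ℝ (Fin m₀))} (hO : IsOpen O)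
    (hA : ∀ i j, ContDiffOn ℝ ∞ (fun y => A y i j) O) (hdet : ∀ y ∈ O, (A y).det ≠ 0)
    (i j : Fin n) : ContDiffOn ℝ ∞ (fun y => (A y)⁻¹ i j) O := fun y hy =>
  (contMDiffAt_iff_contDiffAt.1 (contMDiffAt_matrix_inv (fun k l => contMDiffAt_iff_contDiffAt.2
    ((hA k l).contDiffAt (hO.mem_nhds hy))) (hdet y hy) i j)).contDiffWithinAt

namespace Coordinates

/-- A family of vector fields is changed by an invertible matrix of functions. -/
theorem exists_change_frame {n : ℕ} {k : ℤ} {S : Submodule (functions m₀ F E U) (Endo m₀ F E U)}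
    {Z : Fin n → Endo m₀ F E U} (hZ : ∀ i, Z i ∈ vectorFieldsOfDegree m₀ F E U k)
    (hS : ∀ i, Z i ∈ S) {A : EuclideanSpace ℝ (Fin m₀) → Matrix (Fin n) (Fin n) ℝ}
    (hA : ∀ i j, ContDiffOn ℝ ∞ (fun y => A y i j) c.chart.target)
    (hdet : ∀ y ∈ c.chart.target, (A y).det ≠ 0) :
    ∃ Z' : Fin n → Endo m₀ F E U, (∀ i, Z' i ∈ vectorFieldsOfDegree m₀ F E U k) ∧
      (∀ i, Z' i ∈ S) ∧
      (∀ (q : U) i s, (Z' i s).1 q = ∑ j, (A (c.chart q))⁻¹ i j • (Z j s).1 q) ∧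
      ∀ (q : U) i s, (Z i s).1 q = ∑ j, A (c.chart q) i j • (Z' j s).1 q := by
  have hA' := contDiffOn_matrix_inv c.chart.open_target hA hdet
  have h1 : ∀ (q : U) i s, ((∑ j, c.pull _ (hA' i j) • Z j) s).1 q =
      ∑ j, (A (c.chart q))⁻¹ i j • (Z j s).1 q := fun q i s => by
    rw [LinearMap.sum_apply, sum_apply]
    exact Finset.sum_congr rfl fun j _ => (Algebra.smul_def ((A (c.chart q))⁻¹ i j) _).symm
  refine ⟨fun i => ∑ j, c.pull _ (hA' i j) • Z j,
    fun i => Submodule.sum_mem _ fun j _ => smul_mem_of_mem_zero (c.pull_mem _ _) (hZ j),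
    fun i => Submodule.sum_mem _ fun j _ => Submodule.smul_mem _ _ (hS j), h1, fun q i s => ?_⟩
  rw [Finset.sum_congr rfl fun j _ => by rw [h1 q j s, Finset.smul_sum], Finset.sum_comm]
  simp only [smul_smul, ← Finset.sum_smul]
  have h2 : A (c.chart q) * (A (c.chart q))⁻¹ = 1 :=
    Matrix.mul_nonsing_inv _ (isUnit_iff_ne_zero.2 (hdet _ (c.chart_mem_target q)))
  rw [Finset.sum_eq_single i]
  · rw [← Matrix.mul_apply, h2, Matrix.one_apply_eq, one_smul]
  · intro j _ hj
    rw [← Matrix.mul_apply, h2, Matrix.one_apply_ne (Ne.symm hj), zero_smul]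
  · simp

/-- The vector fields `X` and `Y` are dual to given linear functions of the coordinates. -/
structure IsAdapted (c : Coordinates m₀ F E m₁ U) (D : Distribution m₀ F E d₀ d₁)
    (X : Fin d₀ → Endo m₀ F E U) (Y : Fin d₁ → Endo m₀ F E U)
    (ℓ : Fin d₀ → EuclideanSpace ℝ (Fin m₀) →L[ℝ] ℝ) (μ : Fin d₁ → (Fin m₁ → ℝ) →L[ℝ] ℝ)
    (v : Fin d₀ → EuclideanSpace ℝ (Fin m₀) → EuclideanSpace ℝ (Fin m₀))
    (K : Fin d₀ → EuclideanSpace ℝ (Fin m₀) → (Fin m₁ → ℝ) →L[ℝ] (Fin m₁ → ℝ))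
    (w : Fin d₁ → EuclideanSpace ℝ (Fin m₀) → Fin m₁ → ℝ) : Prop where
  isLocalFrame : D.IsLocalFrame X Y
  symbol : ∀ i, c.HasSymbol (X i) (v i)
  connection : ∀ i, c.HasConnection (X i) (K i)
  oddSymbol : ∀ j, c.HasOddSymbol (Y j) (w j)
  contDiffOn_symbol : ∀ i, ContDiffOn ℝ ∞ (v i) c.chart.target
  contDiffOn_connection : ∀ i, ContDiffOn ℝ ∞ (K i) c.chart.target
  contDiffOn_oddSymbol : ∀ j, ContDiffOn ℝ ∞ (w j) c.chart.target
  dual_even : ∀ y ∈ c.chart.target, ∀ i j, ℓ j (v i y) = if i = j then 1 else 0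
  dual_odd : ∀ y ∈ c.chart.target, ∀ i j, μ j (w i y) = if i = j then 1 else 0

theorem sum_inv_smul_dual {n : ℕ} {V : Type*} [NormedAddCommGroup V] [NormedSpace ℝ V]
    (ℓ : Fin n → V →L[ℝ] ℝ) (v : Fin n → V)
    (hdet : (Matrix.of fun i j => ℓ j (v i)).det ≠ 0) (i j : Fin n) :
    ℓ j (∑ k, (Matrix.of fun i j => ℓ j (v i))⁻¹ i k • v k) = if i = j then 1 else 0 := by
  have h2 : (Matrix.of fun i j => ℓ j (v i))⁻¹ * (Matrix.of fun i j => ℓ j (v i)) = 1 :=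
    Matrix.nonsing_inv_mul _ (isUnit_iff_ne_zero.2 hdet)
  have h3 := congrFun (congrFun h2 i) j
  rw [Matrix.one_apply, Matrix.mul_apply] at h3
  rw [map_sum, ← h3]
  exact Finset.sum_congr rfl fun k _ => by rw [map_smul]; rfl

/-- Vector fields adapted to the coordinates. -/
theorem exists_isAdapted (hD : D.IsLocalFrame X Y)
    {ℓ : Fin d₀ → EuclideanSpace ℝ (Fin m₀) →L[ℝ] ℝ} {μ : Fin d₁ → (Fin m₁ → ℝ) →L[ℝ] ℝ}
    {v : Fin d₀ → EuclideanSpace ℝ (Fin m₀) → EuclideanSpace ℝ (Fin m₀)}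
    {w : Fin d₁ → EuclideanSpace ℝ (Fin m₀) → Fin m₁ → ℝ}
    (hv : ∀ i, c.HasSymbol (X i) (v i)) (hw : ∀ j, c.HasOddSymbol (Y j) (w j))
    (hv' : ∀ i, ContDiffOn ℝ ∞ (v i) c.chart.target)
    (hw' : ∀ j, ContDiffOn ℝ ∞ (w j) c.chart.target)
    (hvℓ : ∀ y ∈ c.chart.target, (Matrix.of fun i j => ℓ j (v i y)).det ≠ 0)
    (hwμ : ∀ y ∈ c.chart.target, (Matrix.of fun i j => μ j (w i y)).det ≠ 0) :
    ∃ X' Y' v' K' w', c.IsAdapted D X' Y' ℓ μ v' K' w' := by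
  have hA : ∀ i j, ContDiffOn ℝ ∞ (fun y => (Matrix.of fun i j => ℓ j (v i y)) i j)
      c.chart.target := fun i j => (ℓ j).contDiff.comp_contDiffOn (hv' i)
  have hB : ∀ i j, ContDiffOn ℝ ∞ (fun y => (Matrix.of fun i j => μ j (w i y)) i j)
      c.chart.target := fun i j => (μ j).contDiff.comp_contDiffOn (hw' i)
  obtain ⟨X', hX1, hX2, hX3, hX4⟩ := c.exists_change_frame hD.degree_even hD.even_mem hA hvℓ
  obtain ⟨Y', hY1, hY2, hY3, hY4⟩ := c.exists_change_frame hD.degree_odd hD.odd_mem hB hwμ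
  choose K hK hK' using fun i => c.exists_hasConnection (hX1 i)
  have hA' := contDiffOn_matrix_inv c.chart.open_target hA hvℓ
  have hB' := contDiffOn_matrix_inv c.chart.open_target hB hwμ
  refine ⟨X', Y', fun i y => ∑ k, (Matrix.of fun i j => ℓ j (v i y))⁻¹ i k • v k y, K,
    fun i y => ∑ k, (Matrix.of fun i j => μ j (w i y))⁻¹ i k • w k y,
    ⟨hX1, hY1, hX2, hY2, hD.spannedBy.change (fun q i => ⟨_, hX4 q i⟩) fun q i => ⟨_, hY4 q i⟩⟩,
    fun i q α => ?_, hK', fun j q β => ?_,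
    fun i => ContDiffOn.sum fun k _ => (hA' i k).smul (hv' k), hK,
    fun i => ContDiffOn.sum fun k _ => (hB' i k).smul (hw' k),
    fun y hy i j => sum_inv_smul_dual ℓ (fun i => v i y) (hvℓ y hy) i j,
    fun y hy i j => sum_inv_smul_dual μ (fun i => w i y) (hwμ y hy) i j⟩
  · rw [hX3]
    simp only [WithLp.ofLp_sum, Finset.sum_apply, PiLp.smul_apply, smul_eq_mul, map_sum]
    exact Finset.sum_congr rfl fun k _ => by rw [hv k q α, map_mul, Algebra.smul_def]
  · rw [hY3]
    simp only [Finset.sum_apply, Pi.smul_apply, smul_eq_mul, map_sum]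
    exact Finset.sum_congr rfl fun k _ => by rw [hw k q β, map_mul, Algebra.smul_def]

variable {ℓ : Fin d₀ → EuclideanSpace ℝ (Fin m₀) →L[ℝ] ℝ} {μ : Fin d₁ → (Fin m₁ → ℝ) →L[ℝ] ℝ}
  {v : Fin d₀ → EuclideanSpace ℝ (Fin m₀) → EuclideanSpace ℝ (Fin m₀)}
  {K : Fin d₀ → EuclideanSpace ℝ (Fin m₀) → (Fin m₁ → ℝ) →L[ℝ] (Fin m₁ → ℝ)}
  {w : Fin d₁ → EuclideanSpace ℝ (Fin m₀) → Fin m₁ → ℝ}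

theorem IsAdapted.restrict [T2Space M] [IsManifold (𝓡 m₀) ∞ M]
    (hc : c.IsAdapted D X Y ℓ μ v K w) {U' : Opens M} {h : U' ≤ U}
    {c' : Coordinates m₀ F E m₁ U'} (hc' : c.IsRestrictionOf c' h) :
    ∃ X' Y', c'.IsAdapted D X' Y' ℓ μ v K w := by
  obtain ⟨X', Y', hD, hX, hY⟩ := hc.isLocalFrame.exists_restrict h
  exact ⟨X', Y', hD, fun i => (hc.symbol i).restrict hc' (hX i),
    fun i => (hc.connection i).restrict hc' (hX i),
    fun i => (hc.oddSymbol i).restrict hc' (hY i),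
    fun i => (hc.contDiffOn_symbol i).mono hc'.target_subset,
    fun i => (hc.contDiffOn_connection i).mono hc'.target_subset,
    fun i => (hc.contDiffOn_oddSymbol i).mono hc'.target_subset,
    fun y hy => hc.dual_even y (hc'.target_subset hy),
    fun y hy => hc.dual_odd y (hc'.target_subset hy)⟩

variable [T2Space M] [IsManifold (𝓡 m₀) ∞ M]

/-- The linear function `ℓ` of the coordinates. -/
def linear (c : Coordinates m₀ F E m₁ U) (ℓ : EuclideanSpace ℝ (Fin m₀) →L[ℝ] ℝ) :
    functions m₀ F E U := c.pull ℓ ℓ.contDiff.contDiffOn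

theorem IsAdapted.apply_linear (hc : c.IsAdapted D X Y ℓ μ v K w) (i j : Fin d₀) :
    X i (c.linear (ℓ j)) = algebraMap ℝ _ (if i = j then 1 else 0) := by
  refine Subtype.ext (funext fun q => ?_)
  rw [linear, (hc.symbol i).apply_pull (hc.isLocalFrame.degree_even i), ContinuousLinearMap.fderiv,
    hc.dual_even _ (c.chart_mem_target q)]
  rfl

theorem IsAdapted.odd_apply_linear (hc : c.IsAdapted D X Y ℓ μ v K w) (i : Fin d₁) (j : Fin d₀) :
    Y i (c.linear (ℓ j)) = 0 :=
  apply_eq_zero_of_degree_neg (hc.isLocalFrame.degree_odd i) (c.pull_mem _ _)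

/-- A section of the distribution that kills the linear functions is a combination of the vector
fields of degree `-1`. -/
theorem IsAdapted.exists_coefficients (hc : c.IsAdapted D X Y ℓ μ v K w) {Z : Endo m₀ F E U}
    (hZ : Z ∈ D.sections U) (hZℓ : ∀ i, Z (c.linear (ℓ i)) = 0) (q : U) :
    ∃ g : Fin d₁ → Fibre E (q : M), ∀ s, (Z s).1 q = ∑ j, g j * (Y j s).1 q := by
  obtain ⟨f, g, hfg⟩ := hc.isLocalFrame.spannedBy U le_rfl Z hZ q
  have hfg' : ∀ s, (Z s).1 q = ∑ i, f i * (X i s).1 q + ∑ j, g j * (Y j s).1 q := hfg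
  -- By duality, evaluating Z on the linear function ℓ_i isolates the coefficient of X_i.
  have hf : ∀ i, f i = 0 := fun i => by
    have h1 := hfg' (c.linear (ℓ i))
    rw [hZℓ] at h1
    have h2 : ∑ j, g j * (Y j (c.linear (ℓ i))).1 q = 0 :=
      Finset.sum_eq_zero fun j _ => by
        rw [hc.odd_apply_linear]
        exact mul_zero _
    have h3 : ∀ j, (X j (c.linear (ℓ i))).1 q = if j = i then 1 else 0 := fun j => by
      rw [hc.apply_linear]
      change algebraMap ℝ (Fibre E (q : M)) _ = _
      split_ifs
      · exact map_one _
      · exact map_zero _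
    rw [h2, add_zero, Finset.sum_congr rfl fun j _ => by rw [h3]] at h1
    simp only [mul_ite, mul_one, mul_zero, Finset.sum_ite_eq', Finset.mem_univ, if_true] at h1
    exact h1.symm
  refine ⟨g, fun s => ?_⟩
  rw [hfg', Finset.sum_eq_zero fun i _ => by rw [hf, zero_mul], zero_add]

theorem bracket_apply {k l : ℤ} (h : k * l = 0) (Z Z' : Endo m₀ F E U) (s : functions m₀ F E U) :
    bracket k l Z Z' s = Z (Z' s) - Z' (Z s) := by
  rw [bracket, h, zpow_zero, one_smul]
  rfl

/-- X_i ℓ_k is a constant, so the bracket kills every ℓ_k; lying in the distribution, it involves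
only the Y. -/
theorem IsAdapted.exists_coefficients_even (hc : c.IsAdapted D X Y ℓ μ v K w)
    (hD : D.IsInvolutive) (i j : Fin d₀) (q : U) : ∃ g : Fin d₁ → Fibre E (q : M), ∀ s,
      (X i (X j s)).1 q - (X j (X i s)).1 q = ∑ j, g j * (Y j s).1 q := by
  have hf := hc.isLocalFrame
  obtain ⟨g, hg⟩ := hc.exists_coefficients (hD U 0 0 (X i) (X j) (hf.degree_even i)
    (hf.degree_even j) (hf.even_mem i) (hf.even_mem j)) (fun k => by
      rw [bracket_apply (mul_zero _), hc.apply_linear, hc.apply_linear,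
        apply_algebraMap (hf.degree_even i), apply_algebraMap (hf.degree_even j), sub_zero]) q
  refine ⟨g, fun s => ?_⟩
  rw [← hg, bracket_apply (mul_zero _)]
  rfl

/-- As before, since Y_i ℓ_k = 0 and Y_i annihilates the constants X_j ℓ_k. -/
theorem IsAdapted.exists_coefficients_odd (hc : c.IsAdapted D X Y ℓ μ v K w)
    (hD : D.IsInvolutive) (i : Fin d₁) (j : Fin d₀) (q : U) : ∃ g : Fin d₁ → Fibre E (q : M), ∀ s,
      (Y i (X j s)).1 q - (X j (Y i s)).1 q = ∑ j, g j * (Y j s).1 q := by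
  have hf := hc.isLocalFrame
  obtain ⟨g, hg⟩ := hc.exists_coefficients (hD U (-1) 0 (Y i) (X j) (hf.degree_odd i)
    (hf.degree_even j) (hf.odd_mem i) (hf.even_mem j)) (fun k => by
      rw [bracket_apply (mul_zero _), hc.apply_linear, hc.odd_apply_linear,
        apply_algebraMap (hf.degree_odd i), map_zero, sub_zero]) q
  refine ⟨g, fun s => ?_⟩
  rw [← hg, bracket_apply (mul_zero _)]
  rfl

theorem exists_chart_eq (c : Coordinates m₀ F E m₁ U) {y : EuclideanSpace ℝ (Fin m₀)}
    (hy : y ∈ c.chart.target) : ∃ q : U, c.chart q = y :=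
  ⟨⟨_, c.symm_mem hy⟩, c.chart.right_inv hy⟩

theorem HasSymbol.apply_x {Z : Endo m₀ F E U}
    {u : EuclideanSpace ℝ (Fin m₀) → EuclideanSpace ℝ (Fin m₀)} (hu : c.HasSymbol Z u)
    (hu' : ContDiffOn ℝ ∞ u c.chart.target) (α : Fin m₀) :
    Z (c.x α) = c.pull (fun y => EuclideanSpace.proj (𝕜 := ℝ) α (u y))
      ((EuclideanSpace.proj (𝕜 := ℝ) α).contDiff.comp_contDiffOn hu') :=
  Subtype.ext (funext fun q => hu q α)

/-- The symbols of the vector fields of degree `0` commute. -/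
theorem IsAdapted.fderiv_symbol_comm (hc : c.IsAdapted D X Y ℓ μ v K w) (hD : D.IsInvolutive)
    (i j : Fin d₀) {y : EuclideanSpace ℝ (Fin m₀)} (hy : y ∈ c.chart.target) :
    fderiv ℝ (v j) y (v i y) = fderiv ℝ (v i) y (v j y) := by
  obtain ⟨q, rfl⟩ := c.exists_chart_eq hy
  obtain ⟨g, hg⟩ := hc.exists_coefficients_even hD i j q
  have hf := hc.isLocalFrame
  have hd : ∀ k, DifferentiableAt ℝ (v k) (c.chart q) := fun k =>
    ((hc.contDiffOn_symbol k).contDiffAt (c.chart.open_target.mem_nhds hy)).differentiableAt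
      (by simp)
  ext α
  have h1 := hg (c.x α)
  -- The Y kill functions of degree 0, so the commutator of the X vanishes on the base coordinates.
  have h2 : ∑ j, g j * (Y j (c.x α)).1 q = 0 := Finset.sum_eq_zero fun j _ => by
    rw [apply_eq_zero_of_degree_neg (hf.degree_odd j) (c.x_mem α)]
    exact mul_zero _
  rw [h2, sub_eq_zero, (hc.symbol j).apply_x (hc.contDiffOn_symbol j),
    (hc.symbol i).apply_x (hc.contDiffOn_symbol i), (hc.symbol i).apply_pull (hf.degree_even i),
    (hc.symbol j).apply_pull (hf.degree_even j)] at h1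
  have h3 := algebraMap_injective_fibre q h1
  have h4 : ∀ k, fderiv ℝ (fun y => EuclideanSpace.proj (𝕜 := ℝ) α (v k y)) (c.chart q) =
      (EuclideanSpace.proj α).comp (fderiv ℝ (v k) (c.chart q)) := fun k =>
    ((EuclideanSpace.proj (𝕜 := ℝ) α).hasFDerivAt.comp _ (hd k).hasFDerivAt).fderiv
  rw [h4, h4] at h3
  exact h3

variable {ζ : EuclideanSpace ℝ (Fin m₀) → (Fin m₁ → ℝ) →L[ℝ] ℝ}

theorem IsAdapted.odd_apply_form_eq_zero (hc : c.IsAdapted D X Y ℓ μ v K w)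
    (hζ : ContDiffOn ℝ ∞ ζ c.chart.target) (h : ∀ y ∈ c.chart.target, ∀ j, ζ y (w j y) = 0)
    (j : Fin d₁) : Y j (c.form ζ hζ) = 0 :=
  Subtype.ext (funext fun q => by
    rw [(hc.oddSymbol j).apply_form hζ (hc.isLocalFrame.degree_odd j),
      h _ (c.chart_mem_target q) j]
    exact map_zero _)

theorem IsAdapted.contDiffOn_nabla (hc : c.IsAdapted D X Y ℓ μ v K w)
    (hζ : ContDiffOn ℝ ∞ ζ c.chart.target) (i : Fin d₀) :
    ContDiffOn ℝ ∞ (nabla (v i) (K i) ζ) c.chart.target :=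
  nabla_contDiffOn c.chart.open_target (hc.contDiffOn_symbol i) (hc.contDiffOn_connection i) hζ

theorem IsAdapted.apply_form (hc : c.IsAdapted D X Y ℓ μ v K w)
    (hζ : ContDiffOn ℝ ∞ ζ c.chart.target) (i : Fin d₀) :
    X i (c.form ζ hζ) = c.form (nabla (v i) (K i) ζ) (hc.contDiffOn_nabla hζ i) :=
  Subtype.ext (funext fun q => by
    rw [(hc.connection i).apply_form hζ (hc.symbol i) (hc.isLocalFrame.degree_even i), form_apply])

/-- The forms that vanish on the distribution are preserved. -/
theorem IsAdapted.nabla_apply_oddSymbol (hc : c.IsAdapted D X Y ℓ μ v K w) (hD : D.IsInvolutive)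
    (hζ : ContDiffOn ℝ ∞ ζ c.chart.target) (h : ∀ y ∈ c.chart.target, ∀ j, ζ y (w j y) = 0)
    (i : Fin d₀) (j : Fin d₁) {y : EuclideanSpace ℝ (Fin m₀)} (hy : y ∈ c.chart.target) :
    nabla (v i) (K i) ζ y (w j y) = 0 := by
  obtain ⟨q, rfl⟩ := c.exists_chart_eq hy
  obtain ⟨g, hg⟩ := hc.exists_coefficients_odd hD j i q
  have h1 := hg (c.form ζ hζ)
  have h2 : ∑ j, g j * (Y j (c.form ζ hζ)).1 q = 0 := Finset.sum_eq_zero fun j _ => by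
    rw [hc.odd_apply_form_eq_zero hζ h]
    exact mul_zero _
  -- All Y kill the form, and so does [Y_j, X_i]; there remains Y_j(X_i ζ) = 0.
  rw [h2, hc.odd_apply_form_eq_zero hζ h, map_zero, hc.apply_form,
    (hc.oddSymbol j).apply_form _ (hc.isLocalFrame.degree_odd j)] at h1
  refine algebraMap_injective_fibre (E := E) q ?_
  rw [map_zero]
  exact (sub_zero _).symm.trans h1

/-- The action on the forms that vanish on the distribution is flat. -/
theorem IsAdapted.nabla_comm (hc : c.IsAdapted D X Y ℓ μ v K w) (hD : D.IsInvolutive)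
    (hζ : ContDiffOn ℝ ∞ ζ c.chart.target) (h : ∀ y ∈ c.chart.target, ∀ j, ζ y (w j y) = 0)
    (i j : Fin d₀) {y : EuclideanSpace ℝ (Fin m₀)} (hy : y ∈ c.chart.target) :
    nabla (v i) (K i) (nabla (v j) (K j) ζ) y = nabla (v j) (K j) (nabla (v i) (K i) ζ) y := by
  obtain ⟨q, rfl⟩ := c.exists_chart_eq hy
  obtain ⟨g, hg⟩ := hc.exists_coefficients_even hD i j q
  have h1 := hg (c.form ζ hζ)
  have h2 : ∑ j, g j * (Y j (c.form ζ hζ)).1 q = 0 := Finset.sum_eq_zero fun j _ => by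
    rw [hc.odd_apply_form_eq_zero hζ h]
    exact mul_zero _
  rw [h2, sub_eq_zero, hc.apply_form, hc.apply_form, hc.apply_form, hc.apply_form, form_apply,
    form_apply] at h1
  exact c.odd_injective q h1

end Coordinates

end

end DegreeOne

/-! ### Calculus of ∇ and the conormal form -/

namespace DegreeOne

noncomputable section

open Set Filter Topology

namespace Coordinates

section Nabla

variable {m₀ m₁ : ℕ} {R R' : Type*} [NormedAddCommGroup R] [NormedSpace ℝ R]
  [NormedAddCommGroup R'] [NormedSpace ℝ R']
  {v : EuclideanSpace ℝ (Fin m₀) → EuclideanSpace ℝ (Fin m₀)}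
  {K : EuclideanSpace ℝ (Fin m₀) → (Fin m₁ → ℝ) →L[ℝ] (Fin m₁ → ℝ)}
  {ζ ζ' : EuclideanSpace ℝ (Fin m₀) → (Fin m₁ → ℝ) →L[ℝ] R} {y : EuclideanSpace ℝ (Fin m₀)}

/-- K acts on the source of ζ and G on its target, so a gauge factor G contributes only its
derivative along v. -/
theorem nabla_comp {G : EuclideanSpace ℝ (Fin m₀) → R →L[ℝ] R'} (hG : DifferentiableAt ℝ G y)
    (hζ : DifferentiableAt ℝ ζ y) : nabla v K (fun y => (G y).comp (ζ y)) y =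
      (fderiv ℝ G y (v y)).comp (ζ y) + (G y).comp (nabla v K ζ y) := by
  rw [nabla, (hG.hasFDerivAt.clm_comp hζ.hasFDerivAt).fderiv]
  ext u
  simp [nabla]
  abel

theorem nabla_const_comp (L : R →L[ℝ] R') (hζ : DifferentiableAt ℝ ζ y) :
    nabla v K (fun y => L.comp (ζ y)) y = L.comp (nabla v K ζ y) := by
  rw [nabla_comp (differentiableAt_const L) hζ]
  simp

theorem nabla_congr (h : ζ =ᶠ[𝓝 y] ζ') : nabla v K ζ y = nabla v K ζ' y := by
  rw [nabla, nabla, h.fderiv_eq, h.eq_of_nhds]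

end Nabla

/-- The linear map with given values on the standard basis. -/
def linearSum {n : ℕ} {W : Type*} [NormedAddCommGroup W] [NormedSpace ℝ W] (β : Fin n → W) :
    (Fin n → ℝ) →L[ℝ] W :=
  ∑ j, (ContinuousLinearMap.proj j : (Fin n → ℝ) →L[ℝ] ℝ).smulRight (β j)

theorem linearSum_apply {n : ℕ} {W : Type*} [NormedAddCommGroup W] [NormedSpace ℝ W]
    (β : Fin n → W) (k : Fin n → ℝ) : linearSum β k = ∑ j, k j • β j := by
  simp [linearSum]

theorem linearSum_single {n : ℕ} {W : Type*} [NormedAddCommGroup W] [NormedSpace ℝ W]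
    (β : Fin n → W) (i : Fin n) : linearSum β (Pi.single i 1) = β i := by
  rw [linearSum_apply, Finset.sum_eq_single i]
  · simp
  · intro j _ hj
    simp [hj]
  · simp

theorem contDiffOn_linearSum {n : ℕ} {V W : Type*} [NormedAddCommGroup V] [NormedSpace ℝ V]
    [NormedAddCommGroup W] [NormedSpace ℝ W] {β : Fin n → V → W} {O : Set V}
    (hβ : ∀ j, ContDiffOn ℝ ∞ (β j) O) : ContDiffOn ℝ ∞ (fun z => linearSum fun j => β j z) O :=
  ContDiffOn.sum fun j _ => contDiffOn_const.smulRight (hβ j)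

/-- The map with values β_j on the basis is differentiated in a direction x whose image is Σ h_i
v_i, and the result is expanded bilinearly; integrability then compares the coefficients of k_j h_i.
-/
theorem fderiv_linearSum {n : ℕ} {V V' W : Type*} [NormedAddCommGroup V] [NormedSpace ℝ V]
    [NormedAddCommGroup V'] [NormedSpace ℝ V'] [NormedAddCommGroup W] [NormedSpace ℝ W]
    {β : Fin n → V → W} (L : V' →L[ℝ] V) {z x : V'} (hβ : ∀ j, DifferentiableAt ℝ (β j) (L z))
    {v : Fin n → V} {h : Fin n → ℝ} (hx : L x = ∑ i, h i • v i) (k : Fin n → ℝ) :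
    fderiv ℝ (fun z => linearSum fun j => β j (L z)) z x k =
      ∑ j, ∑ i, (k j * h i) • fderiv ℝ (β j) (L z) (v i) := by
  have h1 : HasFDerivAt (fun z => linearSum fun j => β j (L z)) _ z :=
    HasFDerivAt.fun_sum fun j _ => (ContinuousLinearMap.smulRightL ℝ (Fin n → ℝ) W
      (ContinuousLinearMap.proj j)).hasFDerivAt.comp z
        ((hβ j).hasFDerivAt.comp z L.hasFDerivAt)
  rw [h1.fderiv, FunLike.coe_sum, Finset.sum_apply, FunLike.coe_sum, Finset.sum_apply]
  refine Finset.sum_congr rfl fun j _ => ?_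
  simp only [mul_smul, ← Finset.smul_sum, ← map_smul, ← map_sum, ← hx]
  simp

section Straightening

variable {m₀ m₁ d₀ d₁ : ℕ} {κ₀ κ₁ : Type} [Fintype κ₀] [Fintype κ₁]
  (Λ : EuclideanSpace ℝ (Fin m₀) ≃L[ℝ] (Fin d₀ → ℝ) × (κ₀ → ℝ))
  (Λ' : (Fin m₁ → ℝ) ≃L[ℝ] (Fin d₁ → ℝ) × (κ₁ → ℝ))

/-- The form that vanishes on the given vectors. -/
def conormal (w : Fin d₁ → Fin m₁ → ℝ) : (Fin m₁ → ℝ) →L[ℝ] (κ₁ → ℝ) :=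
  (ContinuousLinearMap.snd ℝ _ _ - (linearSum fun j => (Λ' (w j)).2).comp
    (ContinuousLinearMap.fst ℝ _ _)).comp (Λ' : (Fin m₁ → ℝ) →L[ℝ] _)

variable {Λ'} {w : Fin d₁ → Fin m₁ → ℝ}

theorem conormal_apply (u : Fin m₁ → ℝ) :
    conormal Λ' w u = (Λ' u).2 - ∑ j, (Λ' u).1 j • (Λ' (w j)).2 := by
  simp [conormal, linearSum_apply]

theorem conormal_symm (r : κ₁ → ℝ) : conormal Λ' w (Λ'.symm (0, r)) = r := by
  simp [conormal_apply]

theorem conormal_self (hw : ∀ i j, (Λ' (w i)).1 j = if i = j then 1 else 0) (i : Fin d₁) :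
    conormal Λ' w (w i) = 0 := by
  simp [conormal_apply, hw]

/-- The normalisation of the w_j makes their span a complement of the second factor of the
splitting; `conormal` is the projection onto that factor along the span. -/
theorem eq_sum_add_conormal (hw : ∀ i j, (Λ' (w i)).1 j = if i = j then 1 else 0)
    (u : Fin m₁ → ℝ) : u = ∑ j, (Λ' u).1 j • w j + Λ'.symm (0, conormal Λ' w u) := by
  refine Λ'.injective ?_
  rw [map_add, ContinuousLinearEquiv.apply_symm_apply, map_sum]
  refine Prod.ext ?_ ?_
  · ext k
    simp [Prod.fst_sum, hw]
  · simp [Prod.snd_sum, conormal_apply]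

/-- A form vanishing on the w_j is determined by its restriction to the fixed complement of their
span. Applied to ∇ζ this produces the connection matrix. -/
theorem comp_conormal (hw : ∀ i j, (Λ' (w i)).1 j = if i = j then 1 else 0) {R : Type*}
    [NormedAddCommGroup R] [NormedSpace ℝ R] {T : (Fin m₁ → ℝ) →L[ℝ] R} (hT : ∀ j, T (w j) = 0) :
    T = (T.comp ((Λ'.symm : _ →L[ℝ] (Fin m₁ → ℝ)).comp
      (ContinuousLinearMap.inr ℝ (Fin d₁ → ℝ) (κ₁ → ℝ)))).comp (conormal Λ' w) := by
  refine ContinuousLinearMap.ext fun u => ?_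
  conv_lhs => rw [eq_sum_add_conormal hw u, map_add, map_sum]
  rw [Finset.sum_eq_zero fun j _ => by rw [map_smul, hT, smul_zero], zero_add]
  rfl

end Straightening

end Coordinates

end

end DegreeOne

/-! ### Straightened coordinates and parallel conormal frames -/

namespace DegreeOne

noncomputable section

open Set Filter Topology

namespace Coordinates

variable {m₀ m₁ d₀ d₁ : ℕ} {κ₀ κ₁ : Type} [Fintype κ₀] [Fintype κ₁]
  {Λ : EuclideanSpace ℝ (Fin m₀) ≃L[ℝ] (Fin d₀ → ℝ) × (κ₀ → ℝ)}
  {Λ' : (Fin m₁ → ℝ) ≃L[ℝ] (Fin d₁ → ℝ) × (κ₁ → ℝ)}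
  {v : Fin d₀ → EuclideanSpace ℝ (Fin m₀) → EuclideanSpace ℝ (Fin m₀)}
  {K : Fin d₀ → EuclideanSpace ℝ (Fin m₀) → (Fin m₁ → ℝ) →L[ℝ] (Fin m₁ → ℝ)}
  {w : Fin d₁ → EuclideanSpace ℝ (Fin m₀) → Fin m₁ → ℝ} {T : Set (EuclideanSpace ℝ (Fin m₀))}

theorem contDiffOn_conormal (hw : ∀ j, ContDiffOn ℝ ∞ (w j) T) :
    ContDiffOn ℝ ∞ (fun y => conormal Λ' fun j => w j y) T := by
  refine ContDiffOn.clm_comp (contDiffOn_const.sub (ContDiffOn.clm_comp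
    (contDiffOn_linearSum fun j => ?_) contDiffOn_const)) contDiffOn_const
  exact (contDiff_snd.comp Λ'.contDiff).comp_contDiffOn (hw j)

theorem differentiableAt_of_contDiffOn {V W : Type*} [NormedAddCommGroup V] [NormedSpace ℝ V]
    [NormedAddCommGroup W] [NormedSpace ℝ W] {O : Set V} (hO : IsOpen O) {f : V → W}
    (hf : ContDiffOn ℝ ∞ f O) (y : V) (hy : y ∈ O) : DifferentiableAt ℝ f y :=
  (hf.contDiffAt (hO.mem_nhds hy)).differentiableAt (by simp)

/-- The operators of a flat connection along the distribution, on the forms vanishing on it. -/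
def connectionForm (Λ' : (Fin m₁ → ℝ) ≃L[ℝ] (Fin d₁ → ℝ) × (κ₁ → ℝ))
    (T : (Fin m₁ → ℝ) →L[ℝ] (κ₁ → ℝ)) : (κ₁ → ℝ) →L[ℝ] (κ₁ → ℝ) :=
  T.comp ((Λ'.symm : _ →L[ℝ] (Fin m₁ → ℝ)).comp
      (ContinuousLinearMap.inr ℝ (Fin d₁ → ℝ) (κ₁ → ℝ)))

theorem proj_comp_ext {R R' : Type*} [NormedAddCommGroup R] [NormedSpace ℝ R] [Fintype R']
    {A B : R →L[ℝ] (R' → ℝ)} (h : ∀ l, (ContinuousLinearMap.proj l : (R' → ℝ) →L[ℝ] ℝ).comp A =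
      (ContinuousLinearMap.proj l : (R' → ℝ) →L[ℝ] ℝ).comp B) : A = B :=
  ContinuousLinearMap.ext fun u => funext fun l => DFunLike.congr_fun (h l) u

/-- Vector-valued versions of the properties of an involutive distribution. -/
theorem nabla_conormal (hT : IsOpen T)
    (hv' : ∀ i, ContDiffOn ℝ ∞ (v i) T) (hK' : ∀ i, ContDiffOn ℝ ∞ (K i) T)
    (hw' : ∀ j, ContDiffOn ℝ ∞ (w j) T)
    (hw : ∀ y ∈ T, ∀ i j, (Λ' (w i y)).1 j = if i = j then 1 else 0)
    (h₁ : ∀ ξ : EuclideanSpace ℝ (Fin m₀) → (Fin m₁ → ℝ) →L[ℝ] ℝ, ContDiffOn ℝ ∞ ξ T →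
      (∀ y ∈ T, ∀ j, ξ y (w j y) = 0) → ∀ i j, ∀ y ∈ T, nabla (v i) (K i) ξ y (w j y) = 0)
    (h₂ : ∀ ξ : EuclideanSpace ℝ (Fin m₀) → (Fin m₁ → ℝ) →L[ℝ] ℝ, ContDiffOn ℝ ∞ ξ T →
      (∀ y ∈ T, ∀ j, ξ y (w j y) = 0) → ∀ i j, ∀ y ∈ T,
        nabla (v i) (K i) (nabla (v j) (K j) ξ) y = nabla (v j) (K j) (nabla (v i) (K i) ξ) y) :
    let ζ := fun y => conormal Λ' fun j => w j y
    let θ := fun i y => connectionForm Λ' (nabla (v i) (K i) ζ y)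
    (∀ y ∈ T, ∀ i, nabla (v i) (K i) ζ y = (θ i y).comp (ζ y)) ∧
      ∀ y ∈ T, ∀ i j, fderiv ℝ (θ j) y (v i y) - θ i y * θ j y =
        fderiv ℝ (θ i) y (v j y) - θ j y * θ i y := by
  intro ζ θ
  have hζ : ContDiffOn ℝ ∞ ζ T := contDiffOn_conormal hw'
  have hnζ : ∀ i, ContDiffOn ℝ ∞ (nabla (v i) (K i) ζ) T := fun i =>
    nabla_contDiffOn hT (hv' i) (hK' i) hζ
  have hθ : ∀ i, ContDiffOn ℝ ∞ (θ i) T := fun i => (hnζ i).clm_comp contDiffOn_const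
  let L : κ₁ → (κ₁ → ℝ) →L[ℝ] ℝ := fun l => ContinuousLinearMap.proj l
  have hLζ : ∀ l, ContDiffOn ℝ ∞ (fun y => (L l).comp (ζ y)) T := fun l =>
    contDiffOn_const.clm_comp hζ
  have hLw : ∀ l, ∀ y ∈ T, ∀ j, (L l).comp (ζ y) (w j y) = 0 := fun l y hy j => by
    change L l (ζ y (w j y)) = 0
    rw [conormal_self (hw y hy), map_zero]
  have hLn : ∀ l i, ∀ y ∈ T, nabla (v i) (K i) (fun y => (L l).comp (ζ y)) y =
      (L l).comp (nabla (v i) (K i) ζ y) := fun l i y hy => nabla_const_comp _ (differentiableAt_of_contDiffOn hT hζ y hy)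
  -- Each component of ζ vanishes on the w_j, hence so does each component of ∇_i ζ, which therefore
  -- factors through ζ.
  have key : ∀ y ∈ T, ∀ i, nabla (v i) (K i) ζ y = (θ i y).comp (ζ y) := fun y hy i =>
    comp_conormal (hw y hy) fun j => funext fun l => by
      have := h₁ _ (hLζ l) (hLw l) i j y hy
      rw [hLn l i y hy] at this
      exact this
  have hcomm : ∀ y ∈ T, ∀ i j, nabla (v i) (K i) (nabla (v j) (K j) ζ) y =
      nabla (v j) (K j) (nabla (v i) (K i) ζ) y := fun y hy i j => proj_comp_ext fun l => by
    have h := h₂ _ (hLζ l) (hLw l) i j y hy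
    have e : ∀ i, nabla (v i) (K i) (fun y => (L l).comp (ζ y)) =ᶠ[𝓝 y]
        fun y => (L l).comp (nabla (v i) (K i) ζ y) := fun i => by
      filter_upwards [hT.mem_nhds hy] with y hy using hLn l i y hy
    rw [nabla_congr (e j), nabla_congr (e i), nabla_const_comp _ (differentiableAt_of_contDiffOn hT (hnζ j) y hy),
      nabla_const_comp _ (differentiableAt_of_contDiffOn hT (hnζ i) y hy)] at h
    exact h
  refine ⟨key, fun y hy i j => ?_⟩
  -- Substituting ∇_i ζ = θ_i ζ twice gives ∇_i ∇_j ζ = (∂_i θ_j + θ_j θ_i) ζ.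
  have e : ∀ i j, nabla (v i) (K i) (nabla (v j) (K j) ζ) y =
      (fderiv ℝ (θ j) y (v i y) + θ j y * θ i y).comp (ζ y) := fun i j => by
    have h : nabla (v j) (K j) ζ =ᶠ[𝓝 y] fun y => (θ j y).comp (ζ y) := by
      filter_upwards [hT.mem_nhds hy] with y hy using key y hy j
    rw [nabla_congr h, nabla_comp (differentiableAt_of_contDiffOn hT (hθ j) y hy) (differentiableAt_of_contDiffOn hT hζ y hy), key y hy i,
      ContinuousLinearMap.add_comp]
    rfl
  have h := hcomm y hy i j
  rw [e, e] at h
  -- ζ is onto, with right inverse the inclusion of the complement, so it cancels.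
  have h' : fderiv ℝ (θ j) y (v i y) + θ j y * θ i y =
      fderiv ℝ (θ i) y (v j y) + θ i y * θ j y := ContinuousLinearMap.ext fun r => by
    have := DFunLike.congr_fun h (Λ'.symm (0, r))
    simp only [ContinuousLinearMap.comp_apply] at this
    have hr : ζ y (Λ'.symm (0, r)) = r := conormal_symm r
    rwa [hr] at this
  rw [sub_eq_sub_iff_add_eq_add, h', add_comm]

/-- With first components normalised, the span of the v_i is the graph of the linear map b
collecting their second components: (h, b h) corresponds to Σ h_i v_i. -/
theorem symm_sum_symbol {v : Fin d₀ → EuclideanSpace ℝ (Fin m₀)}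
    (hv : ∀ i j, (Λ (v i)).1 j = if i = j then 1 else 0) (h : Fin d₀ → ℝ) :
    Λ.symm (h, linearSum (fun j => (Λ (v j)).2) h) = ∑ i, h i • v i := by
  rw [ContinuousLinearEquiv.symm_apply_eq, map_sum]
  refine Prod.ext ?_ ?_
  · ext k
    simp [Prod.fst_sum, hv]
  · simp [Prod.snd_sum, linearSum_apply]

theorem fderiv_linearSum_symm {W : Type*} [NormedAddCommGroup W] [NormedSpace ℝ W]
    (hT : IsOpen T) {β : Fin d₀ → EuclideanSpace ℝ (Fin m₀) → W}
    (hβ : ∀ i, ContDiffOn ℝ ∞ (β i) T)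
    (hv : ∀ y ∈ T, ∀ i j, (Λ (v i y)).1 j = if i = j then 1 else 0)
    {z : (Fin d₀ → ℝ) × (κ₀ → ℝ)} (hz : Λ.symm z ∈ T) (h k : Fin d₀ → ℝ) :
    fderiv ℝ (fun z => linearSum fun j => β j (Λ.symm z)) z
      (h, linearSum (fun j => (Λ (v j (Λ.symm z))).2) h) k =
      ∑ j, ∑ i, (k j * h i) • fderiv ℝ (β j) (Λ.symm z) (v i (Λ.symm z)) :=
  fderiv_linearSum Λ.symm.toContinuousLinearMap
    (fun j => differentiableAt_of_contDiffOn hT (hβ j) _ hz) (symm_sum_symbol (hv _ hz) h) k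

theorem fderiv_snd_symbol {u : EuclideanSpace ℝ (Fin m₀) → EuclideanSpace ℝ (Fin m₀)}
    {y : EuclideanSpace ℝ (Fin m₀)} (hu : DifferentiableAt ℝ u y) (x : EuclideanSpace ℝ (Fin m₀)) :
    fderiv ℝ (fun y => (Λ (u y)).2) y x = (Λ (fderiv ℝ u y x)).2 := by
  have h2 : HasFDerivAt (fun y => (Λ (u y)).2) (((ContinuousLinearMap.snd ℝ (Fin d₀ → ℝ)
      (κ₀ → ℝ)).comp Λ.toContinuousLinearMap).comp (fderiv ℝ u y)) y :=
    ((ContinuousLinearMap.snd ℝ (Fin d₀ → ℝ) (κ₀ → ℝ)).comp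
      Λ.toContinuousLinearMap).hasFDerivAt.comp y hu.hasFDerivAt
  rw [h2.fderiv]
  rfl

theorem linearSum_mul_linearSum {A : Type*} [NormedRing A] [NormedAlgebra ℝ A] (θ : Fin d₀ → A)
    (h k : Fin d₀ → ℝ) :
    linearSum θ h * linearSum θ k = ∑ j, ∑ i, (k j * h i) • (θ i * θ j) := by
  simp only [linearSum_apply, Finset.sum_mul_sum, smul_mul_smul_comm]
  rw [Finset.sum_comm]
  exact Finset.sum_congr rfl fun j _ => Finset.sum_congr rfl fun i _ => by rw [mul_comm (k j)]

/-- The straightening theorem in terms of vector fields on a Euclidean space. -/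
theorem exists_straightening_of_symbols {𝔸 : Type} [NormedRing 𝔸] [NormedAlgebra ℝ 𝔸]
    [FiniteDimensional ℝ 𝔸] {θ : Fin d₀ → EuclideanSpace ℝ (Fin m₀) → 𝔸} (hT : IsOpen T)
    (hv' : ∀ i, ContDiffOn ℝ ∞ (v i) T) (hθ : ∀ i, ContDiffOn ℝ ∞ (θ i) T)
    (hv : ∀ y ∈ T, ∀ i j, (Λ (v i y)).1 j = if i = j then 1 else 0)
    (h₀ : ∀ i j, ∀ y ∈ T, fderiv ℝ (v j) y (v i y) = fderiv ℝ (v i) y (v j y))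
    (hflat : ∀ y ∈ T, ∀ i j, fderiv ℝ (θ j) y (v i y) - θ i y * θ j y =
        fderiv ℝ (θ i) y (v j y) - θ j y * θ i y)
    {y₀ : EuclideanSpace ℝ (Fin m₀)} (hy₀ : y₀ ∈ T) :
    ∃ (Ψ : OpenPartialHomeomorph ((Fin d₀ → ℝ) × (κ₀ → ℝ)) ((Fin d₀ → ℝ) × (κ₀ → ℝ)))
      (G : (Fin d₀ → ℝ) × (κ₀ → ℝ) → 𝔸),
      Λ y₀ ∈ Ψ.source ∧ (∀ y, Λ y ∈ Ψ.source → y ∈ T) ∧ ContDiffOn ℝ ∞ Ψ Ψ.source ∧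
      ContDiffOn ℝ ∞ Ψ.symm Ψ.target ∧ ContDiffOn ℝ ∞ G Ψ.source ∧
      ∀ y, Λ y ∈ Ψ.source → IsUnit (G (Λ y)) ∧
        (∀ i, fderiv ℝ Ψ (Λ y) (Λ (v i y)) = (Pi.single i 1, 0)) ∧
        ∀ i, fderiv ℝ G (Λ y) (Λ (v i y)) = -(G (Λ y) * θ i y) := by
  have hO : IsOpen (Λ.symm ⁻¹' T) := hT.preimage Λ.symm.continuous
  have hβ : ∀ i, ContDiffOn ℝ ∞ (fun y => (Λ (v i y)).2) T := fun i =>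
    (contDiff_snd.comp Λ.contDiff).comp_contDiffOn (hv' i)
  have hb : ContDiffOn ℝ ∞ (fun z => linearSum fun j => (Λ (v j (Λ.symm z))).2)
      (Λ.symm ⁻¹' T) := contDiffOn_linearSum fun j =>
    (hβ j).comp Λ.symm.contDiff.contDiffOn fun z hz => hz
  have hΘ : ContDiffOn ℝ ∞ (fun z => linearSum fun j => θ j (Λ.symm z)) (Λ.symm ⁻¹' T) :=
    contDiffOn_linearSum fun j => (hθ j).comp Λ.symm.contDiff.contDiffOn fun z hz => hz
  -- The condition on b, expanded in h and k, is the second component of the commutation of the v_i.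
  have hbb : ∀ z ∈ Λ.symm ⁻¹' T, ∀ h k,
      fderiv ℝ (fun z => linearSum fun j => (Λ (v j (Λ.symm z))).2) z
        (h, linearSum (fun j => (Λ (v j (Λ.symm z))).2) h) k =
      fderiv ℝ (fun z => linearSum fun j => (Λ (v j (Λ.symm z))).2) z
        (k, linearSum (fun j => (Λ (v j (Λ.symm z))).2) k) h := fun z hz h k => by
    rw [fderiv_linearSum_symm (β := fun j y => (Λ (v j y)).2) hT hβ hv hz,
      fderiv_linearSum_symm (β := fun j y => (Λ (v j y)).2) hT hβ hv hz, Finset.sum_comm]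
    refine Finset.sum_congr rfl fun i _ => Finset.sum_congr rfl fun j _ => ?_
    rw [fderiv_snd_symbol (differentiableAt_of_contDiffOn hT (hv' j) _ hz),
      fderiv_snd_symbol (differentiableAt_of_contDiffOn hT (hv' i) _ hz), h₀ _ _ _ hz, mul_comm]
  -- Likewise the condition on θ, expanded in h and k, is flatness for each pair of indices.
  have hθθ : ∀ z ∈ Λ.symm ⁻¹' T, ∀ h k,
      fderiv ℝ (fun z => linearSum fun j => θ j (Λ.symm z)) z
        (h, linearSum (fun j => (Λ (v j (Λ.symm z))).2) h) k -
        linearSum (fun j => θ j (Λ.symm z)) h * linearSum (fun j => θ j (Λ.symm z)) k =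
      fderiv ℝ (fun z => linearSum fun j => θ j (Λ.symm z)) z
        (k, linearSum (fun j => (Λ (v j (Λ.symm z))).2) k) h -
        linearSum (fun j => θ j (Λ.symm z)) k * linearSum (fun j => θ j (Λ.symm z)) h :=
    fun z hz h k => by
      rw [fderiv_linearSum_symm hT hθ hv hz, fderiv_linearSum_symm hT hθ hv hz,
        linearSum_mul_linearSum, linearSum_mul_linearSum]
      simp only [← Finset.sum_sub_distrib, ← smul_sub]
      rw [Finset.sum_comm]
      refine Finset.sum_congr rfl fun i _ => Finset.sum_congr rfl fun j _ => ?_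
      rw [hflat _ hz, mul_comm]
  have hz₀ : Λ y₀ ∈ Λ.symm ⁻¹' T := by
    rw [mem_preimage, Λ.symm_apply_apply]
    exact hy₀
  obtain ⟨Ψ, G, hz₀, hΨO, hΨ, hΨ', hG, hfin⟩ := exists_straightening hO hb hΘ hbb hθθ hz₀
  have hsub : ∀ y, Λ y ∈ Ψ.source → y ∈ T := fun y hy => by
    have h1 : Λ.symm (Λ y) ∈ T := hΨO hy
    rwa [Λ.symm_apply_apply] at h1
  refine ⟨Ψ, G, hz₀, hsub, hΨ, hΨ', hG, fun y hy => ?_⟩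
  obtain ⟨-, hGu, hΨd, hGd⟩ := hfin _ hy
  have hvy : ∀ i, Λ (v i y) =
      (Pi.single i 1, linearSum (fun j => (Λ (v j (Λ.symm (Λ y)))).2) (Pi.single i 1)) := fun i => by
    rw [linearSum_single, Λ.symm_apply_apply]
    refine Prod.ext (funext fun j => ?_) rfl
    refine (hv y (hsub y hy) i j).trans ?_
    change _ = (Pi.single i 1 : Fin d₀ → ℝ) j
    rw [Pi.single_apply]
    simp only [eq_comm]
  refine ⟨hGu, fun i => by rw [hvy, hΨd], fun i => ?_⟩
  rw [hvy, hGd, linearSum_single, Λ.symm_apply_apply]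

/-- Coordinates and forms that are invariant under the distribution. -/
theorem exists_flat_coordinates (hT : IsOpen T)
    (hv' : ∀ i, ContDiffOn ℝ ∞ (v i) T) (hK' : ∀ i, ContDiffOn ℝ ∞ (K i) T)
    (hw' : ∀ j, ContDiffOn ℝ ∞ (w j) T)
    (hv : ∀ y ∈ T, ∀ i j, (Λ (v i y)).1 j = if i = j then 1 else 0)
    (hw : ∀ y ∈ T, ∀ i j, (Λ' (w i y)).1 j = if i = j then 1 else 0)
    (h₀ : ∀ i j, ∀ y ∈ T, fderiv ℝ (v j) y (v i y) = fderiv ℝ (v i) y (v j y))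
    (h₁ : ∀ ξ : EuclideanSpace ℝ (Fin m₀) → (Fin m₁ → ℝ) →L[ℝ] ℝ, ContDiffOn ℝ ∞ ξ T →
      (∀ y ∈ T, ∀ j, ξ y (w j y) = 0) → ∀ i j, ∀ y ∈ T, nabla (v i) (K i) ξ y (w j y) = 0)
    (h₂ : ∀ ξ : EuclideanSpace ℝ (Fin m₀) → (Fin m₁ → ℝ) →L[ℝ] ℝ, ContDiffOn ℝ ∞ ξ T →
      (∀ y ∈ T, ∀ j, ξ y (w j y) = 0) → ∀ i j, ∀ y ∈ T,
        nabla (v i) (K i) (nabla (v j) (K j) ξ) y = nabla (v j) (K j) (nabla (v i) (K i) ξ) y)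
    {y₀ : EuclideanSpace ℝ (Fin m₀)} (hy₀ : y₀ ∈ T) :
    ∃ (Ψ : OpenPartialHomeomorph ((Fin d₀ → ℝ) × (κ₀ → ℝ)) ((Fin d₀ → ℝ) × (κ₀ → ℝ)))
      (η : EuclideanSpace ℝ (Fin m₀) → (Fin m₁ → ℝ) →L[ℝ] (κ₁ → ℝ)),
      Λ y₀ ∈ Ψ.source ∧ (∀ y, Λ y ∈ Ψ.source → y ∈ T) ∧ ContDiffOn ℝ ∞ Ψ Ψ.source ∧
      ContDiffOn ℝ ∞ Ψ.symm Ψ.target ∧ ContDiffOn ℝ ∞ η (Λ ⁻¹' Ψ.source) ∧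
      ∀ y, Λ y ∈ Ψ.source → (∀ i, fderiv ℝ Ψ (Λ y) (Λ (v i y)) = (Pi.single i 1, 0)) ∧
        (∀ i, nabla (v i) (K i) η y = 0) ∧ (∀ j, η y (w j y) = 0) ∧
        ∀ u, (Λ' u).1 = 0 → η y u = 0 → u = 0 := by
  set ζ := fun y => conormal Λ' fun j => w j y with hζdef
  set θ := fun i y => connectionForm Λ' (nabla (v i) (K i) ζ y) with hθdef
  obtain ⟨key, hflat⟩ := nabla_conormal hT hv' hK' hw' hw h₁ h₂
  have hζ : ContDiffOn ℝ ∞ ζ T := contDiffOn_conormal hw'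
  have hθ : ∀ i, ContDiffOn ℝ ∞ (θ i) T := fun i =>
    (nabla_contDiffOn hT (hv' i) (hK' i) hζ).clm_comp contDiffOn_const
  obtain ⟨Ψ, G, hz₀, hsub, hΨ, hΨ', hG, hfin⟩ :=
    exists_straightening_of_symbols hT hv' hθ hv h₀ hflat hy₀
  have hGΛ : ContDiffOn ℝ ∞ (fun y => G (Λ y)) (Λ ⁻¹' Ψ.source) :=
    hG.comp Λ.contDiff.contDiffOn fun y hy => hy
  -- The parallel frame is η = G ζ: from dG(v_i) = -G θ_i and ∇_i ζ = θ_i ζ one gets ∇_i η = 0.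
  refine ⟨Ψ, fun y => (G (Λ y)).comp (ζ y), hz₀, hsub, hΨ, hΨ',
    hGΛ.clm_comp (hζ.mono hsub), fun y hy => ?_⟩
  obtain ⟨hGu, hΨd, hGd⟩ := hfin _ hy
  refine ⟨hΨd, fun i => ?_, fun j => ?_, fun u hu hηu => ?_⟩
  · have hd1 : DifferentiableAt ℝ G (Λ y) :=
      (hG.contDiffAt (Ψ.open_source.mem_nhds hy)).differentiableAt (by simp)
    have hd2 : HasFDerivAt (fun y => G (Λ y)) ((fderiv ℝ G (Λ y)).comp
        Λ.toContinuousLinearMap) y := hd1.hasFDerivAt.comp y Λ.hasFDerivAt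
    have h4 : fderiv ℝ (fun y => G (Λ y)) y (v i y) = -(G (Λ y) * θ i y) := by
      rw [hd2.fderiv]
      change fderiv ℝ G (Λ y) (Λ (v i y)) = _
      rw [hGd]
    rw [nabla_comp hd2.differentiableAt (differentiableAt_of_contDiffOn hT hζ y (hsub y hy)), h4, key y (hsub y hy) i]
    refine ContinuousLinearMap.ext fun u => ?_
    change -(G (Λ y) (θ i y (ζ y u))) + G (Λ y) (θ i y (ζ y u)) = 0
    exact neg_add_cancel _
  · change G (Λ y) (ζ y (w j y)) = 0
    rw [hζdef]
    simp only
    rw [conormal_self (hw y (hsub y hy)), map_zero]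
  -- G is invertible, so η u = 0 forces ζ u = 0; together with the vanishing first components this
  -- leaves nothing of u in its decomposition along the w_j and the complement.
  · obtain ⟨g, hg⟩ := hGu.exists_left_inv
    have h1 : ζ y u = 0 := by
      have h2 : g (G (Λ y) (ζ y u)) = ζ y u := DFunLike.congr_fun hg (ζ y u)
      have h3 : G (Λ y) (ζ y u) = 0 := hηu
      rw [← h2, h3, map_zero]
    rw [eq_sum_add_conormal (hw y (hsub y hy)) u, hu]
    have h2 : conormal Λ' (fun j => w j y) u = 0 := h1
    rw [h2]
    simp

end Coordinates

end

end DegreeOne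

/-! ### Linear algebra of splittings -/

namespace DegreeOne

noncomputable section

open Set Filter Topology

section LinearAlgebra

/-- The splitting of the coordinates into the first `d` and the others. -/
def splitEquiv {d m : ℕ} (h : d ≤ m) :
    ((Fin d → ℝ) × ({α : Fin m // d ≤ α} → ℝ)) ≃L[ℝ] (Fin m → ℝ) :=
  LinearEquiv.toContinuousLinearEquiv
    { toFun := fun z α => if hα : (α : ℕ) < d then z.1 ⟨α, hα⟩ else z.2 ⟨α, not_lt.1 hα⟩
      map_add' := fun z z' => funext fun α => by
        by_cases hα : (α : ℕ) < d <;> simp [hα]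
      map_smul' := fun r z => funext fun α => by
        by_cases hα : (α : ℕ) < d <;> simp [hα]
      invFun := fun u => (fun i => u (Fin.castLE h i), fun α => u α)
      left_inv := fun z => Prod.ext (funext fun i => by simp) (funext fun α => by
        simp [not_lt.2 α.2])
      right_inv := fun u => funext fun α => by
        by_cases hα : (α : ℕ) < d <;> simp [hα] }

theorem splitEquiv_apply_of_le {d m : ℕ} (h : d ≤ m)
    (z : (Fin d → ℝ) × ({α : Fin m // d ≤ α} → ℝ)) (α : {α : Fin m // d ≤ α}) :
    splitEquiv h z α = z.2 α := by
  change (if hα : ((α : Fin m) : ℕ) < d then z.1 ⟨α, hα⟩ else z.2 ⟨α, not_lt.1 hα⟩) = _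
  rw [dif_neg (not_lt.2 α.2)]

theorem splitEquiv_single {d m : ℕ} (h : d ≤ m) (i : Fin d) (α : Fin m) :
    splitEquiv h (Pi.single i 1, 0) α = if Fin.castLE h i = α then 1 else 0 := by
  change (if hα : (α : ℕ) < d then (Pi.single i 1 : Fin d → ℝ) ⟨α, hα⟩ else
    (0 : {α : Fin m // d ≤ α} → ℝ) ⟨α, not_lt.1 hα⟩) = _
  have h1 : Fin.castLE h i = α ↔ (i : ℕ) = α := by
    rw [Fin.ext_iff]
    rfl
  by_cases hα : (α : ℕ) < d
  · rw [dif_pos hα, Pi.single_apply]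
    refine if_congr ?_ rfl rfl
    rw [h1, Fin.ext_iff]
    exact eq_comm
  · rw [dif_neg hα, if_neg]
    · rfl
    · intro h2
      exact hα ((h1.1 h2) ▸ i.2)

/-- A linearly independent family is completed to a basis. -/
theorem exists_equiv_apply_eq_single {V : Type*} [NormedAddCommGroup V] [NormedSpace ℝ V]
    [FiniteDimensional ℝ V] {d m : ℕ} (hm : Module.finrank ℝ V = m) (h : d ≤ m) {a : Fin d → V}
    (ha : LinearIndependent ℝ a) :
    ∃ Λ : V ≃L[ℝ] (Fin d → ℝ) × ({α : Fin m // d ≤ α} → ℝ), ∀ i, Λ (a i) = (Pi.single i 1, 0) := by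
  obtain ⟨T, hT⟩ := (Submodule.span ℝ (range a)).exists_isCompl
  let b := Module.Basis.span ha
  have h1 : Module.finrank ℝ (Submodule.span ℝ (range a)) = d := by
    rw [Module.finrank_eq_card_basis b, Fintype.card_fin]
  have h2 := Submodule.finrank_add_eq_of_isCompl hT
  have h3 : Module.finrank ℝ ((Fin d → ℝ) × ({α : Fin m // d ≤ α} → ℝ)) = m := by
    rw [(splitEquiv h).toLinearEquiv.finrank_eq, Module.finrank_fin_fun]
  rw [Module.finrank_prod, Module.finrank_fin_fun] at h3
  have e : T ≃ₗ[ℝ] ({α : Fin m // d ≤ α} → ℝ) := LinearEquiv.ofFinrankEq _ _ (by omega)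
  let L := (Submodule.prodEquivOfIsCompl _ _ hT).symm.trans (b.equivFun.prodCongr e)
  refine ⟨L.toContinuousLinearEquiv, fun i => ?_⟩
  have h4 : a i = (b i : V) :=
    congrArg Subtype.val (Module.Basis.span_apply ha i).symm
  change b.equivFun.prodCongr e ((Submodule.prodEquivOfIsCompl _ _ hT).symm (a i)) = _
  rw [h4, Submodule.prodEquivOfIsCompl_symm_apply_left]
  refine Prod.ext ?_ (map_zero e)
  funext j
  change b.equivFun (b i) j = (Pi.single i 1 : Fin d → ℝ) j
  rw [b.equivFun_self, Pi.single_apply]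
  exact if_congr eq_comm rfl rfl

end LinearAlgebra

end

end DegreeOne

/-! ### Coordinates that are constant along the distribution -/

namespace DegreeOne

noncomputable section

open Set Filter Topology

variable {m₀ : ℕ} {M : Type*} [TopologicalSpace M]
  [ChartedSpace (EuclideanSpace ℝ (Fin m₀)) M]
  {F : Type*} [NormedAddCommGroup F] [NormedSpace ℝ F] [FiniteDimensional ℝ F]
  {E : M → Type*} [∀ p, AddCommGroup (E p)] [∀ p, Module ℝ (E p)]
  [∀ p, TopologicalSpace (E p)] [TopologicalSpace (Bundle.TotalSpace F E)]
  [FiberBundle F E] [VectorBundle ℝ F E] {d₀ d₁ m₁ : ℕ}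

variable {D : Distribution m₀ F E d₀ d₁} {U : Opens M} {X : Fin d₀ → Endo m₀ F E U}
  {Y : Fin d₁ → Endo m₀ F E U}

theorem mem_of_add_mem {S : Submodule (functions m₀ F E U) (Endo m₀ F E U)} {A B : Endo m₀ F E U}
    (hAB : A + B ∈ S) (hB : B ∈ S) : A ∈ S := by
  have h : A = A + B + algebraMap ℝ (functions m₀ F E U) (-1) • B := by
    refine LinearMap.ext fun f => Subtype.ext (funext fun q => ?_)
    change (A f).1 q = (A f).1 q + (B f).1 q + algebraMap ℝ (Fibre E (q : M)) (-1) * (B f).1 q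
    rw [← Algebra.smul_def, neg_one_smul, add_neg_cancel_right]
  rw [h]
  exact Submodule.add_mem _ hAB (Submodule.smul_mem _ _ hB)

theorem tangentVector_restrict [T2Space M] {U' : Opens M} (h : U' ≤ U) {Z : Endo m₀ F E U}
    {Z' : Endo m₀ F E U'} (hZ : IsRestriction h Z Z') (p : U') (f : functions m₀ F E U) :
    tangentVector Z' p (restrict h f) = tangentVector Z (Opens.inclusion h p) f := by
  change ExteriorAlgebra.algebraMapInv ((Z' (restrict h f)).1 p) = _
  rw [hZ]
  rfl

/-- Pulled back along C(U) → C(U'), the tangent vectors on U' become those on U; a family with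
independent image is independent. -/
theorem linearIndependent_tangentVector_restrict [T2Space M] {U' : Opens M} (h : U' ≤ U) {n : ℕ}
    {Z : Fin n → Endo m₀ F E U} {Z' : Fin n → Endo m₀ F E U'}
    (hZ : ∀ i, IsRestriction h (Z i) (Z' i)) (p : U')
    (hli : LinearIndependent ℝ fun i => tangentVector (Z i) (Opens.inclusion h p)) :
    LinearIndependent ℝ fun i => tangentVector (Z' i) p := by
  refine LinearIndependent.of_comp (restrict h).toLinearMap.dualMap ?_
  convert hli using 1
  exact funext fun i => LinearMap.ext fun f => tangentVector_restrict h (hZ i) p f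

namespace Coordinates

variable [T2Space M] [IsManifold (𝓡 m₀) ∞ M] {c : Coordinates m₀ F E m₁ U}

set_option maxHeartbeats 1000000 in
/-- A distribution is spanned by coordinate vector fields if the coordinates are constant along
it. -/
theorem sections_eq_span (hD : D.IsLocalFrame X Y) (h₀ : d₀ ≤ m₀) (h₁ : d₁ ≤ m₁)
    (hXx : ∀ i α, X i (c.x α) = if Fin.castLE h₀ i = α then 1 else 0)
    (hXe : ∀ i (β : Fin m₁), d₁ ≤ (β : ℕ) → X i (c.e β) = 0)
    (hYe : ∀ j β, Y j (c.e β) = if Fin.castLE h₁ j = β then 1 else 0) :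
    D.sections U = Submodule.span (functions m₀ F E U)
        (Set.range (fun a : Fin d₀ => c.partialX (Fin.castLE h₀ a)) ∪
          Set.range (fun b : Fin d₁ => c.partialE (Fin.castLE h₁ b))) := by
  have hexp : ∀ Z ∈ vectorFields m₀ F E U,
      Z = ∑ α, Z (c.x α) • c.partialX α + ∑ β, Z (c.e β) • c.partialE β := fun Z hZ =>
    eq_sum_partials c.isPartialX_partialX c.isPartialE_partialE hZ
  have hYx : ∀ j α, Y j (c.x α) = 0 := fun j α =>
    apply_eq_zero_of_degree_neg (hD.degree_odd j) (c.x_mem α)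
  -- A field is determined by its values on coordinates, so Y_j is exactly ∂/∂e^j.
  have hY : ∀ j, c.partialE (Fin.castLE h₁ j) = Y j := fun j => by
    rw [hexp (Y j) (mem_vectorFields_of_degree (hD.degree_odd j)),
      Finset.sum_eq_zero fun α _ => by rw [hYx, zero_smul], zero_add,
      Finset.sum_eq_single (Fin.castLE h₁ j)]
    · rw [hYe, if_pos rfl, one_smul]
    · intro β _ hβ
      rw [hYe, if_neg (Ne.symm hβ), zero_smul]
    · exact fun h => absurd (Finset.mem_univ _) h
  have hXsum : ∀ i, ∑ α, X i (c.x α) • c.partialX α = c.partialX (Fin.castLE h₀ i) := fun i => by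
    rw [Finset.sum_eq_single (Fin.castLE h₀ i)]
    · rw [hXx, if_pos rfl, one_smul]
    · intro β _ hβ
      rw [hXx, if_neg (Ne.symm hβ), zero_smul]
    · exact fun h => absurd (Finset.mem_univ _) h
  have hrest : ∀ i, ∑ β, X i (c.e β) • c.partialE β ∈ D.sections U := fun i =>
    Submodule.sum_mem _ fun β _ => by
      by_cases hβ : (β : ℕ) < d₁
      · have h2 : β = Fin.castLE h₁ ⟨β, hβ⟩ := rfl
        rw [h2, hY]
        exact Submodule.smul_mem _ _ (hD.odd_mem _)
      · rw [hXe i β (not_lt.1 hβ), zero_smul]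
        exact Submodule.zero_mem _
  -- X_i is ∂/∂x^i plus a combination of the ∂/∂e^β with β among the first d₁, which are the Y
  -- already known to lie in the distribution.
  have hX : ∀ i, c.partialX (Fin.castLE h₀ i) ∈ D.sections U := fun i => by
    have h2 := hexp (X i) (mem_vectorFields_of_degree (hD.degree_even i))
    rw [hXsum] at h2
    have h3 : c.partialX (Fin.castLE h₀ i) + ∑ β, X i (c.e β) • c.partialE β ∈ D.sections U := by
      rw [← h2]
      exact hD.even_mem i
    exact mem_of_add_mem h3 (hrest i)
  refine le_antisymm (fun Z hZ => ?_) (Submodule.span_le.2 ?_)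
  -- A section kills every function killed by the whole frame. Applied to the remaining coordinates,
  -- this removes their terms from the expansion of Z.
  · have hzero : ∀ f, (∀ i, X i f = 0) → (∀ j, Y j f = 0) → Z f = 0 := fun f h2 h3 => by
      refine Subtype.ext (funext fun q => ?_)
      obtain ⟨a, b, hab⟩ := hD.spannedBy U le_rfl Z hZ q
      refine (hab f).trans ?_
      rw [Finset.sum_eq_zero fun i _ => ?_, Finset.sum_eq_zero fun j _ => ?_, add_zero]
      · rfl
      · rw [h3]
        exact mul_zero _
      · rw [h2]
        exact mul_zero _
    rw [hexp Z (D.isVectorField U Z hZ)]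
    refine Submodule.add_mem _ (Submodule.sum_mem _ fun α _ => ?_)
      (Submodule.sum_mem _ fun β _ => ?_)
    · by_cases hα : (α : ℕ) < d₀
      · exact Submodule.smul_mem _ _ (Submodule.subset_span (Or.inl ⟨⟨α, hα⟩, rfl⟩))
      · rw [hzero _ (fun i => ?_) (hYx · α), zero_smul]
        · exact Submodule.zero_mem _
        · rw [hXx, if_neg]
          intro h2
          exact hα (h2 ▸ i.2)
    · by_cases hβ : (β : ℕ) < d₁
      · exact Submodule.smul_mem _ _ (Submodule.subset_span (Or.inr ⟨⟨β, hβ⟩, rfl⟩))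
      · rw [hzero _ (hXe · β (not_lt.1 hβ)) fun j => ?_, zero_smul]
        · exact Submodule.zero_mem _
        · rw [hYe, if_neg]
          intro h2
          exact hβ (h2 ▸ j.2)
  · rintro _ (⟨i, rfl⟩ | ⟨j, rfl⟩)
    · exact hX i
    · simp only
      rw [hY]
      exact hD.odd_mem j

end Coordinates

end

end DegreeOne

/-! ### Completing the flat data to a coordinate system -/

namespace DegreeOne

noncomputable section

open Set Filter Topology

variable {m₀ : ℕ} {M : Type*} [TopologicalSpace M]
  [ChartedSpace (EuclideanSpace ℝ (Fin m₀)) M]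
  {F : Type*} [NormedAddCommGroup F] [NormedSpace ℝ F] [FiniteDimensional ℝ F]
  {E : M → Type*} [∀ p, AddCommGroup (E p)] [∀ p, Module ℝ (E p)]
  [∀ p, TopologicalSpace (E p)] [TopologicalSpace (Bundle.TotalSpace F E)]
  [FiberBundle F E] [VectorBundle ℝ F E] {d₀ d₁ m₁ : ℕ}

variable {D : Distribution m₀ F E d₀ d₁} {U : Opens M} {X : Fin d₀ → Endo m₀ F E U}
  {Y : Fin d₁ → Endo m₀ F E U}

namespace Coordinates

variable [IsManifold (𝓡 m₀) ∞ M] {c : Coordinates m₀ F E m₁ U}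

/-- Coordinates are changed by a local diffeomorphism and an invertible matrix of functions. -/
theorem exists_change_of_matrix (c : Coordinates m₀ F E m₁ U)
    (Ψ : OpenPartialHomeomorph (EuclideanSpace ℝ (Fin m₀)) (EuclideanSpace ℝ (Fin m₀)))
    (hΨ : ContDiffOn ℝ ∞ Ψ Ψ.source) (hΨ' : ContDiffOn ℝ ∞ Ψ.symm Ψ.target)
    (hs : c.chart.target ⊆ Ψ.source)
    {B : EuclideanSpace ℝ (Fin m₀) → (Fin m₁ → ℝ) →L[ℝ] (Fin m₁ → ℝ)}
    (hB : ContDiffOn ℝ ∞ B c.chart.target)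
    (hB' : ∀ y ∈ c.chart.target, ∀ u, B y u = 0 → u = 0) :
    ∃ c' : Coordinates m₀ F E m₁ U, (∀ q, c'.chart q = Ψ (c.chart q)) ∧
      ∀ β, c'.e β = c.form (fun y => (ContinuousLinearMap.proj β).comp (B y))
        (contDiffOn_const.clm_comp hB) := by
  have hside : ∀ (q : U) (γ : Fin m₁), (c.e γ).1 (Opens.inclusion le_rfl q) ∈
      Submodule.span ℝ (range fun β => (c.form (fun y => (ContinuousLinearMap.proj β).comp (B y))
        (contDiffOn_const.clm_comp hB)).1 q) := by
    intro q γ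
    have hinj : Function.Injective (B (c.chart q)).toLinearMap :=
      (injective_iff_map_eq_zero _).2 (hB' _ (c.chart_mem_target q))
    let e := LinearEquiv.ofInjectiveEndo _ hinj
    -- Row γ of the inverse matrix of B expresses the old form e^γ in the new frame.
    let L : (Fin m₁ → ℝ) →L[ℝ] ℝ := LinearMap.toContinuousLinearMap
      (LinearMap.proj γ ∘ₗ e.symm.toLinearMap)
    have h3 : (ContinuousLinearMap.proj γ : (Fin m₁ → ℝ) →L[ℝ] ℝ) = ∑ β, L (Pi.single β 1) •
        (ContinuousLinearMap.proj β : (Fin m₁ → ℝ) →L[ℝ] ℝ).comp (B (c.chart q)) := by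
      have h4 : (ContinuousLinearMap.proj γ : (Fin m₁ → ℝ) →L[ℝ] ℝ) =
          L.comp (B (c.chart q)) := by
        refine ContinuousLinearMap.ext fun u => ?_
        exact congrFun (e.symm_apply_apply u).symm γ
      rw [h4]
      conv_lhs => rw [← sum_proj_smul L]
      refine ContinuousLinearMap.ext fun u => ?_
      simp
    have h5 : (c.e γ).1 (Opens.inclusion le_rfl q) = ∑ β, L (Pi.single β 1) •
        (c.form (fun y => (ContinuousLinearMap.proj β).comp (B y))
          (contDiffOn_const.clm_comp hB)).1 q := by
      change (c.e γ).1 q = _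
      rw [← odd_proj, h3, map_sum]
      exact Finset.sum_congr rfl fun β _ => by rw [map_smul, form_apply]
    rw [h5]
    exact Submodule.sum_mem _ fun β _ => Submodule.smul_mem _ _ (Submodule.subset_span ⟨β, rfl⟩)
  obtain ⟨c', h1, -, h2⟩ := c.exists_change le_rfl Ψ hΨ hΨ'
    (fun q hq => hs (c.chart_mem_target ⟨q, hq⟩))
    (fun β => c.form (fun y => (ContinuousLinearMap.proj β).comp (B y))
      (contDiffOn_const.clm_comp hB)) (fun β => c.form_mem _) hside
  exact ⟨c', h1, fun β => congrFun h2 β⟩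

variable [T2Space M]
  {v : Fin d₀ → EuclideanSpace ℝ (Fin m₀) → EuclideanSpace ℝ (Fin m₀)}
  {K : Fin d₀ → EuclideanSpace ℝ (Fin m₀) → (Fin m₁ → ℝ) →L[ℝ] (Fin m₁ → ℝ)}
  {w : Fin d₁ → EuclideanSpace ℝ (Fin m₀) → Fin m₁ → ℝ}

/-- The components of the first factor of a splitting. -/
def firstCoord {V : Type*} [NormedAddCommGroup V] [NormedSpace ℝ V] {d : ℕ} {κ : Type}
    [Fintype κ] (Λ : V ≃L[ℝ] (Fin d → ℝ) × (κ → ℝ)) (i : Fin d) : V →L[ℝ] ℝ :=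
  (ContinuousLinearMap.proj i).comp
    ((ContinuousLinearMap.fst ℝ (Fin d → ℝ) (κ → ℝ)).comp Λ.toContinuousLinearMap)

theorem firstCoord_apply {V : Type*} [NormedAddCommGroup V] [NormedSpace ℝ V] {d : ℕ} {κ : Type}
    [Fintype κ] (Λ : V ≃L[ℝ] (Fin d → ℝ) × (κ → ℝ)) (i : Fin d) (x : V) :
    firstCoord Λ i x = (Λ x).1 i := rfl

/-- Local diffeomorphisms and forms that are invariant under the distribution are part of a
coordinate system. -/
theorem exists_coordinates_of_flat (h₀ : d₀ ≤ m₀) (h₁ : d₁ ≤ m₁)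
    {Λ : EuclideanSpace ℝ (Fin m₀) ≃L[ℝ] (Fin d₀ → ℝ) × ({α : Fin m₀ // d₀ ≤ α} → ℝ)}
    {Λ' : (Fin m₁ → ℝ) ≃L[ℝ] (Fin d₁ → ℝ) × ({β : Fin m₁ // d₁ ≤ β} → ℝ)}
    (hc : c.IsAdapted D X Y (firstCoord Λ) (firstCoord Λ') v K w)
    {Ψ : OpenPartialHomeomorph ((Fin d₀ → ℝ) × ({α : Fin m₀ // d₀ ≤ α} → ℝ))
      ((Fin d₀ → ℝ) × ({α : Fin m₀ // d₀ ≤ α} → ℝ))}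
    {η : EuclideanSpace ℝ (Fin m₀) → (Fin m₁ → ℝ) →L[ℝ] ({β : Fin m₁ // d₁ ≤ β} → ℝ)}
    (hs : ∀ y ∈ c.chart.target, Λ y ∈ Ψ.source) (hΨ : ContDiffOn ℝ ∞ Ψ Ψ.source)
    (hΨ' : ContDiffOn ℝ ∞ Ψ.symm Ψ.target) (hη : ContDiffOn ℝ ∞ η c.chart.target)
    (hΨv : ∀ y ∈ c.chart.target, ∀ i, fderiv ℝ Ψ (Λ y) (Λ (v i y)) = (Pi.single i 1, 0))
    (hηv : ∀ y ∈ c.chart.target, ∀ i, nabla (v i) (K i) η y = 0)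
    (hηw : ∀ y ∈ c.chart.target, ∀ j, η y (w j y) = 0)
    (hηi : ∀ y ∈ c.chart.target, ∀ u, (Λ' u).1 = 0 → η y u = 0 → u = 0) :
    ∃ c' : Coordinates m₀ F E m₁ U,
      (∀ i α, X i (c'.x α) = if Fin.castLE h₀ i = α then 1 else 0) ∧
      (∀ i (β : Fin m₁), d₁ ≤ (β : ℕ) → X i (c'.e β) = 0) ∧
      (∀ j β, Y j (c'.e β) = if Fin.castLE h₁ j = β then 1 else 0) := by
  have hf := hc.isLocalFrame
  let S : ((Fin d₀ → ℝ) × ({α : Fin m₀ // d₀ ≤ α} → ℝ)) ≃L[ℝ] EuclideanSpace ℝ (Fin m₀) :=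
    (splitEquiv h₀).trans (EuclideanSpace.equiv (Fin m₀) ℝ).symm
  let Φ := (Λ.toHomeomorph.transOpenPartialHomeomorph Ψ).transHomeomorph S.toHomeomorph
  -- The new frame of E*: the first d₁ forms are the constant ones dual to the w_j, the others are
  -- the components of the parallel form η.
  let B : EuclideanSpace ℝ (Fin m₀) → (Fin m₁ → ℝ) →L[ℝ] (Fin m₁ → ℝ) := fun y =>
    (splitEquiv h₁).toContinuousLinearMap.comp
      (((ContinuousLinearMap.fst ℝ (Fin d₁ → ℝ) ({β : Fin m₁ // d₁ ≤ β} → ℝ)).comp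
        Λ'.toContinuousLinearMap).prod (η y))
  have hB : ContDiffOn ℝ ∞ B c.chart.target :=
    contDiffOn_const.clm_comp (contDiffOn_clm_apply.2 fun u =>
      contDiffOn_const.prodMk (hη.clm_apply contDiffOn_const))
  have hBi : ∀ y ∈ c.chart.target, ∀ u, B y u = 0 → u = 0 := fun y hy u hu => by
    have h1 : ((Λ' u).1, η y u) = (0 : (Fin d₁ → ℝ) × ({β : Fin m₁ // d₁ ≤ β} → ℝ)) :=
      (splitEquiv h₁).injective (hu.trans (map_zero _).symm)
    exact hηi y hy u (congrArg Prod.fst h1) (congrArg Prod.snd h1)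
  have hΦ : ContDiffOn ℝ ∞ Φ Φ.source :=
    S.contDiff.comp_contDiffOn (hΨ.comp Λ.contDiff.contDiffOn fun y hy => hy)
  have hΦ' : ContDiffOn ℝ ∞ Φ.symm Φ.target :=
    Λ.symm.contDiff.comp_contDiffOn (hΨ'.comp S.symm.contDiff.contDiffOn fun y hy => hy)
  obtain ⟨c', hc1, hc2⟩ := c.exists_change_of_matrix Φ hΦ hΦ' hs hB hBi
  refine ⟨c', fun i α => ?_, fun i β hβ => ?_, fun j β => ?_⟩
  · have hd : ContDiffOn ℝ ∞ (fun y => EuclideanSpace.proj (𝕜 := ℝ) α (S (Ψ (Λ y))))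
        c.chart.target := (EuclideanSpace.proj (𝕜 := ℝ) α).contDiff.comp_contDiffOn (hΦ.mono hs)
    have h1 : c'.x α = c.pull _ hd := Subtype.ext (funext fun q =>
      congrArg (fun y : EuclideanSpace ℝ (Fin m₀) => algebraMap ℝ (Fibre E (q : M)) (y α)) (hc1 q))
    refine Subtype.ext (funext fun q => ?_)
    have hq := c.chart_mem_target q
    have hdΨ : DifferentiableAt ℝ Ψ (Λ (c.chart q)) :=
      differentiableAt_of_contDiffOn Ψ.open_source hΨ _ (hs _ hq)
    have h2 : HasFDerivAt (fun y => EuclideanSpace.proj (𝕜 := ℝ) α (S (Ψ (Λ y))))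
        ((EuclideanSpace.proj (𝕜 := ℝ) α).comp (S.toContinuousLinearMap.comp
          ((fderiv ℝ Ψ (Λ (c.chart q))).comp Λ.toContinuousLinearMap))) (c.chart q) :=
      (EuclideanSpace.proj (𝕜 := ℝ) α).hasFDerivAt.comp _ (S.hasFDerivAt.comp _
        (hdΨ.hasFDerivAt.comp _ Λ.hasFDerivAt))
    rw [h1, (hc.symbol i).apply_pull (hf.degree_even i), h2.fderiv]
    have h3 : EuclideanSpace.proj (𝕜 := ℝ) α (S (fderiv ℝ Ψ (Λ (c.chart q))
        (Λ (v i (c.chart q))))) = if Fin.castLE h₀ i = α then 1 else 0 := by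
      rw [hΨv _ hq]
      exact splitEquiv_single h₀ i α
    refine (congrArg (algebraMap ℝ (Fibre E (q : M))) h3).trans ?_
    split_ifs
    · exact map_one _
    · exact map_zero _
  · refine Subtype.ext (funext fun q => ?_)
    have hq := c.chart_mem_target q
    rw [hc2, (hc.connection i).apply_form _ (hc.symbol i) (hf.degree_even i)]
    -- Beyond the first d₁ the frame consists of components of η, on which X_i acts by ∇_i and gives
    -- zero.
    have h1 : (fun y => (ContinuousLinearMap.proj β : (Fin m₁ → ℝ) →L[ℝ] ℝ).comp (B y)) =
        fun y => (ContinuousLinearMap.proj ⟨β, hβ⟩ :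
          ({β : Fin m₁ // d₁ ≤ β} → ℝ) →L[ℝ] ℝ).comp (η y) :=
      funext fun y => ContinuousLinearMap.ext fun u => splitEquiv_apply_of_le h₁ _ ⟨β, hβ⟩
    rw [h1, nabla_const_comp _ (differentiableAt_of_contDiffOn c.chart.open_target hη _ hq),
      hηv _ hq, ContinuousLinearMap.comp_zero, map_zero]
    rfl
  · refine Subtype.ext (funext fun q => ?_)
    have hq := c.chart_mem_target q
    rw [hc2, (hc.oddSymbol j).apply_form _ (hf.degree_odd j)]
    -- On w_j the constant forms give the basis vector by duality, and η gives 0.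
    have h1 : B (c.chart q) (w j (c.chart q)) β = if Fin.castLE h₁ j = β then 1 else 0 := by
      have h2 : ((Λ' (w j (c.chart q))).1, η (c.chart q) (w j (c.chart q))) =
          ((Pi.single j 1 : Fin d₁ → ℝ), (0 : {β : Fin m₁ // d₁ ≤ β} → ℝ)) := by
        refine Prod.ext (funext fun k => ?_) (hηw _ hq j)
        refine (hc.dual_odd _ hq j k).trans ?_
        change _ = (Pi.single j 1 : Fin d₁ → ℝ) k
        rw [Pi.single_apply]
        exact if_congr eq_comm rfl rfl
      refine Eq.trans ?_ (splitEquiv_single h₁ j β)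
      rw [← h2]
      rfl
    refine (congrArg (algebraMap ℝ (Fibre E (q : M))) h1).trans ?_
    split_ifs
    · exact map_one _
    · exact map_zero _

end Coordinates

end

end DegreeOne

/-! ### Conclusion: the Frobenius theorem -/

namespace DegreeOne

noncomputable section

open Set Filter Topology

variable {m₀ : ℕ} {M : Type*} [TopologicalSpace M]
  [ChartedSpace (EuclideanSpace ℝ (Fin m₀)) M]
  {F : Type*} [NormedAddCommGroup F] [NormedSpace ℝ F] [FiniteDimensional ℝ F]
  {E : M → Type*} [∀ p, AddCommGroup (E p)] [∀ p, Module ℝ (E p)]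
  [∀ p, TopologicalSpace (E p)] [TopologicalSpace (Bundle.TotalSpace F E)]
  [FiberBundle F E] [VectorBundle ℝ F E] {d₀ d₁ m₁ : ℕ}

variable {D : Distribution m₀ F E d₀ d₁} {U : Opens M} {X : Fin d₀ → Endo m₀ F E U}
  {Y : Fin d₁ → Endo m₀ F E U}

variable [T2Space M] [IsManifold (𝓡 m₀) ∞ M]

/-- The given generators are restricted to a domain of coordinates. Joint independence of the
tangent vectors is used only through its even and odd halves. -/
theorem Distribution.exists_isLocalFrame [ContMDiffVectorBundle ∞ F E (𝓡 m₀)]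
    (hF : Module.finrank ℝ F = m₁) (D : Distribution m₀ F E d₀ d₁) (p : M) :
    ∃ (U : Opens M) (hp : p ∈ U) (_ : Coordinates m₀ F E m₁ U) (X : Fin d₀ → Endo m₀ F E U)
      (Y : Fin d₁ → Endo m₀ F E U), D.IsLocalFrame X Y ∧
      (LinearIndependent ℝ fun i => tangentVector (X i) ⟨p, hp⟩) ∧
      LinearIndependent ℝ fun j => tangentVector (Y j) ⟨p, hp⟩ := by
  obtain ⟨U, hp, X, Y, hX, hY, hli, hD⟩ := D.locallyGenerated p
  have hf : D.IsLocalFrame X Y := ⟨hX, hY,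
    fun i => hD ▸ Submodule.subset_span (Or.inl ⟨i, rfl⟩),
    fun j => hD ▸ Submodule.subset_span (Or.inr ⟨j, rfl⟩), D.spannedBy_of_sections_eq hD⟩
  obtain ⟨U', hp', h, ⟨c⟩⟩ := exists_coordinates (m₀ := m₀) (E := E) hF hp
  obtain ⟨X', Y', hf', hX', hY'⟩ := hf.exists_restrict h
  refine ⟨U', hp', c, X', Y', hf', linearIndependent_tangentVector_restrict h hX' _ ?_,
    linearIndependent_tangentVector_restrict h hY' _ ?_⟩
  · exact (hli ⟨p, hp⟩).comp Sum.inl Sum.inl_injective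
  · exact (hli ⟨p, hp⟩).comp Sum.inr Sum.inr_injective

theorem continuousOn_det_dual {n : ℕ} {V W : Type*} [NormedAddCommGroup V] [NormedSpace ℝ V]
    [NormedAddCommGroup W] [NormedSpace ℝ W] {O : Set V} {v : Fin n → V → W}
    (hv : ∀ i, ContinuousOn (v i) O) (ℓ : Fin n → W →L[ℝ] ℝ) :
    ContinuousOn (fun y => (Matrix.of fun i j => ℓ j (v i y)).det) O := by
  simp only [Matrix.det_apply', Matrix.of_apply]
  fun_prop

namespace Coordinates

/-- Independence at p gives the rank inequalities, and lets the splittings Λ and Λ' be chosen with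
the symbols at p as first basis vectors. The matrices to be inverted are then the identity at p,
hence invertible near p. -/
theorem exists_isAdapted_nhds {c : Coordinates m₀ F E m₁ U} {p : M} (hp : p ∈ U)
    (hD : D.IsLocalFrame X Y)
    (hX : LinearIndependent ℝ fun i => tangentVector (X i) ⟨p, hp⟩)
    (hY : LinearIndependent ℝ fun j => tangentVector (Y j) ⟨p, hp⟩) :
    ∃ (_ : d₀ ≤ m₀) (_ : d₁ ≤ m₁)
      (Λ : EuclideanSpace ℝ (Fin m₀) ≃L[ℝ] (Fin d₀ → ℝ) × ({α : Fin m₀ // d₀ ≤ α} → ℝ))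
      (Λ' : (Fin m₁ → ℝ) ≃L[ℝ] (Fin d₁ → ℝ) × ({β : Fin m₁ // d₁ ≤ β} → ℝ))
      (U' : Opens M) (c' : Coordinates m₀ F E m₁ U') (X' : Fin d₀ → Endo m₀ F E U')
      (Y' : Fin d₁ → Endo m₀ F E U') (v : Fin d₀ → EuclideanSpace ℝ (Fin m₀) → _)
      (K : Fin d₀ → EuclideanSpace ℝ (Fin m₀) → (Fin m₁ → ℝ) →L[ℝ] (Fin m₁ → ℝ))
      (w : Fin d₁ → EuclideanSpace ℝ (Fin m₀) → Fin m₁ → ℝ), p ∈ U' ∧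
      c'.IsAdapted D X' Y' (firstCoord Λ) (firstCoord Λ') v K w := by
  choose v hv hXv using fun i => c.exists_hasSymbol (hD.degree_even i)
  choose w hw hYw using fun j => c.exists_hasOddSymbol (hD.degree_odd j)
  have hvi := linearIndependent_symbol hD.degree_even hXv hX
  have hwi := linearIndependent_oddSymbol hD.degree_odd hYw hY
  have h₀ : d₀ ≤ m₀ := by
    have := hvi.fintype_card_le_finrank
    rwa [Fintype.card_fin, finrank_euclideanSpace_fin] at this
  have h₁ : d₁ ≤ m₁ := by
    have := hwi.fintype_card_le_finrank
    rwa [Fintype.card_fin, Module.finrank_fin_fun] at this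
  obtain ⟨Λ, hΛ⟩ := exists_equiv_apply_eq_single finrank_euclideanSpace_fin h₀ hvi
  obtain ⟨Λ', hΛ'⟩ := exists_equiv_apply_eq_single (Module.finrank_fin_fun ℝ) h₁ hwi
  let N : Set (EuclideanSpace ℝ (Fin m₀)) :=
    (c.chart.target ∩ (fun y => (Matrix.of fun i j => firstCoord Λ j (v i y)).det) ⁻¹' {0}ᶜ) ∩
    (c.chart.target ∩ (fun y => (Matrix.of fun i j => firstCoord Λ' j (w i y)).det) ⁻¹' {0}ᶜ)
  have hN : IsOpen N :=
    ((continuousOn_det_dual (fun i => (hv i).continuousOn) _).isOpen_inter_preimage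
      c.chart.open_target isOpen_compl_singleton).inter
    ((continuousOn_det_dual (fun i => (hw i).continuousOn) _).isOpen_inter_preimage
      c.chart.open_target isOpen_compl_singleton)
  have hpt := c.chart_mem_target ⟨p, hp⟩
  have hpN : c.chart p ∈ N := by
    have h2 : (Matrix.of fun i j => firstCoord Λ j (v i (c.chart p))) = 1 := by
      ext i j
      rw [Matrix.of_apply, firstCoord_apply]
      refine (congrFun (congrArg Prod.fst (hΛ i)) j).trans ?_
      rw [Matrix.one_apply]
      change (Pi.single i 1 : Fin d₀ → ℝ) j = _
      rw [Pi.single_apply]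
      exact if_congr eq_comm rfl rfl
    have h3 : (Matrix.of fun i j => firstCoord Λ' j (w i (c.chart p))) = 1 := by
      ext i j
      rw [Matrix.of_apply, firstCoord_apply]
      refine (congrFun (congrArg Prod.fst (hΛ' i)) j).trans ?_
      rw [Matrix.one_apply]
      change (Pi.single i 1 : Fin d₁ → ℝ) j = _
      rw [Pi.single_apply]
      exact if_congr eq_comm rfl rfl
    refine ⟨⟨hpt, ?_⟩, hpt, ?_⟩
    · rw [mem_preimage, h2, Matrix.det_one]
      exact one_ne_zero
    · rw [mem_preimage, h3, Matrix.det_one]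
      exact one_ne_zero
  obtain ⟨U', h, c', hc', hmem, htN⟩ := c.exists_restrict hN
  obtain ⟨X', Y', hf', hX', hY'⟩ := hD.exists_restrict h
  obtain ⟨X'', Y'', v', K', w', hfin⟩ := c'.exists_isAdapted hf'
    (fun i => (hXv i).restrict hc' (hX' i)) (fun j => (hYw j).restrict hc' (hY' j))
    (fun i => (hv i).mono hc'.target_subset) (fun j => (hw j).mono hc'.target_subset)
    (ℓ := firstCoord Λ) (μ := firstCoord Λ')
    (fun y hy => (htN hy).1.2) (fun y hy => (htN hy).2.2)
  exact ⟨h₀, h₁, Λ, Λ', U', c', X'', Y'', v', K', w', hmem p hp hpN, hfin⟩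

/-- The Frobenius theorem for adapted vector fields. -/
theorem IsAdapted.exists_coordinates {c : Coordinates m₀ F E m₁ U} {p : M} (hp : p ∈ U)
    (h₀ : d₀ ≤ m₀) (h₁ : d₁ ≤ m₁)
    {Λ : EuclideanSpace ℝ (Fin m₀) ≃L[ℝ] (Fin d₀ → ℝ) × ({α : Fin m₀ // d₀ ≤ α} → ℝ)}
    {Λ' : (Fin m₁ → ℝ) ≃L[ℝ] (Fin d₁ → ℝ) × ({β : Fin m₁ // d₁ ≤ β} → ℝ)}
    {v : Fin d₀ → EuclideanSpace ℝ (Fin m₀) → EuclideanSpace ℝ (Fin m₀)}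
    {K : Fin d₀ → EuclideanSpace ℝ (Fin m₀) → (Fin m₁ → ℝ) →L[ℝ] (Fin m₁ → ℝ)}
    {w : Fin d₁ → EuclideanSpace ℝ (Fin m₀) → Fin m₁ → ℝ}
    (hc : c.IsAdapted D X Y (firstCoord Λ) (firstCoord Λ') v K w) (hD : D.IsInvolutive) :
    ∃ U' : Opens M, p ∈ U' ∧ ∃ c' : Coordinates m₀ F E m₁ U',
      D.sections U' = Submodule.span (functions m₀ F E U')
        (Set.range (fun a : Fin d₀ => c'.partialX (Fin.castLE h₀ a)) ∪
          Set.range (fun b : Fin d₁ => c'.partialE (Fin.castLE h₁ b))) := by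
  -- Involutivity enters here only, as the three identities on symbols and on forms vanishing on the
  -- w_j.
  obtain ⟨Ψ, η, hΨp, -, hΨ, hΨ', hη, hfin⟩ := exists_flat_coordinates c.chart.open_target
    hc.contDiffOn_symbol hc.contDiffOn_connection hc.contDiffOn_oddSymbol hc.dual_even hc.dual_odd
    (fun i j y hy => hc.fderiv_symbol_comm hD i j hy)
    (fun ξ hξ h i j y hy => hc.nabla_apply_oddSymbol hD hξ h i j hy)
    (fun ξ hξ h i j y hy => hc.nabla_comm hD hξ h i j hy) (c.chart_mem_target ⟨p, hp⟩)
  obtain ⟨U', h, c', hc', hmem, htN⟩ :=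
    c.exists_restrict (Ψ.open_source.preimage Λ.continuous)
  obtain ⟨X', Y', hX'⟩ := hc.restrict hc'
  obtain ⟨c'', h1, h2, h3⟩ := exists_coordinates_of_flat h₀ h₁ hX' (fun y hy => htN hy) hΨ hΨ'
    (hη.mono htN) (fun y hy => (hfin y (htN hy)).1) (fun y hy => (hfin y (htN hy)).2.1)
    (fun y hy => (hfin y (htN hy)).2.2.1) (fun y hy => (hfin y (htN hy)).2.2.2)
  exact ⟨U', hmem p hp hΨp, c'', sections_eq_span hX'.isLocalFrame h₀ h₁ h1 h2 h3⟩

end Coordinates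

end

end DegreeOne

theorem mainTheorem8 (m₀ m₁ d₀ d₁ : ℕ) {M : Type*} [TopologicalSpace M] [T2Space M]
    [ChartedSpace (EuclideanSpace ℝ (Fin m₀)) M] [IsManifold (𝓡 m₀) ∞ M]
    {F : Type*} [NormedAddCommGroup F] [NormedSpace ℝ F] [FiniteDimensional ℝ F]
    (hF : Module.finrank ℝ F = m₁)
    {E : M → Type*} [∀ p, AddCommGroup (E p)] [∀ p, Module ℝ (E p)]
    [∀ p, TopologicalSpace (E p)] [TopologicalSpace (Bundle.TotalSpace F E)]
    [FiberBundle F E] [VectorBundle ℝ F E] [ContMDiffVectorBundle ∞ F E (𝓡 m₀)]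
    (D : DegreeOne.Distribution m₀ F E d₀ d₁) (hD : D.IsInvolutive) (p : M) :
    ∃ (h₀ : d₀ ≤ m₀) (h₁ : d₁ ≤ m₁) (U : TopologicalSpace.Opens M) (_ : p ∈ U)
      (c : DegreeOne.Coordinates m₀ F E m₁ U)
      (X : Fin m₀ → DegreeOne.Endo m₀ F E U) (Y : Fin m₁ → DegreeOne.Endo m₀ F E U),
      (∀ α, c.IsPartialX α (X α)) ∧ (∀ β, c.IsPartialE β (Y β)) ∧
      D.sections U = Submodule.span (DegreeOne.functions m₀ F E U)
        (Set.range (fun a : Fin d₀ => X (Fin.castLE h₀ a)) ∪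
          Set.range (fun b : Fin d₁ => Y (Fin.castLE h₁ b))) := by
  obtain ⟨U, hp, c, X, Y, hf, hX, hY⟩ := D.exists_isLocalFrame hF p
  obtain ⟨h₀, h₁, Λ, Λ', U', c', X', Y', v, K, w, hp', hc⟩ :=
    DegreeOne.Coordinates.exists_isAdapted_nhds (c := c) hp hf hX hY
  obtain ⟨U'', hp'', c'', h⟩ := hc.exists_coordinates hp' h₀ h₁ hD
  exact ⟨h₀, h₁, U'', hp'', c'', c''.partialX, c''.partialE, c''.isPartialX_partialX,
    c''.isPartialE_partialE, h⟩
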